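/- **The type theory COMET.** Fix a set $\mathbf C$ of type constants. Types are $A ::= c\in\mathbf C \mid 0\mid 1\mid A+B\mid A\otimes B$. Terms, up to renaming of bound variables, are $$t ::= x \mid * \mid s\otimes t \mid \mathsf{let}\ x\otimes y=s\ \mathsf{in}\ t \mid {}!t \mid \mathsf{inl}\,t \mid \mathsf{inr}\,t \mid \mathsf{case}\ r\ \mathsf{of}\ \mathsf{inl}\,x\mapsto s\mid \mathsf{inr}\,y\mapsto t \mid \langle\!\langle s,t\rangle\!\rangle \mid \mathsf{left}\,t \mid \mathsf{instr}_{\lambda x t}(s) \mid 1/n \mid \mathsf{norm}\,t \mid s\oplus t \mid b_{m,n},$$ with $n\ge 2$ and, in $b_{m,n}$, $1\le m<n$. Contexts $\Gamma$ are finite assignments of types to distinct variables, in any order; $\Gamma,\Delta$ is a union of disjoint contexts. Judgements are $\Gamma\vdash t:A$, $\Gamma\vdash s=t:A$ and $\Gamma\vdash s\le t:A+1$. *Abbreviations.* $0\cdot A=0$, $1\cdot A=A$, $(n+1)\cdot A=n\cdot A+A$, with injections $\mathsf{in}^n_i$; $\mathbf n=n\cdot 1$; $\mathbf 2=1+1$;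 $\top=\mathsf{inl}\,*$, $\bot=\mathsf{inr}\,*$; $\mathsf{return}\,t=\mathsf{inl}\,t$, $\mathsf{fail}=\mathsf{inr}\,*$; $\mathsf{do}\ x\leftarrow s;t$ is $\mathsf{case}\ s\ \mathsf{of}\ \mathsf{inl}\,x\mapsto t\mid\mathsf{inr}\,\_\mapsto\mathsf{fail}$; $\mathsf{inl}?(t)=t{\downarrow}$ is $\mathsf{case}\ t\ \mathsf{of}\ \mathsf{inl}\,\_\mapsto\top\mid\mathsf{inr}\,\_\mapsto\bot$, and $t{\uparrow}$ is the same with $\top,\bot$ exchanged. On $n\cdot A$, by $n$-fold case distinction, $\nabla$ sends $\mathsf{in}_i(x)$ to $x$, $\mathsf{ind}$ sends $\mathsf{in}_i(x)$ to $\mathsf{in}_i(*):\mathbf n$, and $\rhd_i$ sends $\mathsf{in}_i(x)$ to $\mathsf{return}\,x$ and $\mathsf{in}_j(x)$ to $\mathsf{fail}$ for $j\ne i$. $0\cdot t=\mathsf{fail}$, $1\cdot t=t$, $(n+1)\cdot t=(n\cdot t)\oplus t$. $\mathsf{assert}_{\lambda x p}(t)=\rhd_1(\mathsf{instr}_{\lambda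 x p}(t))$. *Rules.* (a) Variables; equality is reflexive on typed terms, symmetric and transitive; $*:1$, and $t=*$ for $t:1$; if $\Gamma\vdash s:0$ then $\Gamma\vdash {}!s:A$ for every $A$, and ${}!s=t$ for every $\Gamma\vdash t:A$. The usual introduction, elimination, congruence, $\beta$- and $\eta$-rules for $\otimes$ and $+$, where the subterms of $\otimes$ have disjoint contexts, as have the scrutinee and the branches of $\mathsf{let}$ and $\mathsf{case}$ (the two branches of $\mathsf{case}$ share theirs); the commuting conversions of $\mathsf{let}$ out of the scrutinee of a $\mathsf{let}$ and out of the left component of a pair, and of $\mathsf{case}$ out of the scrutinee of a $\mathsf{case}$ or a $\mathsf{let}$ and out of the left component of a pair. (b) If $\Gamma\vdash s:A+1$, $\Gamma\vdash t:B+1$ and $\Gamma\vdash s{\downarrow}=t{\uparrow}:\mathbf 2$ then $\Gamma\vdash\langle\!\langle s,t\rangle\!\rangle:A+B$, with $\rhd_1\langle\!\langle s,t\rangle\!\rangle=s$, $\rhd_2\langle\!\langle s,t\rangle\!\rangle=t$; $\langle\!\langle\rhd_1t,\rhd_2t\rangle\!\rangle=t$ for $t:A+B$; congruence. If $\Gamma\vdash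 t:A+B$ and $\Gamma\vdash\mathsf{inl}?(t)=\top:\mathbf 2$ then $\Gamma\vdash\mathsf{left}\,t:A$ and $\mathsf{inl}(\mathsf{left}\,t)=t$; $\mathsf{left}(\mathsf{inl}\,t)=t$; congruence. (c) For $\Gamma\vdash b:(A+A)+1$ put $b_i=\mathsf{do}\ x\leftarrow b;\rhd_i(x)$ and $b_\nabla=\mathsf{do}\ x\leftarrow b;\mathsf{return}\,\nabla(x)$. If $b_1=c_1$ and $b_2=c_2$ then $b=c$. If $b_1=s$ and $b_\nabla=t$ then $\Gamma\vdash s\le t:A+1$. If $b_1=s$ and $b_2=t$ then $\Gamma\vdash s\oplus t:A+1$ and $s\oplus t=b_\nabla$. (d) If $x:A\vdash t:\mathbf n$ and $\Gamma\vdash s:A$ then $\Gamma\vdash\mathsf{instr}_{\lambda xt}(s):n\cdot A$, with $\nabla(\mathsf{instr}_{\lambda xt}(s))=s$ and $\mathsf{ind}(\mathsf{instr}_{\lambda xt}(s))=t[x:=s]$; if $x:A\vdash t:n\cdot A$ and $x:A\vdash\nabla(t)=x:A$ then $\mathsf{instr}_{\lambda x\,\mathsf{ind}(t)}(s)=t[x:=s]$;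 congruence; for $x:A\vdash p,q:\mathbf 2$ and $\Gamma\vdash t:A$, $\mathsf{do}\ x\leftarrow\mathsf{assert}_{\lambda xp}(t);\mathsf{assert}_{\lambda xq}(x)=\mathsf{do}\ x\leftarrow\mathsf{assert}_{\lambda xq}(t);\mathsf{assert}_{\lambda xp}(x)$. (e) For $n\ge2$: $1/n:\mathbf 2$; $n\cdot(1/n)=\top$; if $\Gamma\vdash t:\mathbf 2$ and $\Gamma\vdash n\cdot t=\top:\mathbf 2$ then $\Gamma\vdash t=1/n:\mathbf 2$. For $1\le m<n$: $b_{m,n}:\mathbf 3$, $\rhd_1(b_{m,n})=m\cdot(1/n)$, $\rhd_2(b_{m,n})=1/n$. (f) If $\vdash t:A+1$ and $\vdash1/n\le t{\downarrow}:\mathbf 2$ with $n\ge2$, then $\Gamma\vdash\mathsf{norm}\,t:A$ and $\mathsf{do}\ \_\leftarrow t;\mathsf{return}(\mathsf{norm}\,t)=t$; if moreover $\vdash\rho:A$ and $\vdash t=\mathsf{do}\ \_\leftarrow t;\mathsf{return}\,\rho:A+1$, then $\Gamma\vdash\rho=\mathsf{norm}\,t:A$. *Sequential product.* For $x:A\vdash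 p,q:\mathbf 2$ put $p\mathrel{\&}q=\mathsf{do}\ x\leftarrow\mathsf{assert}_{\lambda xp}(x);q$. For closed $p,q:\mathbf 2$ (scalars) put $p\mathrel{\&}q=\mathsf{do}\ \_\leftarrow\mathsf{assert}_{\lambda\_p}(*);q$. *Rationals.* A rational $q\in[0,1]$ is represented by every term $m\cdot(1/n)$ with $m\ge0$, $n\ge2$ and $q=m/n$. **Lemma.** Let $q,r$ be rational numbers in $[0,1]$. Below, $q$, $r$, $q+r$, $qr$ also denote arbitrary terms representing these rationals. 1. If $q\le r$, then $\vdash q\le r:\mathbf 2$ is derivable. 2. $\vdash q\oplus r:\mathbf 2$ is derivable if and only if $q+r\le1$, in which case $\Gamma\vdash q\oplus r=q+r:\mathbf 2$ is derivable for every context $\Gamma$. 3. $\vdash q\mathrel{\&}r=qr:\mathbf 2$ is derivable; likewise $x:A\vdash q\mathrel{\&}r=qr:\mathbf 2$ for every type $A$, when $q,r$ are regarded as constant predicates on $A$. -/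

import Mathlib

/-! The type theory COMET (a linear type theory for probabilistic reasoning): types, terms,
defined constructions, and the rules of deduction. -/

namespace COMET

universe u

/-- Types over a set `C` of type constants: `C ∣ 0 ∣ 1 ∣ A + B ∣ A ⊗ B`. -/
inductive Ty (C : Type u) : Type u where
  | const (c : C) : Ty C
  | zero : Ty C
  | one : Ty C
  | sum (A B : Ty C) : Ty C
  | tensor (A B : Ty C) : Ty C

/-- The copower `n · A`: `0 · A = 0`, `1 · A = A`, `(n + 1) · A = n · A + A`. -/
def Ty.copower {C : Type u} : ℕ → Ty C → Ty C
  | 0, _ => .zero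
  | 1, A => A
  | n + 2, A => .sum (Ty.copower (n + 1) A) A

/-- The finite type `𝐧 = n · 1`. -/
def Ty.fin {C : Type u} (n : ℕ) : Ty C := Ty.copower n .one

/-- The type `𝟐 = 1 + 1` of predicates and scalars. -/
def Ty.two {C : Type u} : Ty C := .sum .one .one

/-- The type `A + 1` of partial computations of an `A`. -/
def Ty.part {C : Type u} (A : Ty C) : Ty C := .sum A .one

/-- Raw terms, up to renaming of bound variables: variables are de Bruijn indices. -/
inductive Tm : Type where
  /-- the variable with de Bruijn index `i` -/
  | var (i : ℕ) : Tm
  /-- `*` -/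
  | star : Tm
  /-- `s ⊗ t` -/
  | pair (s t : Tm) : Tm
  /-- `let x ⊗ y = s in t`; in `t`, index `1` is `x` and index `0` is `y` -/
  | lett (s t : Tm) : Tm
  /-- the eliminator of the empty type -/
  | magic (t : Tm) : Tm
  /-- `inl t` -/
  | inl (t : Tm) : Tm
  /-- `inr t` -/
  | inr (t : Tm) : Tm
  /-- `case r of inl x ↦ s ∣ inr y ↦ t`; index `0` is `x` in `s`, and `y` in `t` -/
  | caseOf (r s t : Tm) : Tm
  /-- the partial pairing `⟨⟨s, t⟩⟩` -/
  | inlr (s t : Tm) : Tm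
  /-- `left t` -/
  | left (t : Tm) : Tm
  /-- `instr_{λ x. t} (s)`; in `t`, index `0` is `x` -/
  | instr (t s : Tm) : Tm
  /-- the constant `1 / n`; only typable for `2 ≤ n` -/
  | oneOver (n : ℕ) : Tm
  /-- `norm t` -/
  | norm (t : Tm) : Tm
  /-- the partial sum `s ⊕ t` (written as a circled "or") -/
  | osum (s t : Tm) : Tm
  /-- the constant `b_{m,n}`, a bound for the sum `m · (1 / n) ⊕ 1 / n`;
  only typable for `1 ≤ m < n` -/
  | bound (m n : ℕ) : Tm

namespace Tm

/-- A renaming, moved under one binder. -/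
def upr (f : ℕ → ℕ) : ℕ → ℕ
  | 0 => 0
  | i + 1 => f i + 1

/-- Renaming of the free variables. -/
def rename (f : ℕ → ℕ) : Tm → Tm
  | var i => var (f i)
  | star => star
  | pair s t => pair (s.rename f) (t.rename f)
  | lett s t => lett (s.rename f) (t.rename (upr (upr f)))
  | magic t => magic (t.rename f)
  | inl t => inl (t.rename f)
  | inr t => inr (t.rename f)
  | caseOf r s t => caseOf (r.rename f) (s.rename (upr f)) (t.rename (upr f))
  | inlr s t => inlr (s.rename f) (t.rename f)
  | left t => left (t.rename f)
  | instr t s => instr (t.rename (upr f)) (s.rename f)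
  | oneOver n => oneOver n
  | norm t => norm (t.rename f)
  | osum s t => osum (s.rename f) (t.rename f)
  | bound m n => bound m n

/-- `t`, read under one additional binder that does not occur in it. -/
def shift (t : Tm) : Tm := t.rename Nat.succ

/-- `t` under one binder (index `0`), read with one additional variable, not occurring in `t`,
bound just outside that binder. -/
def shiftUnder (t : Tm) : Tm := t.rename (upr Nat.succ)

/-- `t` under two binders (indices `0`, `1`), read with one additional variable, not occurring in
`t`, bound just outside these binders. -/
def shiftUnderTwo (t : Tm) : Tm := t.rename (upr (upr Nat.succ))

/-- A substitution, moved under one binder. -/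
def ups (σ : ℕ → Tm) : ℕ → Tm
  | 0 => var 0
  | i + 1 => (σ i).shift

/-- Simultaneous capture-avoiding substitution. -/
def subst (σ : ℕ → Tm) : Tm → Tm
  | var i => σ i
  | star => star
  | pair s t => pair (s.subst σ) (t.subst σ)
  | lett s t => lett (s.subst σ) (t.subst (ups (ups σ)))
  | magic t => magic (t.subst σ)
  | inl t => inl (t.subst σ)
  | inr t => inr (t.subst σ)
  | caseOf r s t => caseOf (r.subst σ) (s.subst (ups σ)) (t.subst (ups σ))
  | inlr s t => inlr (s.subst σ) (t.subst σ)
  | left t => left (t.subst σ)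
  | instr t s => instr (t.subst (ups σ)) (s.subst σ)
  | oneOver n => oneOver n
  | norm t => norm (t.subst σ)
  | osum s t => osum (s.subst σ) (t.subst σ)
  | bound m n => bound m n

/-- `s` for index `0`, the other indices drop by one. -/
def scons (s : Tm) (σ : ℕ → Tm) : ℕ → Tm
  | 0 => s
  | i + 1 => σ i

/-- `t[x := s]`, where `x` is index `0`. -/
def inst (t s : Tm) : Tm := t.subst (scons s var)

/-- `t[x := r, y := s]`, where `x` is index `1` and `y` is index `0`. -/
def instTwo (t r s : Tm) : Tm := t.subst (scons s (scons r var))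

/-- `⊤ = inl *`. -/
def top : Tm := inl star

/-- `⊥ = inr *`. -/
def bot : Tm := inr star

/-- `return t = inl t`. -/
def ret (t : Tm) : Tm := inl t

/-- `fail = inr *`. -/
def fail : Tm := inr star

/-- `do x ← s; t`, where `x` is index `0` in `t`. -/
def doo (s t : Tm) : Tm := caseOf s t fail

/-- `inl?(t)`, which is also the domain predicate `t↓` of `t : A + 1`. -/
def isInl (t : Tm) : Tm := caseOf t top bot

/-- `inr?(t)`, which is also the kernel predicate `t↑` of `t : A + 1`. -/
def isInr (t : Tm) : Tm := caseOf t bot top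

/-- The `i`-th constructor `in_i^n(t)` of an `n`-fold sum (`1 ≤ i ≤ n`). -/
def inj : ℕ → ℕ → Tm → Tm
  | 0, _, t => t
  | 1, _, t => t
  | n + 2, i, t => if i = n + 2 then inr t else inl (inj (n + 1) i t)

/-- `case_{i=1}^n t of in_i^n(x) ↦ f i`, where `x` is index `0` in each `f i`. -/
def ncase : ℕ → Tm → (ℕ → Tm) → Tm
  | 0, t, _ => magic t
  | 1, t, f => (f 1).inst t
  | n + 2, t, f => caseOf t (ncase (n + 1) (var 0) fun i => (f i).shiftUnder) (f (n + 2))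

/-- The codiagonal `∇(t) : A` of `t : n · A`. -/
def nabla (n : ℕ) (t : Tm) : Tm := ncase n t fun _ => var 0

/-- `ind(t) : 𝐧` for `t : n · A`. -/
def ind (n : ℕ) (t : Tm) : Tm := ncase n t fun i => inj n i star

/-- The partial projection `▷_i^n(t) : A + 1` of `t : n · A`. -/
def proj (n i : ℕ) (t : Tm) : Tm := ncase n t fun j => if j = i then ret (var 0) else fail

/-- `b >>= ▷₁`. -/
def bindFst (b : Tm) : Tm := doo b (proj 2 1 (var 0))

/-- `b >>= ▷₂`. -/
def bindSnd (b : Tm) : Tm := doo b (proj 2 2 (var 0))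

/-- `do x ← b; return ∇(x)`, for `b : (A + A) + 1`. -/
def bindNabla (b : Tm) : Tm := doo b (ret (nabla 2 (var 0)))

/-- `n · t = t ⊕ ⋯ ⊕ t`, with `0 · t = fail` and `1 · t = t`. -/
def times : ℕ → Tm → Tm
  | 0, _ => fail
  | 1, t => t
  | n + 2, t => osum (times (n + 1) t) t

/-- `assert_{λ x. p}(t)`, where `x` is index `0` in `p`. -/
def assert (p t : Tm) : Tm := caseOf (instr p t) (ret (var 0)) fail

/-- The sequential product `p & q = do x ← assert_{λ x. p}(x); q` of two predicates in the
variable `x` with index `0`. -/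
def seqProd (p q : Tm) : Tm := doo (assert p.shiftUnder (var 0)) q.shiftUnder

/-- The sequential product `p & q = do _ ← assert_{λ _. p}(*); q` of two scalars, which are
regarded as predicates on the type `1`, at `* : 1`. -/
def scalarProd (p q : Tm) : Tm := doo (assert p.shift star) q.shift

end Tm

/-- A context, as a partial map from variables to types; so the order of the variables is
immaterial and no exchange rule is needed. From a context with finite domain,
the rules below only ever lead to contexts with finite domain. -/
abbrev Ctx (C : Type u) : Type u := ℕ → Option (Ty C)

namespace Ctx

variable {C : Type u}

/-- The empty context. -/
def empty : Ctx C := fun _ => none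

/-- `Γ, x : A`, where the new variable `x` gets index `0`. -/
def cons (Γ : Ctx C) (A : Ty C) : Ctx C
  | 0 => some A
  | i + 1 => Γ i

/-- `Ξ` is the context `Γ, Δ`, the union of the disjoint contexts `Γ` and `Δ`. -/
def Split (Ξ Γ Δ : Ctx C) : Prop :=
  ∀ i, (Γ i = Ξ i ∧ Δ i = none) ∨ (Γ i = none ∧ Δ i = Ξ i)

end Ctx

/-- The right-hand sides of judgements: `t : A`, `s = t : A` and `s ≤ t : A`. -/
inductive Jdg (C : Type u) : Type u where
  | ty (t : Tm) (A : Ty C) : Jdg C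
  | eq (s t : Tm) (A : Ty C) : Jdg C
  | le (s t : Tm) (A : Ty C) : Jdg C

open Tm Jdg

/-- `Der Γ J`: the judgement `Γ ⊢ J` is derivable. -/
inductive Der {C : Type u} : Ctx C → Jdg C → Prop where
  -- structural rules
  | var {Γ : Ctx C} {i : ℕ} {A : Ty C} : Γ i = some A → Der Γ (ty (var i) A)
  | ref {Γ : Ctx C} {t : Tm} {A : Ty C} : Der Γ (ty t A) → Der Γ (eq t t A)
  | sym {Γ : Ctx C} {s t : Tm} {A : Ty C} : Der Γ (eq s t A) → Der Γ (eq t s A)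
  | trans {Γ : Ctx C} {r s t : Tm} {A : Ty C} :
      Der Γ (eq r s A) → Der Γ (eq s t A) → Der Γ (eq r t A)
  -- the singleton type
  | unit {Γ : Ctx C} : Der Γ (ty star .one)
  | etaOne {Γ : Ctx C} {t : Tm} : Der Γ (ty t .one) → Der Γ (eq star t .one)
  -- tensor product
  | pair {Ξ Γ Δ : Ctx C} {s t : Tm} {A B : Ty C} : Ξ.Split Γ Δ →
      Der Γ (ty s A) → Der Δ (ty t B) → Der Ξ (ty (pair s t) (.tensor A B))
  | lett {Ξ Γ Δ : Ctx C} {s t : Tm} {A B D : Ty C} : Ξ.Split Γ Δ →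
      Der Γ (ty s (.tensor A B)) → Der ((Δ.cons A).cons B) (ty t D) →
      Der Ξ (ty (lett s t) D)
  | pairEq {Ξ Γ Δ : Ctx C} {s s' t t' : Tm} {A B : Ty C} : Ξ.Split Γ Δ →
      Der Γ (eq s s' A) → Der Δ (eq t t' B) →
      Der Ξ (eq (pair s t) (pair s' t') (.tensor A B))
  | lettEq {Ξ Γ Δ : Ctx C} {s s' t t' : Tm} {A B D : Ty C} : Ξ.Split Γ Δ →
      Der Γ (eq s s' (.tensor A B)) → Der ((Δ.cons A).cons B) (eq t t' D) →
      Der Ξ (eq (lett s t) (lett s' t') D)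
  | betaPair {Ξ Γ ΔΘ Δ Θ : Ctx C} {r s t : Tm} {A B D : Ty C} :
      Ξ.Split Γ ΔΘ → ΔΘ.Split Δ Θ →
      Der Γ (ty r A) → Der Δ (ty s B) → Der ((Θ.cons A).cons B) (ty t D) →
      Der Ξ (eq (lett (pair r s) t) (t.instTwo r s) D)
  | etaPair {Γ : Ctx C} {t : Tm} {A B : Ty C} : Der Γ (ty t (.tensor A B)) →
      Der Γ (eq (lett t (pair (var 1) (var 0))) t (.tensor A B))
  | letLet {Ξ Γ ΔΘ Δ Θ : Ctx C} {r s t : Tm} {A B A' B' D : Ty C} :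
      Ξ.Split Γ ΔΘ → ΔΘ.Split Δ Θ →
      Der Γ (ty r (.tensor A B)) → Der ((Δ.cons A).cons B) (ty s (.tensor A' B')) →
      Der ((Θ.cons A').cons B') (ty t D) →
      Der Ξ (eq (lett (lett r s) t) (lett r (lett s t.shiftUnderTwo.shiftUnderTwo)) D)
  | letPair {Ξ Γ ΔΘ Δ Θ : Ctx C} {r s t : Tm} {A B A' B' : Ty C} :
      Ξ.Split Γ ΔΘ → ΔΘ.Split Δ Θ →
      Der Γ (ty r (.tensor A B)) → Der ((Δ.cons A).cons B) (ty s A') → Der Θ (ty t B') →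
      Der Ξ (eq (pair (lett r s) t) (lett r (pair s t.shift.shift)) (.tensor A' B'))
  -- empty type
  | magic {Γ : Ctx C} {t : Tm} {A : Ty C} : Der Γ (ty t .zero) → Der Γ (ty (magic t) A)
  | etaZero {Γ : Ctx C} {s t : Tm} {A : Ty C} :
      Der Γ (ty s .zero) → Der Γ (ty t A) → Der Γ (eq (magic s) t A)
  -- binary coproducts
  | inl {Γ : Ctx C} {t : Tm} {A B : Ty C} : Der Γ (ty t A) → Der Γ (ty (inl t) (.sum A B))
  | inr {Γ : Ctx C} {t : Tm} {A B : Ty C} : Der Γ (ty t B) → Der Γ (ty (inr t) (.sum A B))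
  | inlEq {Γ : Ctx C} {s t : Tm} {A B : Ty C} :
      Der Γ (eq s t A) → Der Γ (eq (inl s) (inl t) (.sum A B))
  | inrEq {Γ : Ctx C} {s t : Tm} {A B : Ty C} :
      Der Γ (eq s t B) → Der Γ (eq (inr s) (inr t) (.sum A B))
  | caseOf {Ξ Γ Δ : Ctx C} {r s t : Tm} {A B D : Ty C} : Ξ.Split Γ Δ →
      Der Γ (ty r (.sum A B)) → Der (Δ.cons A) (ty s D) → Der (Δ.cons B) (ty t D) →
      Der Ξ (ty (caseOf r s t) D)
  | caseEq {Ξ Γ Δ : Ctx C} {r r' s s' t t' : Tm} {A B D : Ty C} : Ξ.Split Γ Δ →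
      Der Γ (eq r r' (.sum A B)) → Der (Δ.cons A) (eq s s' D) → Der (Δ.cons B) (eq t t' D) →
      Der Ξ (eq (caseOf r s t) (caseOf r' s' t') D)
  | betaInl {Ξ Γ Δ : Ctx C} {r s t : Tm} {A B D : Ty C} : Ξ.Split Γ Δ →
      Der Γ (ty r A) → Der (Δ.cons A) (ty s D) → Der (Δ.cons B) (ty t D) →
      Der Ξ (eq (caseOf (inl r) s t) (s.inst r) D)
  | betaInr {Ξ Γ Δ : Ctx C} {r s t : Tm} {A B D : Ty C} : Ξ.Split Γ Δ →
      Der Γ (ty r B) → Der (Δ.cons A) (ty s D) → Der (Δ.cons B) (ty t D) →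
      Der Ξ (eq (caseOf (inr r) s t) (t.inst r) D)
  | etaSum {Γ : Ctx C} {t : Tm} {A B : Ty C} : Der Γ (ty t (.sum A B)) →
      Der Γ (eq (caseOf t (inl (var 0)) (inr (var 0))) t (.sum A B))
  | caseCase {Ξ Γ ΔΘ Δ Θ : Ctx C} {r s s' t t' : Tm} {A B A' B' D : Ty C} :
      Ξ.Split Γ ΔΘ → ΔΘ.Split Δ Θ → Der Γ (ty r (.sum A B)) →
      Der (Δ.cons A) (ty s (.sum A' B')) → Der (Δ.cons B) (ty s' (.sum A' B')) →
      Der (Θ.cons A') (ty t D) → Der (Θ.cons B') (ty t' D) →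
      Der Ξ (eq (caseOf (caseOf r s s') t t')
        (caseOf r (caseOf s t.shiftUnder t'.shiftUnder)
          (caseOf s' t.shiftUnder t'.shiftUnder)) D)
  | casePair {Ξ Γ ΔΘ Δ Θ : Ctx C} {r s s' t : Tm} {A B A' B' : Ty C} :
      Ξ.Split Γ ΔΘ → ΔΘ.Split Δ Θ → Der Γ (ty r (.sum A B)) →
      Der (Δ.cons A) (ty s A') → Der (Δ.cons B) (ty s' A') → Der Θ (ty t B') →
      Der Ξ (eq (pair (caseOf r s s') t)
        (caseOf r (pair s t.shift) (pair s' t.shift)) (.tensor A' B'))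
  | letCase {Ξ Γ ΔΘ Δ Θ : Ctx C} {r s s' t : Tm} {A B A' B' D : Ty C} :
      Ξ.Split Γ ΔΘ → ΔΘ.Split Δ Θ → Der Γ (ty r (.sum A B)) →
      Der (Δ.cons A) (ty s (.tensor A' B')) → Der (Δ.cons B) (ty s' (.tensor A' B')) →
      Der ((Θ.cons A').cons B') (ty t D) →
      Der Ξ (eq (lett (caseOf r s s') t)
        (caseOf r (lett s t.shiftUnderTwo) (lett s' t.shiftUnderTwo)) D)
  -- partial pairing
  | inlr {Γ : Ctx C} {s t : Tm} {A B : Ty C} :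
      Der Γ (ty s A.part) → Der Γ (ty t B.part) → Der Γ (eq (isInl s) (isInr t) .two) →
      Der Γ (ty (inlr s t) (.sum A B))
  | inlrEq {Γ : Ctx C} {s s' t t' : Tm} {A B : Ty C} :
      Der Γ (eq s s' A.part) → Der Γ (eq t t' B.part) → Der Γ (eq (isInl s) (isInr t) .two) →
      Der Γ (eq (inlr s t) (inlr s' t') (.sum A B))
  | betaInlrOne {Γ : Ctx C} {s t : Tm} {A B : Ty C} :
      Der Γ (ty s A.part) → Der Γ (ty t B.part) → Der Γ (eq (isInl s) (isInr t) .two) →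
      Der Γ (eq (proj 2 1 (inlr s t)) s A.part)
  | betaInlrTwo {Γ : Ctx C} {s t : Tm} {A B : Ty C} :
      Der Γ (ty s A.part) → Der Γ (ty t B.part) → Der Γ (eq (isInl s) (isInr t) .two) →
      Der Γ (eq (proj 2 2 (inlr s t)) t B.part)
  | etaInlr {Γ : Ctx C} {t : Tm} {A B : Ty C} : Der Γ (ty t (.sum A B)) →
      Der Γ (eq (inlr (proj 2 1 t) (proj 2 2 t)) t (.sum A B))
  -- the `left` construction
  | left {Γ : Ctx C} {t : Tm} {A B : Ty C} :
      Der Γ (ty t (.sum A B)) → Der Γ (eq (isInl t) top .two) → Der Γ (ty (left t) A)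
  | leftEq {Γ : Ctx C} {s t : Tm} {A B : Ty C} :
      Der Γ (eq s t (.sum A B)) → Der Γ (eq (isInl s) top .two) →
      Der Γ (eq (left s) (left t) A)
  | betaLeft {Γ : Ctx C} {t : Tm} {A B : Ty C} :
      Der Γ (ty t (.sum A B)) → Der Γ (eq (isInl t) top .two) →
      Der Γ (eq (inl (left t)) t (.sum A B))
  | etaLeft {Γ : Ctx C} {t : Tm} {A : Ty C} : Der Γ (ty t A) → Der Γ (eq (left (inl t)) t A)
  -- joint monicity
  | jointMonic {Γ : Ctx C} {s t : Tm} {A : Ty C} :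
      Der Γ (ty s (Ty.part (.sum A A))) → Der Γ (ty t (Ty.part (.sum A A))) →
      Der Γ (eq s.bindFst t.bindFst A.part) → Der Γ (eq s.bindSnd t.bindSnd A.part) →
      Der Γ (eq s t (Ty.part (.sum A A)))
  -- ordering
  | leI {Γ : Ctx C} {b s t : Tm} {A : Ty C} :
      Der Γ (ty b (Ty.part (.sum A A))) →
      Der Γ (eq b.bindFst s A.part) → Der Γ (eq b.bindNabla t A.part) →
      Der Γ (le s t A.part)
  -- partial sum
  | osum {Γ : Ctx C} {b s t : Tm} {A : Ty C} :
      Der Γ (ty b (Ty.part (.sum A A))) →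
      Der Γ (eq b.bindFst s A.part) → Der Γ (eq b.bindSnd t A.part) →
      Der Γ (ty (osum s t) A.part)
  | osumDef {Γ : Ctx C} {b s t : Tm} {A : Ty C} :
      Der Γ (ty b (Ty.part (.sum A A))) →
      Der Γ (eq b.bindFst s A.part) → Der Γ (eq b.bindSnd t A.part) →
      Der Γ (eq (osum s t) b.bindNabla A.part)
  -- instruments
  | instr {Γ : Ctx C} {t s : Tm} {A : Ty C} {n : ℕ} :
      Der (Ctx.empty.cons A) (ty t (.fin n)) → Der Γ (ty s A) →
      Der Γ (ty (instr t s) (.copower n A))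
  | nablaInstr {Γ : Ctx C} {t s : Tm} {A : Ty C} {n : ℕ} :
      Der (Ctx.empty.cons A) (ty t (.fin n)) → Der Γ (ty s A) →
      Der Γ (eq (nabla n (instr t s)) s A)
  | instrTest {Γ : Ctx C} {t s : Tm} {A : Ty C} {n : ℕ} :
      Der (Ctx.empty.cons A) (ty t (.fin n)) → Der Γ (ty s A) →
      Der Γ (eq (ind n (instr t s)) (t.inst s) (.fin n))
  | etaInstr {Γ : Ctx C} {t s : Tm} {A : Ty C} {n : ℕ} :
      Der (Ctx.empty.cons A) (ty t (.copower n A)) →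
      Der (Ctx.empty.cons A) (eq (nabla n t) (var 0) A) → Der Γ (ty s A) →
      Der Γ (eq (instr (ind n t) s) (t.inst s) (.copower n A))
  | instrEq {Γ : Ctx C} {t t' s s' : Tm} {A : Ty C} {n : ℕ} :
      Der (Ctx.empty.cons A) (eq t t' (.fin n)) → Der Γ (eq s s' A) →
      Der Γ (eq (instr t s) (instr t' s') (.copower n A))
  | comm {Γ : Ctx C} {p q t : Tm} {A : Ty C} :
      Der (Ctx.empty.cons A) (ty p .two) → Der (Ctx.empty.cons A) (ty q .two) →
      Der Γ (ty t A) →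
      Der Γ (eq (doo (assert p t) (assert q.shiftUnder (var 0)))
        (doo (assert q t) (assert p.shiftUnder (var 0))) A.part)
  -- scalar constants
  | oneOver {Γ : Ctx C} {n : ℕ} : 2 ≤ n → Der Γ (ty (oneOver n) .two)
  | timesOneOver {Γ : Ctx C} {n : ℕ} : 2 ≤ n → Der Γ (eq (times n (oneOver n)) top .two)
  | divide {Γ : Ctx C} {n : ℕ} {t : Tm} : 2 ≤ n → Der Γ (ty t .two) →
      Der Γ (eq (times n t) top .two) → Der Γ (eq t (oneOver n) .two)
  | bound {Γ : Ctx C} {m n : ℕ} : 1 ≤ m → m < n → Der Γ (ty (bound m n) (.fin 3))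
  | projOneBound {Γ : Ctx C} {m n : ℕ} : 1 ≤ m → m < n →
      Der Γ (eq (proj 3 1 (bound m n)) (times m (oneOver n)) .two)
  | projTwoBound {Γ : Ctx C} {m n : ℕ} : 1 ≤ m → m < n →
      Der Γ (eq (proj 3 2 (bound m n)) (oneOver n) .two)
  -- normalisation
  | norm {Γ : Ctx C} {t : Tm} {A : Ty C} {n : ℕ} : 2 ≤ n →
      Der Ctx.empty (ty t A.part) → Der Ctx.empty (le (oneOver n) (isInl t) .two) →
      Der Γ (ty (norm t) A)
  | betaNorm {Γ : Ctx C} {t : Tm} {A : Ty C} {n : ℕ} : 2 ≤ n →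
      Der Ctx.empty (ty t A.part) → Der Ctx.empty (le (oneOver n) (isInl t) .two) →
      Der Γ (eq (doo t (ret (norm t).shift)) t A.part)
  | etaNorm {Γ : Ctx C} {t ρ : Tm} {A : Ty C} {n : ℕ} : 2 ≤ n →
      Der Ctx.empty (ty t A.part) → Der Ctx.empty (le (oneOver n) (isInl t) .two) →
      Der Ctx.empty (ty ρ A) → Der Ctx.empty (eq t (doo t (ret ρ.shift)) A.part) →
      Der Γ (eq ρ (norm t) A)

/-- `t` is a term `m / n`, that is `m · (1 / n)` with `2 ≤ n`, representing the rational `q`. -/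
def Represents (q : ℚ) (t : Tm) : Prop :=
  ∃ m n : ℕ, 2 ≤ n ∧ q = (m : ℚ) / (n : ℚ) ∧ t = times m (oneOver n)

/-- Every nonnegative rational is represented by a term. -/
theorem exists_represents (q : ℚ) (hq : 0 ≤ q) : ∃ t, Represents q t := by
  refine ⟨_, 2 * q.num.toNat, 2 * q.den, ?_, ?_, rfl⟩
  · have := q.den_pos
    omega
  · have h : ((q.num.toNat : ℤ)) = q.num := Int.toNat_of_nonneg (Rat.num_nonneg.mpr hq)
    have h' : ((q.num.toNat : ℕ) : ℚ) = (q.num : ℚ) := by exact_mod_cast h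
    push_cast
    rw [h', mul_div_mul_left _ _ (by norm_num : (2 : ℚ) ≠ 0)]
    exact (Rat.num_div_den q).symm

end COMET

/-!
The positive statements are derived in the type theory; the necessity of `q + r ≤ 1` comes from a
probabilistic model.

*Derivations.* All terms in question are closed, and what matters about them is a case
distinction with closed branches. `Shape.sel` is such a case distinction, over a type built
from `1` by binary sums, and `Shape.sel_sel` and `Shape.sel_relabel` say how these compose. The one
rule that is not immediate is that equal closed branches can be dropped (`case_const`).
With these laws, the partial sum of scalars, `ScalarSum r s t` (there is a bound of `r` and `s` with
total `t`), is shown to be a partial commutative monoid. Its associativity (`ScalarSum.assoc`) needs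
the partial pairing: two binary bounds are glued to a term with four outcomes, and joint monicity
identifies the second bound with a relabelling of that term. The rest is arithmetic of multiples.
The constants `b_{m,n}` say that `1 / n` can be added `n` times, so multiples of `1 / n`
add up as they should (`Summable.add`). Since division by `n` is unique,
`1 / n = k · (1 / (nk))`, and fractions can be brought to a common denominator
(`times_oneOver_eq`); the order and the sum of fractions follow (`scalarSum_times_oneOver`). The
product of scalars is `do _ ← s; t`, also for constant predicates on a type (`doo_assert`).
It is additive in both arguments, which gives `nk · ((1 / n) & (1 / k)) = ⊤`, hence
`(1 / n) & (1 / k) = 1 / (nk)` by unique division, and then the general case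
(`doo_times_oneOver`).

*Model.* A term denotes a finitely supported combination of values (`Tm.eval`), where
environments assign such combinations to variables. Substitution then is
evaluation in a changed environment, for all raw terms. What typing adds is that the denotation is
a probability distribution on the values of the type, and that it is linear in each
variable (`Admissible`); the latter turns substitution into composition of kernels, as the `β`-rules
require. All rules are sound (`Der.holds`). The term `m · (1 / n)` denotes the coin with bias
`m / n`, and if `s ⊕ t` is typable, then its failure probability is not negative, which means that
the biases of `s` and `t` add up to at most one (`add_le_one_of_osum`).
-/

/-! ### Closed terms -/

namespace COMET

universe u

open Tm Jdg

/-- A term without free variables, in the form in which this is used: renamings and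
substitutions leave it unchanged. -/
structure Tm.Closed (t : Tm) : Prop where
  rename : ∀ f, t.rename f = t
  subst : ∀ σ, t.subst σ = t

/-- A term without free variables other than index `0`: it is unchanged by renamings and
substitutions that were moved under one binder. -/
structure Tm.ClosedUnder (t : Tm) : Prop where
  rename : ∀ f, t.rename (upr f) = t
  subst : ∀ σ, t.subst (ups σ) = t

namespace Tm

theorem Closed.closedUnder {t : Tm} (h : t.Closed) : t.ClosedUnder :=
  ⟨fun _ => h.rename _, fun _ => h.subst _⟩

theorem Closed.shift_eq {t : Tm} (h : t.Closed) : t.shift = t := h.rename _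

theorem Closed.shiftUnder_eq {t : Tm} (h : t.Closed) : t.shiftUnder = t := h.rename _

theorem ClosedUnder.shiftUnder_eq {t : Tm} (h : t.ClosedUnder) : t.shiftUnder = t := h.rename _

theorem Closed.inst_eq {t : Tm} (h : t.Closed) (s : Tm) : t.inst s = t := h.subst _

theorem closed_star : star.Closed := ⟨fun _ => rfl, fun _ => rfl⟩

theorem closed_oneOver (n : ℕ) : (oneOver n).Closed := ⟨fun _ => rfl, fun _ => rfl⟩

theorem closed_bound (m n : ℕ) : (bound m n).Closed := ⟨fun _ => rfl, fun _ => rfl⟩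

theorem Closed.inl {t : Tm} (h : t.Closed) : (inl t).Closed :=
  ⟨fun f => congrArg Tm.inl (h.rename f), fun σ => congrArg Tm.inl (h.subst σ)⟩

theorem Closed.inr {t : Tm} (h : t.Closed) : (inr t).Closed :=
  ⟨fun f => congrArg Tm.inr (h.rename f), fun σ => congrArg Tm.inr (h.subst σ)⟩

theorem Closed.inlr {s t : Tm} (hs : s.Closed) (ht : t.Closed) : (inlr s t).Closed :=
  ⟨fun f => congrArg₂ Tm.inlr (hs.rename f) (ht.rename f),
    fun σ => congrArg₂ Tm.inlr (hs.subst σ) (ht.subst σ)⟩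

theorem Closed.osum {s t : Tm} (hs : s.Closed) (ht : t.Closed) : (osum s t).Closed :=
  ⟨fun f => congrArg₂ Tm.osum (hs.rename f) (ht.rename f),
    fun σ => congrArg₂ Tm.osum (hs.subst σ) (ht.subst σ)⟩

theorem Closed.caseOf {r s t : Tm} (hr : r.Closed) (hs : s.ClosedUnder) (ht : t.ClosedUnder) :
    (caseOf r s t).Closed :=
  ⟨fun f => by simp only [Tm.rename, hr.rename, hs.rename, ht.rename],
    fun σ => by simp only [Tm.subst, hr.subst, hs.subst, ht.subst]⟩

theorem closed_fail : fail.Closed := closed_star.inr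

theorem Closed.doo {s t : Tm} (hs : s.Closed) (ht : t.Closed) : (doo s t).Closed :=
  hs.caseOf ht.closedUnder closed_fail.closedUnder

theorem Closed.times {t : Tm} (h : t.Closed) : ∀ m, (times m t).Closed
  | 0 => closed_fail
  | 1 => h
  | m + 2 => (Closed.times h (m + 1)).osum h

end Tm

/-! ### Case distinctions with closed branches -/

variable {C : Type u}

theorem split_empty (Γ : Ctx C) : Γ.Split Γ Ctx.empty := by
  intro i
  rcases h : Γ i with _ | A
  · exact Or.inl ⟨rfl, rfl⟩
  · exact Or.inl ⟨rfl, rfl⟩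

theorem var_zero_ty {Γ : Ctx C} {A : Ty C} : Der (Γ.cons A) (ty (Tm.var 0) A) := .var rfl

theorem case_ty {Γ : Ctx C} {r s t : Tm} {A B D : Ty C} (hr : Der Γ (ty r (.sum A B)))
    (hs : Der (Ctx.empty.cons A) (ty s D)) (ht : Der (Ctx.empty.cons B) (ty t D)) :
    Der Γ (ty (caseOf r s t) D) := .caseOf (split_empty Γ) hr hs ht

theorem case_congr {Γ : Ctx C} {r r' s s' t t' : Tm} {A B D : Ty C}
    (hr : Der Γ (eq r r' (.sum A B))) (hs : Der (Ctx.empty.cons A) (eq s s' D))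
    (ht : Der (Ctx.empty.cons B) (eq t t' D)) :
    Der Γ (eq (caseOf r s t) (caseOf r' s' t') D) := .caseEq (split_empty Γ) hr hs ht

theorem case_inl {Γ : Ctx C} {r s t : Tm} {A B D : Ty C} (hr : Der Γ (ty r A))
    (hs : Der (Ctx.empty.cons A) (ty s D)) (ht : Der (Ctx.empty.cons B) (ty t D)) :
    Der Γ (eq (caseOf (Tm.inl r) s t) (s.inst r) D) := .betaInl (split_empty Γ) hr hs ht

theorem case_inr {Γ : Ctx C} {r s t : Tm} {A B D : Ty C} (hr : Der Γ (ty r B))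
    (hs : Der (Ctx.empty.cons A) (ty s D)) (ht : Der (Ctx.empty.cons B) (ty t D)) :
    Der Γ (eq (caseOf (Tm.inr r) s t) (t.inst r) D) := .betaInr (split_empty Γ) hr hs ht

theorem case_case {Γ : Ctx C} {r s s' t t' : Tm} {A B A' B' D : Ty C}
    (hr : Der Γ (ty r (.sum A B)))
    (hs : Der (Ctx.empty.cons A) (ty s (.sum A' B')))
    (hs' : Der (Ctx.empty.cons B) (ty s' (.sum A' B')))
    (ht : Der (Ctx.empty.cons A') (ty t D)) (ht' : Der (Ctx.empty.cons B') (ty t' D))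
    (ct : t.ClosedUnder) (ct' : t'.ClosedUnder) :
    Der Γ (eq (caseOf (caseOf r s s') t t') (caseOf r (caseOf s t t') (caseOf s' t t')) D) := by
  have h := Der.caseCase (split_empty Γ) (split_empty Ctx.empty) hr hs hs' ht ht'
  rwa [ct.shiftUnder_eq, ct'.shiftUnder_eq] at h

/-- A case distinction with equal, closed branches may be dropped. The commuting conversions do
not give this directly: the branch `c` is first paired with the case distinction
`case r of inl _ ↦ * ∣ inr _ ↦ *`, which is equal to `*`, and then projected out again. -/
theorem case_const {Γ : Ctx C} {r c : Tm} {A B D : Ty C} (hr : Der Γ (ty r (.sum A B)))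
    (hc : c.Closed) (h : ∀ Δ : Ctx C, Der Δ (ty c D)) : Der Γ (eq (caseOf r c c) c D) := by
  have hp : ∀ Δ : Ctx C, Der Δ (ty (Tm.pair star c) (.tensor .one D)) := fun Δ =>
    .pair (split_empty Δ) .unit (h _)
  have hv : Der ((Ctx.empty.cons .one).cons D) (ty (Tm.var 0) D) := var_zero_ty
  have h1 : Der Γ (eq (Tm.pair (caseOf r star star) c)
      (caseOf r (Tm.pair star c) (Tm.pair star c)) (.tensor .one D)) := by
    have := Der.casePair (split_empty Γ) (split_empty Ctx.empty) hr
      (Der.unit (Γ := Ctx.empty.cons A)) (Der.unit (Γ := Ctx.empty.cons B)) (h Ctx.empty)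
    rwa [hc.shift_eq] at this
  have h2 : Der Γ (eq (Tm.pair star c) (Tm.pair (caseOf r star star) c) (.tensor .one D)) :=
    .pairEq (split_empty Γ) (.etaOne (case_ty hr .unit .unit)) (.ref (h _))
  have h3 : ∀ Δ : Ctx C, Der Δ (eq (Tm.lett (Tm.pair star c) (Tm.var 0)) c D) := fun Δ => by
    have := Der.betaPair (split_empty Δ) (split_empty Ctx.empty) (Der.unit (Γ := Δ))
      (h Ctx.empty) hv
    exact this
  have h4 : Der Γ (eq (Tm.lett (caseOf r (Tm.pair star c) (Tm.pair star c)) (Tm.var 0))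
      (caseOf r (Tm.lett (Tm.pair star c) (Tm.var 0)) (Tm.lett (Tm.pair star c) (Tm.var 0))) D) :=
    Der.letCase (split_empty Γ) (split_empty Ctx.empty) hr (hp _) (hp _) hv
  have h5 : Der Γ (eq (Tm.lett (Tm.pair star c) (Tm.var 0))
      (Tm.lett (caseOf r (Tm.pair star c) (Tm.pair star c)) (Tm.var 0)) D) :=
    .lettEq (split_empty Γ) (.trans h2 h1) (.ref hv)
  exact .trans (case_congr (.ref hr) (.sym (h3 _)) (.sym (h3 _)))
    (.trans (.sym h4) (.trans (.sym h5) (h3 Γ)))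

/-- Binary trees. A shape stands for a type built from `1` by binary sums. -/
inductive Shape : Type where
  | leaf : Shape
  | node (l r : Shape) : Shape

namespace Shape

/-- The leaves of a shape. -/
inductive Leaf : Shape → Type
  | here : Leaf leaf
  | inl {l r : Shape} (i : Leaf l) : Leaf (node l r)
  | inr {l r : Shape} (i : Leaf r) : Leaf (node l r)

/-- The type with the summands `1` arranged as in the shape. -/
def toTy : Shape → Ty C
  | leaf => .one
  | node l r => .sum l.toTy r.toTy

/-- The closed constructor term for a leaf. -/
def val : (S : Shape) → S.Leaf → Tm
  | leaf, .here => star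
  | node l _, Leaf.inl i => Tm.inl (l.val i)
  | node _ r, Leaf.inr i => Tm.inr (r.val i)

/-- The nested case distinction on `t` that takes the value `f i` at the leaf `i`; the terms
`f i` are meant to be closed. -/
def sel : (S : Shape) → Tm → (S.Leaf → Tm) → Tm
  | leaf, _, f => f .here
  | node l r, t, f =>
      caseOf t (l.sel (var 0) fun i => f (Leaf.inl i)) (r.sel (var 0) fun i => f (Leaf.inr i))

theorem sel_rename {S : Shape} {f : S.Leaf → Tm} (hf : ∀ i, (f i).Closed) (t : Tm) (g : ℕ → ℕ) :
    (S.sel t f).rename g = S.sel (t.rename g) f := by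
  induction S generalizing t g with
  | leaf => exact (hf .here).rename g
  | node l r ihl ihr =>
    simp only [sel, Tm.rename]
    rw [ihl (fun i => hf _), ihr (fun i => hf _)]
    rfl

theorem sel_subst {S : Shape} {f : S.Leaf → Tm} (hf : ∀ i, (f i).Closed) (t : Tm) (σ : ℕ → Tm) :
    (S.sel t f).subst σ = S.sel (t.subst σ) f := by
  induction S generalizing t σ with
  | leaf => exact (hf .here).subst σ
  | node l r ihl ihr =>
    simp only [sel, Tm.subst]
    rw [ihl (fun i => hf _), ihr (fun i => hf _)]
    rfl

theorem sel_closed {S : Shape} {f : S.Leaf → Tm} (hf : ∀ i, (f i).Closed) {t : Tm}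
    (ht : t.Closed) : (S.sel t f).Closed :=
  ⟨fun g => by rw [sel_rename hf, ht.rename], fun σ => by rw [sel_subst hf, ht.subst]⟩

theorem sel_closedUnder {S : Shape} {f : S.Leaf → Tm} (hf : ∀ i, (f i).Closed) :
    (S.sel (var 0) f).ClosedUnder :=
  ⟨fun g => by rw [sel_rename hf]; rfl, fun σ => by rw [sel_subst hf]; rfl⟩

theorem val_closed : ∀ (S : Shape) (i : S.Leaf), (S.val i).Closed
  | leaf, .here => closed_star
  | node l _, Leaf.inl i => (val_closed l i).inl
  | node _ r, Leaf.inr i => (val_closed r i).inr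

theorem val_ty : ∀ (S : Shape) (i : S.Leaf) (Γ : Ctx C), Der Γ (ty (S.val i) S.toTy)
  | leaf, .here, _ => .unit
  | node l _, Leaf.inl i, Γ => .inl (val_ty l i Γ)
  | node _ r, Leaf.inr i, Γ => .inr (val_ty r i Γ)

theorem sel_ty {S : Shape} {f : S.Leaf → Tm} {A : Ty C} (hf : ∀ i Γ, Der Γ (ty (f i) A))
    {Γ : Ctx C} {t : Tm} (ht : Der Γ (ty t S.toTy)) : Der Γ (ty (S.sel t f) A) := by
  induction S generalizing t Γ with
  | leaf => exact hf _ _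
  | node l r ihl ihr =>
    exact case_ty ht (ihl (fun i => hf _) var_zero_ty) (ihr (fun i => hf _) var_zero_ty)

theorem sel_congr {S : Shape} {f g : S.Leaf → Tm} {A : Ty C}
    (h : ∀ i Γ, Der Γ (eq (f i) (g i) A)) {Γ : Ctx C} {s t : Tm}
    (hst : Der Γ (eq s t S.toTy)) : Der Γ (eq (S.sel s f) (S.sel t g) A) := by
  induction S generalizing s t Γ with
  | leaf => exact h _ _
  | node l r ihl ihr =>
    exact case_congr hst (ihl (fun i => h _) (.ref var_zero_ty))
      (ihr (fun i => h _) (.ref var_zero_ty))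

theorem sel_const {S : Shape} {c : Tm} {A : Ty C} (hc : c.Closed)
    (h : ∀ Γ : Ctx C, Der Γ (ty c A)) {Γ : Ctx C} {t : Tm} (ht : Der Γ (ty t S.toTy)) :
    Der Γ (eq (S.sel t fun _ => c) c A) := by
  induction S generalizing t Γ with
  | leaf => exact .ref (h _)
  | node l r ihl ihr =>
    exact .trans (case_congr (.ref ht) (ihl var_zero_ty) (ihr var_zero_ty))
      (case_const ht hc h)

theorem case_sel {S : Shape} {f : S.Leaf → Tm} {A B D : Ty C} {p q : Tm}
    (hf : ∀ i Γ, Der Γ (ty (f i) (.sum A B)))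
    (hp : Der (Ctx.empty.cons A) (ty p D)) (hq : Der (Ctx.empty.cons B) (ty q D))
    (cp : p.ClosedUnder) (cq : q.ClosedUnder)
    {Γ : Ctx C} {t : Tm} (ht : Der Γ (ty t S.toTy)) :
    Der Γ (eq (caseOf (S.sel t f) p q) (S.sel t fun i => caseOf (f i) p q) D) := by
  induction S generalizing t Γ with
  | leaf => exact .ref (case_ty (hf _ _) hp hq)
  | node l r ihl ihr =>
    exact .trans (case_case ht (sel_ty (fun i => hf _) var_zero_ty)
        (sel_ty (fun i => hf _) var_zero_ty) hp hq cp cq)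
      (case_congr (.ref ht) (ihl (fun i => hf _) var_zero_ty)
        (ihr (fun i => hf _) var_zero_ty))

/-- Associativity of nested case distinctions. -/
theorem sel_sel {S T : Shape} {f : S.Leaf → Tm} {g : T.Leaf → Tm} {A : Ty C}
    (hf : ∀ i (Γ : Ctx C), Der Γ (ty (f i) T.toTy)) (hg : ∀ i Γ, Der Γ (ty (g i) A))
    (cg : ∀ i, (g i).Closed) {Γ : Ctx C} {t : Tm} (ht : Der Γ (ty t S.toTy)) :
    Der Γ (eq (T.sel (S.sel t f) g) (S.sel t fun i => T.sel (f i) g) A) := by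
  cases T with
  | leaf => exact .sym (sel_const (cg _) (hg _) ht)
  | node l r =>
    exact case_sel hf (sel_ty (fun i => hg _) var_zero_ty) (sel_ty (fun i => hg _) var_zero_ty)
      (sel_closedUnder fun i => cg _) (sel_closedUnder fun i => cg _) ht

theorem sel_val {S : Shape} {f : S.Leaf → Tm} {A : Ty C} (hf : ∀ i Γ, Der Γ (ty (f i) A))
    (cf : ∀ i, (f i).Closed) (i : S.Leaf) (Γ : Ctx C) : Der Γ (eq (S.sel (S.val i) f) (f i) A) := by
  induction S generalizing Γ with
  | leaf => cases i; exact .ref (hf _ _)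
  | node l r ihl ihr =>
    cases i with
    | inl i =>
      have h := case_inl (val_ty l i Γ) (sel_ty (fun i => hf (Leaf.inl i)) var_zero_ty)
        (sel_ty (fun i => hf (Leaf.inr i)) (var_zero_ty (A := r.toTy)))
      rw [Tm.inst, sel_subst fun i => cf _] at h
      exact .trans h (ihl (fun i => hf _) (fun i => cf _) i Γ)
    | inr i =>
      have h := case_inr (val_ty r i Γ) (sel_ty (fun i => hf (Leaf.inl i))
        (var_zero_ty (A := l.toTy))) (sel_ty (fun i => hf (Leaf.inr i)) var_zero_ty)
      rw [Tm.inst, sel_subst fun i => cf _] at h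
      exact .trans h (ihr (fun i => hf _) (fun i => cf _) i Γ)

/-- A case distinction on a term that only relabels the leaves of `t` is a case distinction
on `t`. -/
theorem sel_relabel {S T : Shape} (φ : S.Leaf → T.Leaf) {g : T.Leaf → Tm} {A : Ty C}
    (hg : ∀ i Γ, Der Γ (ty (g i) A)) (cg : ∀ i, (g i).Closed) {Γ : Ctx C} {t : Tm}
    (ht : Der Γ (ty t S.toTy)) :
    Der Γ (eq (T.sel (S.sel t fun i => T.val (φ i)) g) (S.sel t fun i => g (φ i)) A) :=
  .trans (sel_sel (fun _ => val_ty T _) hg cg ht)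
    (sel_congr (fun _ => sel_val hg cg _) (.ref ht))

end Shape

/-! ### Sums of scalars -/

namespace Shape

/-- The shape of `𝟐 = 1 + 1`. -/
abbrev two : Shape := node leaf leaf

/-- The shape of `(1 + 1) + 1`, the type of the bounds for sums of scalars. -/
abbrev three : Shape := node two leaf

/-- The shape of `(1 + 1) + (1 + 1)`. -/
abbrev four : Shape := node two two

/-- The leaf of `⊤`. -/
abbrev yes : two.Leaf := .inl .here

/-- The leaf of `⊥`. -/
abbrev no : two.Leaf := .inr .here

/-- The leaf of `return (inl *)`. -/
abbrev one : three.Leaf := .inl yes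

/-- The leaf of `return (inr *)`. -/
abbrev other : three.Leaf := .inl no

/-- The leaf of `fail`. -/
abbrev none : three.Leaf := .inr .here

theorem forall_three {P : three.Leaf → Prop} (h₁ : P one) (h₂ : P other) (h₃ : P none) : ∀ i, P i
  | .inl (.inl .here) => h₁
  | .inl (.inr .here) => h₂
  | .inr .here => h₃

theorem forall_four {P : four.Leaf → Prop} (h₁ : P (.inl yes)) (h₂ : P (.inl no))
    (h₃ : P (.inr yes)) (h₄ : P (.inr no)) : ∀ i, P i
  | .inl (.inl .here) => h₁
  | .inl (.inr .here) => h₂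
  | .inr (.inl .here) => h₃
  | .inr (.inr .here) => h₄

/-- The indicator of the first summand. -/
def isOne : three.Leaf → two.Leaf
  | .inl (.inl .here) => yes
  | .inl (.inr .here) => no
  | .inr .here => no

/-- The indicator of the second summand. -/
def isOther : three.Leaf → two.Leaf
  | .inl (.inl .here) => no
  | .inl (.inr .here) => yes
  | .inr .here => no

/-- The indicator of success. -/
def isSome : three.Leaf → two.Leaf
  | .inl (.inl .here) => yes
  | .inl (.inr .here) => yes
  | .inr .here => no

end Shape

open Shape

theorem star_eq {Γ : Ctx C} {t : Tm} (ht : Der Γ (ty t .one)) : Der Γ (eq t star .one) :=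
  .sym (.etaOne ht)

/-- The `η`-rule of `𝟐`. -/
theorem sel_two_val {Γ : Ctx C} {t : Tm} (ht : Der Γ (ty t .two)) :
    Der Γ (eq (two.sel t two.val) t .two) :=
  .trans (case_congr (.ref ht) (.inlEq (.etaOne var_zero_ty)) (.inrEq (.etaOne var_zero_ty)))
    (.etaSum ht)

theorem bindFst_eq {Γ : Ctx C} {b : Tm} (hb : Der Γ (ty b three.toTy)) :
    Der Γ (eq b.bindFst (three.sel b fun i => two.val (isOne i)) .two) :=
  case_congr (.ref hb)
    (case_congr (.ref var_zero_ty) (.inlEq (star_eq var_zero_ty)) (.ref (.inr .unit)))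
    (.ref (.inr .unit))

theorem bindSnd_eq {Γ : Ctx C} {b : Tm} (hb : Der Γ (ty b three.toTy)) :
    Der Γ (eq b.bindSnd (three.sel b fun i => two.val (isOther i)) .two) :=
  case_congr (.ref hb)
    (case_congr (.ref var_zero_ty) (.ref (.inr .unit)) (.inlEq (star_eq var_zero_ty)))
    (.ref (.inr .unit))

theorem bindNabla_eq {Γ : Ctx C} {b : Tm} (hb : Der Γ (ty b three.toTy)) :
    Der Γ (eq b.bindNabla (three.sel b fun i => two.val (isSome i)) .two) :=
  case_congr (.ref hb)
    (.trans (.inlEq (star_eq (case_ty var_zero_ty var_zero_ty var_zero_ty)))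
      (.sym (case_const var_zero_ty closed_star.inl fun _ => .inl .unit)))
    (.ref (.inr .unit))

variable (C) in
/-- A scalar: a closed term of type `𝟐`, in every context. -/
def IsScalar (t : Tm) : Prop := t.Closed ∧ ∀ Γ : Ctx C, Der Γ (ty t .two)

variable (C) in
/-- Derivable equality at type `𝟐`, in every context. -/
def ScalarEq (s t : Tm) : Prop := ∀ Γ : Ctx C, Der Γ (eq s t .two)

variable (C) in
/-- `r ⊕ s` is defined and equal to `t`: there is a closed bound for `r` and `s`, in every context,
with total `t`. -/
def ScalarSum (r s t : Tm) : Prop :=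
  ∃ b : Tm, b.Closed ∧ (∀ Γ : Ctx C, Der Γ (ty b three.toTy)) ∧
    ScalarEq C (three.sel b fun i => two.val (isOne i)) r ∧
    ScalarEq C (three.sel b fun i => two.val (isOther i)) s ∧
    ScalarEq C (three.sel b fun i => two.val (isSome i)) t

theorem ScalarEq.symm {s t : Tm} (h : ScalarEq C s t) : ScalarEq C t s := fun Γ => .sym (h Γ)

theorem ScalarEq.trans {r s t : Tm} (h : ScalarEq C r s) (h' : ScalarEq C s t) :
    ScalarEq C r t := fun Γ => .trans (h Γ) (h' Γ)

theorem IsScalar.refl {t : Tm} (h : IsScalar C t) : ScalarEq C t t := fun Γ => .ref (h.2 Γ)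

theorem isScalar_val (i : two.Leaf) : IsScalar C (two.val i) := ⟨val_closed _ _, val_ty two i⟩

theorem isScalar_fail : IsScalar C Tm.fail := isScalar_val no

namespace ScalarSum

variable {r r' s s' t t' w : Tm}

theorem congr (h : ScalarSum C r s t) (hr : ScalarEq C r r') (hs : ScalarEq C s s')
    (ht : ScalarEq C t t') : ScalarSum C r' s' t' := by
  obtain ⟨b, cb, hb, h1, h2, h3⟩ := h
  exact ⟨b, cb, hb, h1.trans hr, h2.trans hs, h3.trans ht⟩

theorem osum_ty (h : ScalarSum C r s t) (Γ : Ctx C) : Der Γ (ty (osum r s) .two) := by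
  obtain ⟨b, cb, hb, h1, h2, h3⟩ := h
  exact Der.osum (hb Γ) (.trans (bindFst_eq (hb Γ)) (h1 Γ)) (.trans (bindSnd_eq (hb Γ)) (h2 Γ))

theorem osum_eq (h : ScalarSum C r s t) : ScalarEq C (osum r s) t := by
  obtain ⟨b, cb, hb, h1, h2, h3⟩ := h
  exact fun Γ => .trans (Der.osumDef (hb Γ) (.trans (bindFst_eq (hb Γ)) (h1 Γ))
    (.trans (bindSnd_eq (hb Γ)) (h2 Γ))) (.trans (bindNabla_eq (hb Γ)) (h3 Γ))

theorem le (h : ScalarSum C r s t) (Γ : Ctx C) : Der Γ (le r t .two) := by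
  obtain ⟨b, cb, hb, h1, h2, h3⟩ := h
  exact Der.leI (hb Γ) (.trans (bindFst_eq (hb Γ)) (h1 Γ)) (.trans (bindNabla_eq (hb Γ)) (h3 Γ))

theorem unique (h : ScalarSum C r s t) (h' : ScalarSum C r' s' t') (hr : ScalarEq C r r')
    (hs : ScalarEq C s s') : ScalarEq C t t' :=
  have ht : ScalarEq C t t := h.osum_eq.symm.trans h.osum_eq
  (h.congr hr hs ht).osum_eq.symm.trans h'.osum_eq

theorem refl_left (h : ScalarSum C r s t) : ScalarEq C r r := by
  obtain ⟨b, cb, hb, h1, h2, h3⟩ := h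
  exact h1.symm.trans h1

end ScalarSum

/-- A case distinction on a closed term with leaves labelled by the leaves of the type of bounds
is a bound for the sum of the two scalars that it induces. -/
theorem scalarSum_sel {S : Shape} {e : Tm} (ce : e.Closed) (he : ∀ Γ : Ctx C, Der Γ (ty e S.toTy))
    (φ : S.Leaf → three.Leaf) :
    ScalarSum C (S.sel e fun i => two.val (isOne (φ i))) (S.sel e fun i => two.val (isOther (φ i)))
      (S.sel e fun i => two.val (isSome (φ i))) := by
  have key : ∀ p : three.Leaf → two.Leaf,
      ScalarEq C (three.sel (S.sel e fun i => three.val (φ i)) fun i => two.val (p i))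
        (S.sel e fun i => two.val (p (φ i))) := fun p Γ =>
    sel_relabel φ (fun i => val_ty two _) (fun i => val_closed _ _) (he Γ)
  exact ⟨S.sel e fun i => three.val (φ i), sel_closed (fun i => val_closed _ _) ce,
    fun Γ => sel_ty (fun i => val_ty three _) (he Γ), key _, key _, key _⟩

theorem scalarSum_fail_left {t : Tm} (ht : IsScalar C t) : ScalarSum C Tm.fail t t := by
  have h := scalarSum_sel (S := two) ht.1 ht.2 fun
    | .inl .here => other
    | .inr .here => Shape.none
  have e : ScalarEq C _ t := fun Γ => .trans (case_congr (.ref (ht.2 Γ)) (.ref (.inl .unit))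
    (.ref (.inr .unit))) (sel_two_val (ht.2 Γ))
  exact h.congr (fun Γ => case_const (ht.2 Γ) closed_fail isScalar_fail.2) e e

theorem scalarSum_fail_right {t : Tm} (ht : IsScalar C t) : ScalarSum C t Tm.fail t := by
  have h := scalarSum_sel (S := two) ht.1 ht.2 fun
    | .inl .here => Shape.one
    | .inr .here => Shape.none
  have e : ScalarEq C _ t := fun Γ => .trans (case_congr (.ref (ht.2 Γ)) (.ref (.inl .unit))
    (.ref (.inr .unit))) (sel_two_val (ht.2 Γ))
  exact h.congr e (fun Γ => case_const (ht.2 Γ) closed_fail isScalar_fail.2) e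

/-! ### Commutativity and associativity -/

namespace Shape

/-- The effect of `▷₁` on leaves. -/
def keepLeft {S T : Shape} : (node S T).Leaf → (node S leaf).Leaf
  | .inl i => .inl i
  | .inr _ => .inr .here

/-- The effect of `▷₂` on leaves. -/
def keepRight {S T : Shape} : (node S T).Leaf → (node T leaf).Leaf
  | .inl _ => .inr .here
  | .inr i => .inl i

/-- The leaves `1, 2, ∗` of the type of bounds, moved to `∗, 1, 2`. -/
def rotate : three.Leaf → three.Leaf
  | .inl (.inl .here) => none
  | .inl (.inr .here) => one
  | .inr .here => other

/-- The leaves `1, 2` of the type of bounds, exchanged. -/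
def exchange : three.Leaf → three.Leaf
  | .inl (.inl .here) => other
  | .inl (.inr .here) => one
  | .inr .here => none

/-- Of the four leaves, the first two become the first outcome of a bound,
and the third becomes the second outcome. -/
def twoPlusOne : four.Leaf → three.Leaf
  | .inl _ => one
  | .inr (.inl .here) => other
  | .inr (.inr .here) => none

/-- Of the four leaves, the second becomes the first outcome of a bound,
and the third becomes the second outcome. -/
def secondAndThird : four.Leaf → three.Leaf
  | .inl (.inl .here) => none
  | .inl (.inr .here) => one
  | .inr (.inl .here) => other
  | .inr (.inr .here) => none

/-- Of the four leaves, the first becomes the first outcome of a bound,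
and the next two become the second outcome. -/
def onePlusTwo : four.Leaf → three.Leaf
  | .inl (.inl .here) => one
  | .inl (.inr .here) => other
  | .inr (.inl .here) => other
  | .inr (.inr .here) => none

theorem sel_proj_one {S T : Shape} {g : (node S leaf).Leaf → Tm} {A : Ty C}
    (hg : ∀ i Γ, Der Γ (ty (g i) A)) (cg : ∀ i, (g i).Closed) {Γ : Ctx C} {e : Tm}
    (he : Der Γ (ty e (node S T).toTy)) :
    Der Γ (eq ((node S leaf).sel (proj 2 1 e) g)
      ((node S T).sel e fun i => g (keepLeft i)) A) := by
  have cS : ∀ i : S.Leaf, (g (.inl i)).Closed := fun i => cg _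
  have hS : ∀ Δ : Ctx C, Der (Δ.cons S.toTy) (ty (S.sel (var 0) fun i => g (.inl i)) A) :=
    fun Δ => sel_ty (fun i => hg _) var_zero_ty
  have h1 := case_inl (B := .one) (var_zero_ty (Γ := Ctx.empty)) (hS _) (hg (.inr .here) _)
  rw [inst, sel_subst cS] at h1
  have h2 := case_inr (A := S.toTy) (.unit (Γ := Ctx.empty.cons T.toTy)) (hS _)
    (hg (.inr .here) _)
  rw [(cg _).inst_eq] at h2
  exact .trans (case_case he (.inl var_zero_ty) (.inr .unit) (hS _) (hg (.inr .here) _)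
      (sel_closedUnder cS) (cg _).closedUnder)
    (case_congr (.ref he) h1
      (.trans h2 (.sym (sel_const (S := T) (cg (.inr .here)) (hg _) var_zero_ty))))

theorem sel_proj_two {S T : Shape} {g : (node T leaf).Leaf → Tm} {A : Ty C}
    (hg : ∀ i Γ, Der Γ (ty (g i) A)) (cg : ∀ i, (g i).Closed) {Γ : Ctx C} {e : Tm}
    (he : Der Γ (ty e (node S T).toTy)) :
    Der Γ (eq ((node T leaf).sel (proj 2 2 e) g)
      ((node S T).sel e fun i => g (keepRight i)) A) := by
  have cT : ∀ i : T.Leaf, (g (.inl i)).Closed := fun i => cg _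
  have hT : ∀ Δ : Ctx C, Der (Δ.cons T.toTy) (ty (T.sel (var 0) fun i => g (.inl i)) A) :=
    fun Δ => sel_ty (fun i => hg _) var_zero_ty
  have h1 := case_inl (B := .one) (var_zero_ty (Γ := Ctx.empty)) (hT _) (hg (.inr .here) _)
  rw [inst, sel_subst cT] at h1
  have h2 := case_inr (A := T.toTy) (.unit (Γ := Ctx.empty.cons S.toTy)) (hT _)
    (hg (.inr .here) _)
  rw [(cg _).inst_eq] at h2
  exact .trans (case_case he (.inr .unit) (.inl var_zero_ty) (hT _) (hg (.inr .here) _)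
      (sel_closedUnder cT) (cg _).closedUnder)
    (case_congr (.ref he)
      (.trans h2 (.sym (sel_const (S := S) (cg (.inr .here)) (hg _) var_zero_ty))) h1)

end Shape

theorem isInl_eq {Γ : Ctx C} {b : Tm} (hb : Der Γ (ty b three.toTy)) :
    Der Γ (eq b.isInl (three.sel b fun i => two.val (isSome i)) .two) :=
  case_congr (.ref hb)
    (.sym (case_const var_zero_ty closed_star.inl fun _ => .inl .unit)) (.ref (.inr .unit))

theorem isInr_sel_rotate {Γ : Ctx C} {c : Tm} (hc : Der Γ (ty c three.toTy)) :
    Der Γ (eq (three.sel c fun i => three.val (rotate i)).isInr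
      (three.sel c fun i => two.val (isOne i)) .two) := by
  refine .trans (case_sel (fun i => val_ty three _) (.inr .unit) (.inl .unit)
    closed_star.inr.closedUnder closed_star.inl.closedUnder hc) (sel_congr ?_ (.ref hc))
  exact forall_three (fun _ => case_inr (A := two.toTy) .unit (.inr .unit) (.inl .unit))
    (fun Γ => case_inl (B := .one) (val_ty two yes Γ) (.inr .unit) (.inl .unit))
    (fun Γ => case_inl (B := .one) (val_ty two no Γ) (.inr .unit) (.inl .unit))

/-- Associativity of the partial sum. If `b` is a bound for `r` and `s`, and `c` is a bound for
`r ⊕ s` and `t`, then `b` succeeds exactly where `c` has its first outcome. So the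
partial pairing of `b` with the remaining outcomes of `c` is defined. It is a term with four
outcomes, whose first three have the probabilities `r`, `s` and `t`, and joint monicity
identifies `c` with a relabelling of it. -/
theorem ScalarSum.assoc {r s t v w : Tm} (h : ScalarSum C r s v) (h' : ScalarSum C v t w) :
    ∃ y, ScalarSum C s t y ∧ ScalarSum C r y w := by
  obtain ⟨b, cb, hb, b1, b2, b3⟩ := h
  obtain ⟨c, cc, hc, c1, c2, c3⟩ := h'
  set d := three.sel c fun i => three.val (rotate i)
  have cd : d.Closed := sel_closed (fun i => val_closed _ _) cc
  have hd : ∀ Γ : Ctx C, Der Γ (ty d three.toTy) := fun Γ => sel_ty (fun i => val_ty _ _) (hc Γ)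
  have hbd : ∀ Γ : Ctx C, Der Γ (eq b.isInl d.isInr .two) := fun Γ =>
    .trans (isInl_eq (hb Γ)) (.trans (b3 Γ) (.trans (c1.symm Γ) (.sym (isInr_sel_rotate (hc Γ)))))
  set e := inlr b d
  have ce : e.Closed := cb.inlr cd
  have he : ∀ Γ : Ctx C, Der Γ (ty e four.toTy) := fun Γ => .inlr (hb Γ) (hd Γ) (hbd Γ)
  -- `b` and `c` are computed from `e`: tests on `b` become tests on the left part of `e`, and
  -- tests on the rotated outcomes of `c` become tests on its right part
  have e1 : ∀ p : three.Leaf → two.Leaf, ScalarEq C (four.sel e fun i => two.val (p (keepLeft i)))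
      (three.sel b fun i => two.val (p i)) := fun p Γ =>
    .trans (.sym (sel_proj_one (fun i => val_ty two _) (fun i => val_closed _ _) (he Γ)))
      (sel_congr (fun i Δ => .ref (val_ty two _ Δ)) (.betaInlrOne (hb Γ) (hd Γ) (hbd Γ)))
  have e2 : ∀ p : three.Leaf → two.Leaf, ScalarEq C (four.sel e fun i => two.val (p (keepRight i)))
      (three.sel c fun i => two.val (p (rotate i))) := fun p Γ =>
    .trans (.sym (sel_proj_two (fun i => val_ty two _) (fun i => val_closed _ _) (he Γ)))
      (.trans (sel_congr (fun i Δ => .ref (val_ty two _ Δ)) (.betaInlrTwo (hb Γ) (hd Γ) (hbd Γ)))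
        (sel_relabel rotate (fun i => val_ty two _) (fun i => val_closed _ _) (hc Γ)))
  have e3 : ∀ (φ : four.Leaf → three.Leaf) (p : three.Leaf → two.Leaf),
      ScalarEq C (three.sel (four.sel e fun i => three.val (φ i)) fun i => two.val (p i))
        (four.sel e fun i => two.val (p (φ i))) := fun φ p Γ =>
    sel_relabel φ (fun i => val_ty two _) (fun i => val_closed _ _) (he Γ)
  have e4 : ∀ {p q : four.Leaf → two.Leaf}, (∀ i, p i = q i) →
      ScalarEq C (four.sel e fun i => two.val (p i)) (four.sel e fun i => two.val (q i)) :=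
    fun {p q} hpq => by
      obtain rfl : p = q := funext hpq
      exact fun Γ => .ref (sel_ty (fun i => val_ty two _) (he Γ))
  have e5 : ∀ {p q : three.Leaf → two.Leaf}, (∀ i, p i = q i) →
      ScalarEq C (three.sel c fun i => two.val (p i)) (three.sel c fun i => two.val (q i)) :=
    fun {p q} hpq => by
      obtain rfl : p = q := funext hpq
      exact fun Γ => .ref (sel_ty (fun i => val_ty two _) (hc Γ))
  have ht : ScalarEq C (four.sel e fun i => two.val (isOne (keepRight i))) t :=
    (e2 isOne).trans ((e5 (forall_three rfl rfl rfl)).trans c2)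
  -- `c` is a relabelling of `e`
  set c' := four.sel e fun i => three.val (twoPlusOne i)
  have hc' : ∀ Γ : Ctx C, Der Γ (ty c' three.toTy) := fun Γ =>
    sel_ty (fun i => val_ty three _) (he Γ)
  have hfst : ScalarEq C (three.sel c' fun i => two.val (isOne i)) v :=
    (e3 _ _).trans ((e4 (forall_four rfl rfl rfl rfl)).trans ((e1 isSome).trans b3))
  have hsnd : ScalarEq C (three.sel c' fun i => two.val (isOther i)) t :=
    (e3 _ _).trans ((e4 (forall_four rfl rfl rfl rfl)).trans ht)
  have hcc : ∀ Γ : Ctx C, Der Γ (eq c c' three.toTy) := fun Γ =>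
    .jointMonic (hc Γ) (hc' Γ)
      (.trans (bindFst_eq (hc Γ)) (.trans (c1.trans hfst.symm Γ) (.sym (bindFst_eq (hc' Γ)))))
      (.trans (bindSnd_eq (hc Γ)) (.trans (c2.trans hsnd.symm Γ) (.sym (bindSnd_eq (hc' Γ)))))
  have hw : ScalarEq C (four.sel e fun i => two.val (isSome (twoPlusOne i))) w :=
    (e3 _ isSome).symm.trans (ScalarEq.trans (fun Γ =>
      sel_congr (fun i Δ => .ref (val_ty two _ Δ)) (.sym (hcc Γ))) c3)
  refine ⟨_, (scalarSum_sel ce he secondAndThird).congr ?_ ?_ (e4 fun _ => rfl),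
    (scalarSum_sel ce he onePlusTwo).congr ?_ ?_ ?_⟩
  · exact (e4 (forall_four rfl rfl rfl rfl)).trans ((e1 isOther).trans b2)
  · exact (e4 (forall_four rfl rfl rfl rfl)).trans ht
  · exact (e4 (forall_four rfl rfl rfl rfl)).trans ((e1 isOne).trans b1)
  · exact e4 (forall_four rfl rfl rfl rfl)
  · exact (e4 (forall_four rfl rfl rfl rfl)).trans hw

theorem ScalarSum.comm {r s t : Tm} (h : ScalarSum C r s t) : ScalarSum C s r t := by
  obtain ⟨b, cb, hb, b1, b2, b3⟩ := h
  have e : ∀ {p q : three.Leaf → two.Leaf}, (∀ i, p i = q i) →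
      ScalarEq C (three.sel b fun i => two.val (p i)) (three.sel b fun i => two.val (q i)) :=
    fun {p q} hpq => by
      obtain rfl : p = q := funext hpq
      exact fun Γ => .ref (sel_ty (fun i => val_ty two _) (hb Γ))
  exact (scalarSum_sel cb hb exchange).congr ((e (forall_three rfl rfl rfl)).trans b2)
    ((e (forall_three rfl rfl rfl)).trans b1) ((e (forall_three rfl rfl rfl)).trans b3)

theorem ScalarSum.assoc_symm {r s t v w : Tm} (h : ScalarSum C s t v) (h' : ScalarSum C r v w) :
    ∃ y, ScalarSum C r s y ∧ ScalarSum C y t w := by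
  obtain ⟨y, hy, hy'⟩ := h.comm.assoc h'.comm
  exact ⟨y, hy.comm, hy'.comm⟩

/-! ### Products of scalars -/

theorem doo_congr {Γ : Ctx C} {s s' t t' : Tm} (hs : Der Γ (eq s s' .two))
    (ht : ∀ Δ : Ctx C, Der Δ (eq t t' .two)) : Der Γ (eq (doo s t) (doo s' t') .two) :=
  case_congr hs (ht _) (.ref (.inr .unit))

theorem IsScalar.doo {s t : Tm} (hs : IsScalar C s) (ht : IsScalar C t) :
    IsScalar C (doo s t) :=
  ⟨hs.1.doo ht.1, fun Γ => case_ty (hs.2 Γ) (ht.2 _) (.inr .unit)⟩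

theorem doo_fail {s : Tm} (hs : IsScalar C s) : ScalarEq C (doo s Tm.fail) Tm.fail := fun Γ =>
  case_const (hs.2 Γ) closed_fail isScalar_fail.2

theorem fail_doo {t : Tm} (ht : IsScalar C t) : ScalarEq C (doo Tm.fail t) Tm.fail := fun Γ =>
  case_inr (A := .one) (.unit (Γ := Γ)) (ht.2 _) (.inr .unit)

theorem top_doo {t : Tm} (ht : IsScalar C t) : ScalarEq C (doo top t) t := fun Γ => by
  have h := case_inl (B := .one) (.unit (Γ := Γ)) (ht.2 _) (.inr .unit)
  rwa [ht.1.inst_eq] at h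

/-- The scalar product is additive in its second argument: a bound for the summands may be
run after the first factor has succeeded. -/
theorem ScalarSum.doo_left {a s t w : Tm} (ha : IsScalar C a) (h : ScalarSum C s t w) :
    ScalarSum C (doo a s) (doo a t) (doo a w) := by
  obtain ⟨b, cb, hb, b1, b2, b3⟩ := h
  have key : ∀ (p : three.Leaf → two.Leaf) (_ : p Shape.none = no) {x : Tm}
      (_ : ScalarEq C (three.sel b fun i => two.val (p i)) x),
      ScalarEq C (three.sel (doo a b) fun i => two.val (p i)) (doo a x) := by
    intro p hp x hx Γ
    have hP : ∀ Δ : Ctx C, Der (Δ.cons two.toTy)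
        (ty (two.sel (var 0) fun i => two.val (p (.inl i))) .two) :=
      fun Δ => sel_ty (fun i => val_ty two _) var_zero_ty
    have hn := case_inr (A := two.toTy) (.unit (Γ := Ctx.empty.cons .one)) (hP _)
      (val_ty two (p (.inr .here)) _)
    rw [(val_closed _ _).inst_eq] at hn
    refine .trans (case_case (ha.2 Γ) (hb _) (.inr .unit) (hP _) (val_ty two _ _)
      (sel_closedUnder fun i => val_closed _ _) (val_closed _ _).closedUnder)
      (case_congr (.ref (ha.2 Γ)) (hx _) (.trans hn ?_))
    rw [show p (.inr .here) = no from hp]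
    exact .ref (val_ty two no _)
  exact ⟨doo a b, ha.1.doo cb, fun Γ => case_ty (ha.2 Γ) (hb _) (.inr .unit),
    key _ rfl b1, key _ rfl b2, key _ rfl b3⟩

/-- The outcome `j` of a bound if a further test succeeds, and failure otherwise. -/
def Shape.restrict (j : three.Leaf) : two.Leaf → three.Leaf
  | .inl .here => j
  | .inr .here => Shape.none

/-- The scalar product is additive in its first argument: after a bound for the summands
has returned one of its two outcomes, the second factor is run, and its success returns that
outcome again. -/
theorem ScalarSum.doo_right {r s w a : Tm} (ha : IsScalar C a) (h : ScalarSum C r s w) :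
    ScalarSum C (doo r a) (doo s a) (doo w a) := by
  obtain ⟨b, cb, hb, b1, b2, b3⟩ := h
  let f : three.Leaf → Tm := fun j => two.sel a fun i => three.val (restrict j i)
  have cf : ∀ j, (f j).Closed := fun j => sel_closed (fun i => val_closed _ _) ha.1
  have hf : ∀ j (Γ : Ctx C), Der Γ (ty (f j) three.toTy) := fun j Γ =>
    sel_ty (fun i => val_ty three _) (ha.2 Γ)
  have key : ∀ (p : three.Leaf → two.Leaf) (_ : p Shape.none = no) {x : Tm}
      (_ : ScalarEq C (three.sel b fun i => two.val (p i)) x),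
      ScalarEq C (three.sel (three.sel b f) fun i => two.val (p i)) (doo x a) := by
    intro p hp x hx Γ
    have hb' : ∀ i (Δ : Ctx C), Der Δ (ty (two.val (p i)) two.toTy) := fun i => val_ty two _
    refine .trans (sel_sel hf hb' (fun i => val_closed _ _) (hb Γ)) ?_
    refine .trans ?_ (doo_congr (hx Γ) fun Δ => .ref (ha.2 Δ))
    refine .trans ?_ (.sym (case_sel hb' (ha.2 _) (.inr .unit) ha.1.closedUnder
      closed_fail.closedUnder (hb Γ)))
    refine sel_congr (fun j Δ => ?_) (.ref (hb Γ))
    refine .trans (sel_relabel (restrict j) hb' (fun i => val_closed _ _) (ha.2 Δ)) ?_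
    generalize hk : p j = k
    have e1 : Der Δ (eq (two.sel a fun i => two.val (p (restrict j i)))
        (caseOf a (two.val k) Tm.fail) .two) := by
      subst hk
      have : p (.inr .here) = no := hp
      refine case_congr (.ref (ha.2 Δ)) (.ref (hb' _ _)) ?_
      simp only [sel, restrict, this]
      exact .ref (val_ty two no _)
    refine .trans e1 ?_
    match k with
    | .inl .here =>
      exact .trans (.trans (case_congr (.ref (ha.2 Δ)) (.ref (.inl .unit)) (.ref (.inr .unit)))
        (sel_two_val (ha.2 Δ))) ((top_doo ha).symm Δ)
    | .inr .here => exact (doo_fail ha).trans (fail_doo ha).symm Δ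
  exact ⟨three.sel b f, sel_closed cf cb, fun Γ => sel_ty hf (hb Γ), key _ rfl b1, key _ rfl b2,
    key _ rfl b3⟩

/-! ### Multiples of a scalar -/

variable (C) in
/-- The multiples `m · x` with `m ≤ n` are defined, by adding one summand after the other. -/
def Summable (x : Tm) (n : ℕ) : Prop :=
  ∀ m < n, ScalarSum C (times m x) x (times (m + 1) x)

theorem Summable.isScalar_times {x : Tm} {n m : ℕ} (h : Summable C x n) (hx : IsScalar C x)
    (hm : m ≤ n) : IsScalar C (times m x) := by
  refine ⟨hx.1.times m, ?_⟩
  match m with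
  | 0 => exact isScalar_fail.2
  | 1 => exact hx.2
  | m + 2 => exact (h (m + 1) hm).osum_ty

theorem Summable.of_sum {x : Tm} (hx : IsScalar C x) {n : ℕ}
    (h : ∀ m, 1 ≤ m → m < n → ∃ y, ScalarSum C (times m x) x y) : Summable C x n := by
  intro m hm
  match m with
  | 0 => exact scalarSum_fail_left hx
  | m + 1 =>
    obtain ⟨y, hy⟩ := h (m + 1) (by omega) hm
    exact hy.congr (hy.refl_left) hx.refl hy.osum_eq.symm

theorem isScalar_oneOver {n : ℕ} (hn : 2 ≤ n) : IsScalar C (oneOver n) :=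
  ⟨closed_oneOver n, fun _ => .oneOver hn⟩

theorem summable_oneOver {n : ℕ} (hn : 2 ≤ n) : Summable C (oneOver n) n := by
  refine .of_sum (isScalar_oneOver hn) fun m hm hmn => ?_
  have hb : ∀ Γ : Ctx C, Der Γ (ty (bound m n) three.toTy) := fun Γ => .bound hm hmn
  exact ⟨_, bound m n, closed_bound m n, hb,
    fun Γ => .trans (.sym (bindFst_eq (hb Γ))) (.projOneBound hm hmn),
    fun Γ => .trans (.sym (bindSnd_eq (hb Γ))) (.projTwoBound hm hmn),
    fun Γ => .ref (sel_ty (fun i => val_ty two _) (hb Γ))⟩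

theorem Summable.add {x : Tm} (hx : IsScalar C x) {n m k : ℕ} (h : Summable C x n)
    (hmk : m + k ≤ n) : ScalarSum C (times m x) (times k x) (times (m + k) x) := by
  induction k with
  | zero => exact scalarSum_fail_right (h.isScalar_times hx hmk)
  | succ k ih =>
    obtain ⟨y, hy, hy'⟩ := (ih (by omega)).assoc (h (m + k) (by omega))
    have hyk := hy.unique (h k (by omega)) (h.isScalar_times hx (by omega)).refl hx.refl
    exact hy'.congr hy'.refl_left hyk (h.isScalar_times hx (m := m + k + 1) (by omega)).refl

/-- Multiples of `y`, where `y` is the `k`-fold multiple of `x`, up to derivable equality. -/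
theorem Summable.mul {x y : Tm} (hx : IsScalar C x) (hy : IsScalar C y) {n k j : ℕ}
    (h : Summable C x n) (hkj : j * k ≤ n) (hxy : ScalarEq C (times k x) y) :
    Summable C y j ∧ ∀ m ≤ j, ScalarEq C (times (m * k) x) (times m y) := by
  have step : ∀ m < j, ScalarEq C (times (m * k) x) (times m y) →
      ScalarSum C (times m y) y (times ((m + 1) * k) x) := fun m hm e => by
    have hm' : m * k + k ≤ n := by nlinarith
    rw [Nat.succ_mul]
    exact (h.add hx hm').congr e hxy (h.isScalar_times hx hm').refl
  have eqs : ∀ m ≤ j, ScalarEq C (times (m * k) x) (times m y) := by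
    intro m
    induction m with
    | zero => rw [Nat.zero_mul]; exact fun _ => isScalar_fail.refl
    | succ m ih =>
      intro hm
      match m, ih (by omega) with
      | 0, _ => rw [Nat.zero_add, Nat.one_mul]; exact hxy
      | m + 1, e => exact (step (m + 1) (by omega) e).osum_eq.symm
  refine ⟨.of_sum hy fun m _ hm => ⟨_, step m hm (eqs m hm.le)⟩, eqs⟩

/-- `1 / n = k · (1 / (nk))`, by uniqueness of division by `n`. -/
theorem times_oneOver_mul {n k : ℕ} (hn : 2 ≤ n) (hk : 0 < k) :
    ScalarEq C (times k (oneOver (n * k))) (oneOver n) := by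
  have hnk : 2 ≤ n * k := by nlinarith
  have hx := isScalar_oneOver (C := C) hnk
  have h := summable_oneOver (C := C) hnk
  have hy := h.isScalar_times hx (m := k) (by nlinarith)
  have e := (h.mul hx hy le_rfl hy.refl).2 n le_rfl
  exact fun Γ => .divide hn (hy.2 Γ) (.trans (.sym (e Γ)) (.timesOneOver hnk))

/-- A fraction may be expanded. -/
theorem times_oneOver_expand {m n k : ℕ} (hn : 2 ≤ n) (hk : 0 < k) (hm : m ≤ n) :
    ScalarEq C (times (m * k) (oneOver (n * k))) (times m (oneOver n)) := by
  have hnk : 2 ≤ n * k := by nlinarith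
  exact ((summable_oneOver hnk).mul (isScalar_oneOver hnk) (isScalar_oneOver hn) le_rfl
    (times_oneOver_mul hn hk)).2 m hm

theorem isScalar_times_oneOver {m n : ℕ} (hn : 2 ≤ n) (hm : m ≤ n) :
    IsScalar C (times m (oneOver n)) :=
  (summable_oneOver hn).isScalar_times (isScalar_oneOver hn) hm

/-- Equal fractions are derivably equal. -/
theorem times_oneOver_eq {m n m' n' : ℕ} (hn : 2 ≤ n) (hn' : 2 ≤ n') (hm : m ≤ n)
    (h : m * n' = m' * n) : ScalarEq C (times m (oneOver n)) (times m' (oneOver n')) := by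
  have hm' : m' ≤ n' := by nlinarith
  have e := times_oneOver_expand (C := C) hn' (by omega : 0 < n) hm'
  rw [← h, Nat.mul_comm n' n] at e
  exact (times_oneOver_expand hn (by omega) hm).symm.trans e

/-- If `y` can be added `j` times, and is the `k`-fold multiple of `x`, then `x` can be added
`jk` times. -/
theorem Summable.of_times {x y : Tm} (hx : IsScalar C x) (hy : IsScalar C y) {k j : ℕ}
    (h : Summable C x k) (h' : Summable C y j) (hxy : ScalarEq C (times k x) y) :
    ∀ m ≤ j, Summable C x (m * k) := by
  intro m
  induction m with
  | zero => intro _ i hi; omega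
  | succ m ih =>
    intro hm
    have hs := ih (by omega)
    have hmy := (hs.mul hx hy le_rfl hxy).2 m le_rfl
    have hsum := (h' m hm).congr hmy.symm hxy.symm (h' m hm).osum_eq.symm
    rw [Nat.succ_mul]
    suffices H : ∀ i ≤ k, Summable C x (m * k + i) from H k le_rfl
    intro i
    induction i with
    | zero => exact fun _ => hs
    | succ i ih' =>
      intro hi
      have hi' := ih' (by omega)
      -- `y` splits into `(i + 1) · x` and the rest, and `(i + 1) · x` into `i · x` and `x`
      have hk := h.add hx (m := i + 1) (k := k - (i + 1)) (by omega)
      rw [Nat.add_sub_cancel' hi] at hk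
      obtain ⟨v, hv, -⟩ := hk.assoc_symm hsum
      obtain ⟨w, hw, hw'⟩ := (h i hi).assoc_symm hv
      have e := hw.unique (hi'.add hx le_rfl) hw.refl_left hw.comm.refl_left
      refine .of_sum hx fun l _ hl => ?_
      rcases Nat.lt_succ_iff_lt_or_eq.mp hl with hl | rfl
      · exact ⟨_, hi' l hl⟩
      · exact ⟨v, hw'.congr e hx.refl (hw'.osum_eq.symm.trans hw'.osum_eq)⟩

/-- An additive operation on scalars commutes with multiples. -/
theorem Summable.map {F : Tm → Tm} {x : Tm} {n : ℕ} (h : Summable C x n)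
    (hx : IsScalar C (F x)) (h0 : ScalarEq C (F Tm.fail) Tm.fail)
    (hF : ∀ {r s t}, ScalarSum C r s t → ScalarSum C (F r) (F s) (F t)) :
    Summable C (F x) n ∧ ∀ m ≤ n, ScalarEq C (times m (F x)) (F (times m x)) := by
  have step : ∀ m < n, ScalarEq C (times m (F x)) (F (times m x)) →
      ScalarSum C (times m (F x)) (F x) (F (times (m + 1) x)) := fun m hm e =>
    have hs := hF (h m hm)
    hs.congr e.symm hx.refl (hs.osum_eq.symm.trans hs.osum_eq)
  have eqs : ∀ m ≤ n, ScalarEq C (times m (F x)) (F (times m x)) := by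
    intro m
    induction m with
    | zero => exact fun _ => h0.symm
    | succ m ih =>
      intro hm
      match m, ih (by omega) with
      | 0, _ => exact hx.refl
      | m + 1, e => exact (step (m + 1) hm e).osum_eq
  exact ⟨.of_sum hx fun m _ hm => ⟨_, step m hm (eqs m hm.le)⟩, eqs⟩

/-! ### Products of fractions -/

theorem doo_times_left {x a : Tm} (hx : IsScalar C x) (ha : IsScalar C a) {n : ℕ}
    (h : Summable C x n) : Summable C (doo a x) n ∧
      ∀ m ≤ n, ScalarEq C (times m (doo a x)) (doo a (times m x)) :=
  h.map (F := fun t => doo a t) (ha.doo hx) (doo_fail ha) fun h => h.doo_left ha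

theorem doo_times_right {x a : Tm} (hx : IsScalar C x) (ha : IsScalar C a) {n : ℕ}
    (h : Summable C x n) : Summable C (doo x a) n ∧
      ∀ m ≤ n, ScalarEq C (times m (doo x a)) (doo (times m x) a) :=
  h.map (F := fun t => doo t a) (hx.doo ha) (fail_doo ha) fun h => h.doo_right ha

/-- `(1 / n) · (1 / k) = 1 / (nk)`, by uniqueness of division by `nk`. -/
theorem doo_oneOver {n k : ℕ} (hn : 2 ≤ n) (hk : 2 ≤ k) :
    ScalarEq C (doo (oneOver n) (oneOver k)) (oneOver (n * k)) := by
  have hx := isScalar_oneOver (C := C) hn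
  have hy := isScalar_oneOver (C := C) hk
  obtain ⟨hz, ez⟩ := doo_times_left hy hx (summable_oneOver hk)
  have e : ScalarEq C (times k (doo (oneOver n) (oneOver k))) (oneOver n) :=
    (ez k le_rfl).trans fun Γ => .trans
      (doo_congr (.ref (hx.2 Γ)) fun Δ => .timesOneOver hk)
      (.trans (case_congr (.ref (hx.2 Γ)) (.inlEq (.etaOne var_zero_ty))
        (.inrEq (.etaOne var_zero_ty))) (.etaSum (hx.2 Γ)))
  have hs := Summable.of_times (hx.doo hy) hx hz (summable_oneOver hn) e n le_rfl
  have e' := (hs.mul (hx.doo hy) hx le_rfl e).2 n le_rfl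
  exact fun Γ => .divide (by nlinarith) ((hx.doo hy).2 Γ) (.trans (e' Γ) (.timesOneOver hn))

theorem doo_times_oneOver {m n l k : ℕ} (hn : 2 ≤ n) (hk : 2 ≤ k) (hm : m ≤ n) (hl : l ≤ k) :
    ScalarEq C (doo (times m (oneOver n)) (times l (oneOver k)))
      (times (m * l) (oneOver (n * k))) := by
  have hx := isScalar_oneOver (C := C) hn
  have hy := isScalar_oneOver (C := C) hk
  have hly := isScalar_times_oneOver (C := C) hk hl
  have hnk : 2 ≤ n * k := by nlinarith
  have hnl : n * l ≤ n * k := Nat.mul_le_mul_left n hl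
  have hkn : k * 1 ≤ n * k := by nlinarith
  have hz := isScalar_oneOver (C := C) hnk
  have e1 := ((summable_oneOver hnk).mul (k := 1) hz (hx.doo hy) hkn (doo_oneOver hn hk).symm).2
    l hl
  rw [Nat.mul_one] at e1
  have e2 := (doo_times_left hy hx (summable_oneOver hk)).2 l hl
  have e3 := ((summable_oneOver hnk).mul hz (hx.doo hly) hnl (e1.trans e2)).2 m hm
  exact (e3.trans ((doo_times_right hx hly (summable_oneOver hn)).2 m hm)).symm

/-- Asserting a constant predicate on any state and continuing with a closed computation amounts
to running the predicate as a scalar. -/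
theorem doo_assert {s t : Tm} (hs : IsScalar C s) (ht : IsScalar C t) {Γ : Ctx C} {a : Tm}
    {A : Ty C} (ha : Der Γ (ty a A)) : Der Γ (eq (doo (assert s a) t) (doo s t) .two) := by
  have hi : Der Γ (ty (instr s a) (.sum A A)) := .instr (n := 2) (hs.2 _) ha
  have hf : ∀ Δ : Ctx C, Der Δ (ty Tm.fail .two) := isScalar_fail.2
  have ctu := ht.1.closedUnder
  have cfu := closed_fail.closedUnder
  have inlt : ∀ {Δ : Ctx C} {r : Tm} {B : Ty C}, Der Δ (ty r B) →
      Der Δ (eq (caseOf (Tm.inl r) t Tm.fail) t .two) := fun {Δ r B} hr => by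
    have := case_inl (B := .one) hr (ht.2 _) (hf _)
    rwa [ht.1.inst_eq] at this
  have inrt : ∀ (Δ : Ctx C) (B : Ty C), Der Δ (eq (caseOf Tm.fail t Tm.fail) Tm.fail .two) :=
    fun Δ B => case_inr (A := B) .unit (ht.2 _) (hf _)
  have h1 : Der Γ (eq (doo (assert s a) t) (caseOf (instr s a) t Tm.fail) .two) :=
    .trans (case_case (B' := .one) hi (.inl var_zero_ty) (.inr .unit) (ht.2 _) (hf _) ctu cfu)
      (case_congr (.ref hi) (inlt var_zero_ty) (inrt _ .one))
  have h2 : Der Γ (eq (caseOf (instr s a) (Tm.inl star) (Tm.inr star)) s .two) := by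
    have := Der.instrTest (n := 2) (hs.2 _) ha
    rwa [hs.1.inst_eq] at this
  have h3 : Der Γ (eq (doo (caseOf (instr s a) (Tm.inl star) (Tm.inr star)) t)
      (caseOf (instr s a) t Tm.fail) .two) :=
    .trans (case_case hi (.inl .unit) (.inr .unit) (ht.2 _) (hf _) ctu cfu)
      (case_congr (.ref hi) (inlt .unit) (inrt _ .one))
  exact .trans h1 (.trans (.sym h3) (doo_congr h2 fun Δ => .ref (ht.2 Δ)))

end COMET

namespace COMET

universe u

open Tm Jdg

variable {C : Type u}

/-! ### Finite distributions -/

/-- The closed values of all types together. -/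
inductive Val : Type where
  | star : Val
  | pair (a b : Val) : Val
  | inl (a : Val) : Val
  | inr (a : Val) : Val

/-- Formal rational combinations of values. Terms are interpreted as such combinations; those of
well-typed terms are probability distributions. -/
abbrev Dist : Type := Val →₀ ℚ

namespace Dist

/-- The point distribution at a value. -/
noncomputable def pure (v : Val) : Dist := Finsupp.single v 1

/-- The linear extension of a kernel. -/
noncomputable def bind (μ : Dist) (K : Val → Dist) : Dist := μ.sum fun v c => c • K v

/-- The sum of all coefficients. -/
noncomputable def total (μ : Dist) : ℚ := μ.sum fun _ c => c

theorem pure_self (v : Val) : pure v v = 1 := Finsupp.single_eq_same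

theorem eq_of_pure_ne_zero {v w : Val} (h : pure v w ≠ 0) : w = v := by
  classical
  by_contra hne
  exact h (Finsupp.single_eq_of_ne hne)

theorem pure_of_ne {v w : Val} (h : w ≠ v) : pure v w = 0 := by
  by_contra hne
  exact h (eq_of_pure_ne_zero hne)

theorem pure_nonneg (v w : Val) : 0 ≤ pure v w := by
  by_cases h : w = v
  · rw [h, pure_self]; exact zero_le_one
  · rw [pure_of_ne h]

theorem bind_eq (μ : Dist) (K : Val → Dist) : μ.bind K = Finsupp.linearCombination ℚ K μ := rfl

theorem total_eq (μ : Dist) : μ.total = Finsupp.linearCombination ℚ (fun _ => (1 : ℚ)) μ := by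
  simp [total, Finsupp.linearCombination_apply]

@[simp] theorem pure_bind (v : Val) (K : Val → Dist) : (pure v).bind K = K v := by
  simp [bind, pure]

@[simp] theorem zero_bind (K : Val → Dist) : bind 0 K = 0 := by simp [bind]

@[simp] theorem add_bind (μ ν : Dist) (K : Val → Dist) :
    (μ + ν).bind K = μ.bind K + ν.bind K := by simp only [bind_eq, map_add]

@[simp] theorem smul_bind (c : ℚ) (μ : Dist) (K : Val → Dist) :
    (c • μ).bind K = c • μ.bind K := by simp only [bind_eq, map_smul]

theorem bind_congr {μ : Dist} {K L : Val → Dist} (h : ∀ v, μ v ≠ 0 → K v = L v) :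
    μ.bind K = μ.bind L :=
  Finsupp.sum_congr fun v hv => by rw [h v (Finsupp.mem_support_iff.mp hv)]

theorem bind_pure (μ : Dist) : μ.bind pure = μ := by
  simp [bind, pure, Finsupp.sum_single]

theorem bind_bind (μ : Dist) (K L : Val → Dist) :
    (μ.bind K).bind L = μ.bind fun v => (K v).bind L := by
  rw [bind_eq _ L, bind, map_finsuppSum]
  simp only [map_smul]
  rfl

theorem bind_comm (μ ν : Dist) (K : Val → Val → Dist) :
    (μ.bind fun v => ν.bind fun w => K v w) = ν.bind fun w => μ.bind fun v => K v w := by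
  simp only [bind, Finsupp.smul_sum]
  rw [Finsupp.sum_comm]
  simp only [smul_smul, mul_comm]

theorem bind_add (μ : Dist) (K L : Val → Dist) :
    (μ.bind fun v => K v + L v) = μ.bind K + μ.bind L := by
  simp only [bind, smul_add, Finsupp.sum_add]

theorem bind_const (μ ν : Dist) : (μ.bind fun _ => ν) = μ.total • ν := by
  simp only [bind, total, Finsupp.sum, Finset.sum_smul]

theorem bind_apply (μ : Dist) (K : Val → Dist) (w : Val) :
    μ.bind K w = μ.sum fun v c => c * K v w := by
  simp [bind, Finsupp.sum, Finsupp.finsetSum_apply]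

@[simp] theorem total_pure (v : Val) : (pure v).total = 1 := by simp [total, pure]

@[simp] theorem total_add (μ ν : Dist) : (μ + ν).total = μ.total + ν.total := by
  simp only [total_eq, map_add]

@[simp] theorem total_sub (μ ν : Dist) : (μ - ν).total = μ.total - ν.total := by
  simp only [total_eq, map_sub]

@[simp] theorem total_smul (c : ℚ) (μ : Dist) : (c • μ).total = c * μ.total := by
  simp only [total_eq, map_smul, smul_eq_mul]

theorem total_bind (μ : Dist) (K : Val → Dist) :
    (μ.bind K).total = μ.sum fun v c => c * (K v).total := by
  rw [total_eq, bind, map_finsuppSum]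
  simp only [map_smul, smul_eq_mul, total_eq]

/-- A coefficient of `μ` that is read off from a single coefficient of `μ.bind K`. -/
theorem bind_apply_of_unique {μ : Dist} {K : Val → Dist} {v w : Val}
    (h1 : K v w = 1) (h0 : ∀ v', μ v' ≠ 0 → v' ≠ v → K v' w = 0) : μ.bind K w = μ v := by
  rw [bind_apply, Finsupp.sum, Finset.sum_eq_single v, h1, mul_one]
  · intro v' hv' hne
    rw [h0 v' (Finsupp.mem_support_iff.mp hv') hne, mul_zero]
  · intro hv
    rw [Finsupp.notMem_support_iff.mp hv, zero_mul]

end Dist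

open COMET.Dist

/-- A probability distribution on the values with the property `S`. -/
structure IsProb (S : Val → Prop) (μ : Dist) : Prop where
  nonneg : ∀ v, 0 ≤ μ v
  mem : ∀ v, μ v ≠ 0 → S v
  total : μ.total = 1

namespace IsProb

variable {S S' : Val → Prop} {μ ν : Dist}

theorem pure {v : Val} (h : S v) : IsProb S (pure v) :=
  ⟨pure_nonneg v, fun w hw => by rwa [eq_of_pure_ne_zero hw], total_pure v⟩

theorem bind_apply_nonneg {K : Val → Dist} (h : IsProb S μ) {w : Val}
    (hK : ∀ v, S v → 0 ≤ K v w) : 0 ≤ μ.bind K w := by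
  rw [bind_apply]
  exact Finset.sum_nonneg fun v hv =>
    mul_nonneg (h.nonneg v) (hK v (h.mem v (Finsupp.mem_support_iff.mp hv)))

theorem bind_apply_ne_zero {K : Val → Dist} (h : IsProb S μ) {v w : Val}
    (hK : ∀ v, S v → 0 ≤ K v w) (hv : μ v ≠ 0) (hw : K v w ≠ 0) : μ.bind K w ≠ 0 := by
  rw [bind_apply]
  refine ne_of_gt (Finset.sum_pos' (fun v hv =>
    mul_nonneg (h.nonneg v) (hK v (h.mem v (Finsupp.mem_support_iff.mp hv))))
    ⟨v, Finsupp.mem_support_iff.mpr hv, mul_pos ?_ ?_⟩)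
  · exact lt_of_le_of_ne (h.nonneg v) hv.symm
  · exact lt_of_le_of_ne (hK v (h.mem v hv)) hw.symm

theorem bind {K : Val → Dist} (h : IsProb S μ) (hK : ∀ v, S v → IsProb S' (K v)) :
    IsProb S' (μ.bind K) := by
  refine ⟨fun w => h.bind_apply_nonneg fun v hv => (hK v hv).nonneg w, fun w hw => ?_, ?_⟩
  · rw [bind_apply] at hw
    obtain ⟨v, hv, hne⟩ := Finset.exists_ne_zero_of_sum_ne_zero hw
    exact (hK v (h.mem v (Finsupp.mem_support_iff.mp hv))).mem w (right_ne_zero_of_mul hne)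
  · rw [total_bind, ← h.total, Dist.total]
    exact Finsupp.sum_congr fun v hv => by
      rw [(hK v (h.mem v (Finsupp.mem_support_iff.mp hv))).total, mul_one]

theorem bind_const (h : IsProb S μ) (ν : Dist) : (μ.bind fun _ => ν) = ν := by
  rw [Dist.bind_const, h.total, one_smul]

theorem bind_congr {K L : Val → Dist} (h : IsProb S μ) (hKL : ∀ v, S v → K v = L v) :
    μ.bind K = μ.bind L := Dist.bind_congr fun v hv => hKL v (h.mem v hv)

theorem exists_mem (h : IsProb S μ) : ∃ v, S v := by
  by_contra hS
  have : μ = 0 := by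
    ext v
    by_contra hv
    exact hS ⟨v, h.mem v hv⟩
  have ht := h.total
  simp [this, Dist.total] at ht

theorem eq_pure (h : IsProb S μ) {v : Val} (hS : ∀ w, S w → w = v) : μ = Dist.pure v := by
  have := h.bind_congr (K := Dist.pure) (L := fun _ => Dist.pure v) fun w hw => by rw [hS w hw]
  rwa [Dist.bind_pure, h.bind_const] at this

/-- Two distributions that agree off one value are equal, because both have total `1`. -/
theorem ext_of_ne (h : IsProb S μ) (h' : IsProb S' ν) (v : Val) (hne : ∀ w, w ≠ v → μ w = ν w) :
    μ = ν := by
  have hs : μ - ν = (μ v - ν v) • Dist.pure v := by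
    classical
    ext w
    by_cases hw : w = v
    · subst hw; simp [pure_self]
    · simp [hne w hw, Dist.pure, Finsupp.single_eq_of_ne hw]
  have ht : (μ - ν).total = 0 := by rw [total_sub, h.total, h'.total, sub_self]
  rw [hs, total_smul, total_pure, mul_one] at ht
  rw [ht, zero_smul] at hs
  exact sub_eq_zero.mp hs

end IsProb

/-! ### Interpretation of terms -/

/-- The values of a type. A type constant is interpreted like the type `1`. -/
def Ty.Mem : Ty C → Val → Prop
  | .const _, .star => True
  | .one, .star => True
  | .sum A _, .inl a => A.Mem a
  | .sum _ B, .inr b => B.Mem b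
  | .tensor A B, .pair a b => A.Mem a ∧ B.Mem b
  | _, _ => False

/-- Environments assign distributions, not only values, to the variables; this makes
substitution into a term an instance of evaluation. -/
abbrev Env : Type := ℕ → Dist

/-- The environment for one more bound variable. -/
def Env.cons (μ : Dist) (ρ : Env) : Env
  | 0 => μ
  | i + 1 => ρ i

namespace Val

/-- The kernel of a case distinction. -/
noncomputable def onSum (K L : Val → Dist) : Val → Dist
  | inl a => K a
  | inr b => L b
  | _ => 0

/-- The kernel of a pattern matching on pairs. -/
noncomputable def onPair (K : Val → Val → Dist) : Val → Dist
  | pair a b => K a b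
  | _ => 0

/-- The values `in_i(*)` of `𝐧`, turned into the values `in_i(a)` of `n · A`. -/
def graft (a : Val) : Val → Val
  | star => a
  | pair b c => pair b c
  | inl b => inl (graft a b)
  | inr b => inr (graft a b)

@[simp] theorem onSum_inl (K L : Val → Dist) (a : Val) : onSum K L (inl a) = K a := rfl

@[simp] theorem onSum_inr (K L : Val → Dist) (a : Val) : onSum K L (inr a) = L a := rfl

@[simp] theorem onPair_pair (K : Val → Val → Dist) (a b : Val) :
    onPair K (pair a b) = K a b := rfl

theorem onSum_bind (K L M : Val → Dist) (v : Val) :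
    (onSum K L v).bind M = onSum (fun a => (K a).bind M) (fun b => (L b).bind M) v := by
  cases v <;> simp [onSum]

theorem onPair_bind (K : Val → Val → Dist) (M : Val → Dist) (v : Val) :
    (onPair K v).bind M = onPair (fun a b => (K a b).bind M) v := by
  cases v <;> simp [onPair]

end Val

open Val

/-- The combination of values denoted by a term. The sum `s ⊕ t` adds the success probabilities;
its failure probability is that of `s` plus that of `t` minus one. The definition
is total, and it is meaningful on well-typed terms only. -/
noncomputable def Tm.eval : Tm → Env → Dist
  | .var i, ρ => ρ i
  | .star, _ => Dist.pure Val.star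
  | .pair s t, ρ => (s.eval ρ).bind fun a => (t.eval ρ).bind fun b => Dist.pure (Val.pair a b)
  | .lett s t, ρ => (s.eval ρ).bind (onPair fun a b =>
      t.eval (Env.cons (Dist.pure b) (Env.cons (Dist.pure a) ρ)))
  | .magic _, _ => 0
  | .inl t, ρ => (t.eval ρ).bind fun a => Dist.pure (Val.inl a)
  | .inr t, ρ => (t.eval ρ).bind fun a => Dist.pure (Val.inr a)
  | .caseOf r s t, ρ => (r.eval ρ).bind (onSum (fun a => s.eval (Env.cons (Dist.pure a) ρ))
      (fun b => t.eval (Env.cons (Dist.pure b) ρ)))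
  | .inlr s t, ρ => (s.eval ρ).bind (onSum (fun a => Dist.pure (Val.inl a)) fun _ => 0) +
      (t.eval ρ).bind (onSum (fun b => Dist.pure (Val.inr b)) fun _ => 0)
  | .left t, ρ => (t.eval ρ).bind (onSum Dist.pure fun _ => 0)
  | .instr t s, ρ => (s.eval ρ).bind fun a =>
      (t.eval (Env.cons (Dist.pure a) ρ)).bind fun k => Dist.pure (graft a k)
  | .oneOver n, _ => (1 / n : ℚ) • Dist.pure (Val.inl Val.star) +
      (1 - 1 / n : ℚ) • Dist.pure (Val.inr Val.star)
  | .norm t, ρ => ((t.eval ρ).bind (onSum Dist.pure fun _ => 0)).total⁻¹ •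
      (t.eval ρ).bind (onSum Dist.pure fun _ => 0)
  | .osum s t, ρ => s.eval ρ + t.eval ρ - Dist.pure (Val.inr Val.star)
  | .bound m n, _ => (m / n : ℚ) • Dist.pure (Val.inl (Val.inl Val.star)) +
      (1 / n : ℚ) • Dist.pure (Val.inl (Val.inr Val.star)) +
      (1 - (m + 1) / n : ℚ) • Dist.pure (Val.inr Val.star)

theorem Env.cons_comp_upr (μ : Dist) (ρ : Env) (f : ℕ → ℕ) :
    (fun i => Env.cons μ ρ (upr f i)) = Env.cons μ fun i => ρ (f i) := by
  funext i; cases i <;> rfl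

theorem eval_rename (t : Tm) (f : ℕ → ℕ) (ρ : Env) :
    (t.rename f).eval ρ = t.eval fun i => ρ (f i) := by
  induction t generalizing f ρ <;> simp_all [Tm.rename, Tm.eval, Env.cons_comp_upr]

theorem eval_shift (t : Tm) (μ : Dist) (ρ : Env) : t.shift.eval (Env.cons μ ρ) = t.eval ρ :=
  eval_rename t _ _

theorem eval_shiftUnder (t : Tm) (μ ν : Dist) (ρ : Env) :
    t.shiftUnder.eval (Env.cons μ (Env.cons ν ρ)) = t.eval (Env.cons μ ρ) := by
  rw [shiftUnder, eval_rename, Env.cons_comp_upr]; rfl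

theorem eval_shiftUnderTwo (t : Tm) (μ μ' ν : Dist) (ρ : Env) :
    t.shiftUnderTwo.eval (Env.cons μ (Env.cons μ' (Env.cons ν ρ))) =
      t.eval (Env.cons μ (Env.cons μ' ρ)) := by
  rw [shiftUnderTwo, eval_rename, Env.cons_comp_upr, Env.cons_comp_upr]; rfl

theorem Env.cons_eval_ups (μ : Dist) (ρ : Env) (σ : ℕ → Tm) :
    (fun i => (ups σ i).eval (Env.cons μ ρ)) = Env.cons μ fun i => (σ i).eval ρ := by
  funext i
  cases i with
  | zero => rfl
  | succ i => exact eval_shift _ _ _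

theorem eval_subst (t : Tm) (σ : ℕ → Tm) (ρ : Env) :
    (t.subst σ).eval ρ = t.eval fun i => (σ i).eval ρ := by
  induction t generalizing σ ρ <;> simp_all [Tm.subst, Tm.eval, Env.cons_eval_ups]

theorem eval_inst (t s : Tm) (ρ : Env) : (t.inst s).eval ρ = t.eval (Env.cons (s.eval ρ) ρ) := by
  rw [inst, eval_subst]
  congr 1
  funext i; cases i <;> rfl

theorem eval_instTwo (t r s : Tm) (ρ : Env) :
    (t.instTwo r s).eval ρ = t.eval (Env.cons (s.eval ρ) (Env.cons (r.eval ρ) ρ)) := by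
  rw [instTwo, eval_subst]
  congr 1
  funext i
  match i with
  | 0 => rfl
  | 1 => rfl
  | i + 2 => rfl

/-! ### Multilinearity -/

/-- The environment assigns distributions of the right types. -/
def Models (Γ : Ctx C) (ρ : Env) : Prop := ∀ i A, Γ i = some A → IsProb A.Mem (ρ i)

namespace Models

variable {Γ Δ Ξ : Ctx C} {ρ : Env}

theorem cons {A : Ty C} {μ : Dist} (h : Models Γ ρ) (hμ : IsProb A.Mem μ) :
    Models (Γ.cons A) (Env.cons μ ρ)
  | 0, _, hi => by cases hi; exact hμ
  | i + 1, B, hi => h i B hi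

theorem empty (ρ : Env) : Models (Ctx.empty : Ctx C) ρ := fun _ _ h => nomatch h

theorem left (h : Models Ξ ρ) (hs : Ξ.Split Γ Δ) : Models Γ ρ := fun i A hi => by
  rcases hs i with ⟨h1, -⟩ | ⟨h1, -⟩
  · exact h i A (h1 ▸ hi)
  · rw [h1] at hi; cases hi

theorem right (h : Models Ξ ρ) (hs : Ξ.Split Γ Δ) : Models Δ ρ := fun i A hi => by
  rcases hs i with ⟨-, h1⟩ | ⟨-, h1⟩
  · rw [h1] at hi; cases hi
  · exact h i A (h1 ▸ hi)

theorem update (h : Models Γ ρ) {i : ℕ} {A : Ty C} (hi : Γ i = some A) {v : Val}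
    (hv : A.Mem v) : Models Γ (Function.update ρ i (Dist.pure v)) := fun j B hj => by
  by_cases hji : j = i
  · subst hji
    rw [hi] at hj
    cases hj
    rw [Function.update_self]
    exact .pure hv
  · rw [Function.update_of_ne hji]
    exact h j B hj

end Models

theorem Env.update_cons (μ ν : Dist) (ρ : Env) (i : ℕ) :
    Function.update (Env.cons μ ρ) (i + 1) ν = Env.cons μ (Function.update ρ i ν) := by
  funext j
  cases j with
  | zero => rfl
  | succ j =>
    by_cases h : j = i
    · subst h; simp [Env.cons]
    · rw [Function.update_of_ne (by omega : j + 1 ≠ i + 1)]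
      exact (Function.update_of_ne h _ _).symm

theorem Env.update_cons_zero (μ ν : Dist) (ρ : Env) :
    Function.update (Env.cons μ ρ) 0 ν = Env.cons ν ρ := by
  funext j
  cases j <;> simp [Env.cons]

/-- On the environments of type `Γ`, the function `F` depends only on the variables of `Γ`,
and on each of them linearly. This is the semantic trace of the linearity of the type theory. -/
structure Multilinear (Γ : Ctx C) (F : Env → Dist) : Prop where
  depends : ∀ {ρ ρ'}, Models Γ ρ → (∀ i, Γ i ≠ none → ρ i = ρ' i) → F ρ = F ρ'
  linear : ∀ {ρ}, Models Γ ρ → ∀ {i A}, Γ i = some A →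
    F ρ = (ρ i).bind fun v => F (Function.update ρ i (Dist.pure v))

/-- The semantic counterpart of `Γ ⊢ t : A`, where `S` is the property of being a value
of the type `A`. -/
structure Admissible (Γ : Ctx C) (S : Val → Prop) (F : Env → Dist) : Prop
    extends Multilinear Γ F where
  prob : ∀ {ρ}, Models Γ ρ → IsProb S (F ρ)

namespace Multilinear

variable {Γ Δ Ξ : Ctx C} {F G : Env → Dist} {ρ ρ' : Env}

theorem congr (h : Multilinear Γ F) (hFG : ∀ {ρ}, Models Γ ρ → F ρ = G ρ) :
    Multilinear Γ G where
  depends {ρ ρ'} hρ e := by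
    have hρ' : Models Γ ρ' := fun i A hi => e i (by simp [hi]) ▸ hρ i A hi
    rw [← hFG hρ, ← hFG hρ', h.depends hρ e]
  linear {ρ} hρ {i A} hi := by
    rw [← hFG hρ, h.linear hρ hi]
    exact (hρ i A hi).bind_congr fun v hv => hFG (hρ.update hi hv)

theorem const (Γ : Ctx C) (μ : Dist) : Multilinear Γ fun _ => μ where
  depends _ _ := rfl
  linear hρ _ _ hi := ((hρ _ _ hi).bind_const μ).symm

theorem add (hF : Multilinear Γ F) (hG : Multilinear Γ G) :
    Multilinear Γ fun ρ => F ρ + G ρ where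
  depends hρ e := by rw [hF.depends hρ e, hG.depends hρ e]
  linear hρ _ _ hi := by rw [bind_add, ← hF.linear hρ hi, ← hG.linear hρ hi]

theorem bind_kernel (hF : Multilinear Γ F) (K : Val → Dist) :
    Multilinear Γ fun ρ => (F ρ).bind K where
  depends hρ e := by rw [hF.depends hρ e]
  linear hρ _ _ hi := by rw [← bind_bind, ← hF.linear hρ hi]

/-- Composition; each variable is used by only one of the two parts. -/
theorem bind {S : Val → Prop} {K : Val → Env → Dist} (hs : Ξ.Split Γ Δ) (hF : Admissible Γ S F)
    (hK : ∀ v, S v → Multilinear Δ (K v)) :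
    Multilinear Ξ fun ρ => (F ρ).bind fun v => K v ρ where
  depends {ρ ρ'} hρ e := by
    have h1 : F ρ = F ρ' := hF.depends (hρ.left hs) fun i hi => e i fun hn => hi (by
      rcases hs i with ⟨h1, -⟩ | ⟨h1, -⟩
      · rw [h1, hn]
      · exact h1)
    rw [← h1]
    exact (hF.prob (hρ.left hs)).bind_congr fun v hv =>
      (hK v hv).depends (hρ.right hs) fun i hi => e i fun hn => hi (by
        rcases hs i with ⟨-, h1⟩ | ⟨-, h1⟩
        · exact h1
        · rw [h1, hn])
  linear {ρ} hρ {i A} hi := by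
    rcases hs i with ⟨h1, h2⟩ | ⟨h1, h2⟩
    · rw [hi] at h1
      rw [hF.linear (hρ.left hs) h1, bind_bind]
      refine (hρ i A hi).bind_congr fun v hv => ?_
      refine (hF.prob ((hρ.left hs).update h1 hv)).bind_congr fun w hw => ?_
      refine (hK w hw).depends (hρ.right hs) fun j hj => ?_
      rw [Function.update_of_ne]
      rintro rfl
      exact hj h2
    · rw [hi] at h2
      have h3 : ∀ v, F (Function.update ρ i (Dist.pure v)) = F ρ := fun v =>
        (hF.depends (hρ.left hs) fun j hj => by
          rw [Function.update_of_ne]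
          rintro rfl
          exact hj h1).symm
      simp only [h3]
      rw [bind_comm]
      exact (hF.prob (hρ.left hs)).bind_congr fun w hw => (hK w hw).linear (hρ.right hs) h2

theorem cons_pure {A : Ty C} (h : Multilinear (Γ.cons A) F) {v : Val} (hv : A.Mem v) :
    Multilinear Γ fun ρ => F (Env.cons (Dist.pure v) ρ) where
  depends {ρ ρ'} hρ e := h.depends (hρ.cons (.pure hv)) fun
    | 0, _ => rfl
    | i + 1, hi => e i hi
  linear {ρ} hρ {i A} hi := by
    rw [h.linear (hρ.cons (.pure hv)) (i := i + 1) hi]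
    simp only [Env.update_cons]
    rfl

/-- Substitution is composition. -/
theorem cons_eq {A : Ty C} (h : Multilinear (Γ.cons A) F) (hρ : Models Γ ρ) {μ : Dist}
    (hμ : IsProb A.Mem μ) :
    F (Env.cons μ ρ) = μ.bind fun v => F (Env.cons (Dist.pure v) ρ) := by
  rw [h.linear (hρ.cons hμ) (i := 0) rfl]
  simp only [Env.update_cons_zero]
  rfl

end Multilinear

namespace Admissible

variable {Γ Δ Ξ : Ctx C} {S S' : Val → Prop} {F G : Env → Dist} {ρ : Env}

theorem congr (h : Admissible Γ S F) (hFG : ∀ {ρ}, Models Γ ρ → F ρ = G ρ) :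
    Admissible Γ S G where
  toMultilinear := h.toMultilinear.congr hFG
  prob hρ := hFG hρ ▸ h.prob hρ

theorem const (Γ : Ctx C) {μ : Dist} (h : IsProb S μ) : Admissible Γ S fun _ => μ where
  toMultilinear := .const Γ μ
  prob _ := h

theorem bind {K : Val → Env → Dist} (hs : Ξ.Split Γ Δ) (hF : Admissible Γ S F)
    (hK : ∀ v, S v → Admissible Δ S' (K v)) :
    Admissible Ξ S' fun ρ => (F ρ).bind fun v => K v ρ where
  toMultilinear := .bind hs hF fun v hv => (hK v hv).toMultilinear
  prob hρ := (hF.prob (hρ.left hs)).bind fun v hv => (hK v hv).prob (hρ.right hs)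

theorem bind_kernel {K : Val → Dist} (hF : Admissible Γ S F) (hK : ∀ v, S v → IsProb S' (K v)) :
    Admissible Γ S' fun ρ => (F ρ).bind K where
  toMultilinear := hF.toMultilinear.bind_kernel K
  prob hρ := (hF.prob hρ).bind hK

theorem cons_pure {A : Ty C} (h : Admissible (Γ.cons A) S F) {v : Val} (hv : A.Mem v) :
    Admissible Γ S fun ρ => F (Env.cons (Dist.pure v) ρ) where
  toMultilinear := h.toMultilinear.cons_pure hv
  prob hρ := h.prob (hρ.cons (.pure hv))

theorem var {i : ℕ} {A : Ty C} (hi : Γ i = some A) : Admissible Γ A.Mem fun ρ => ρ i where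
  depends _ e := e i (by simp [hi])
  linear {ρ} hρ {j B} hj := by
    by_cases h : j = i
    · subst h
      simp only [Function.update_self]
      exact (bind_pure _).symm
    · simp only [Function.update_of_ne (Ne.symm h)]
      exact ((hρ j B hj).bind_const _).symm
  prob hρ := hρ i A hi

/-- In the empty context, nothing depends on the environment. -/
theorem eq_of_empty (h : Admissible (Ctx.empty : Ctx C) S F) (ρ ρ' : Env) : F ρ = F ρ' :=
  h.depends (.empty ρ) fun _ hi => absurd rfl hi

end Admissible

/-- The meaning of judgements in the model. For equations it includes that the left-hand side has
a meaning of the right type; for the right-hand side this follows (`Jdg.Holds.right`). -/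
def Jdg.Holds (Γ : Ctx C) : Jdg C → Prop
  | ty t A => Admissible Γ A.Mem t.eval
  | eq s t A => Admissible Γ A.Mem s.eval ∧ ∀ ρ, Models Γ ρ → s.eval ρ = t.eval ρ
  | le s t _ => ∀ ρ, Models Γ ρ → ∀ a, s.eval ρ (Val.inl a) ≤ t.eval ρ (Val.inl a)

/-! ### Soundness of the formation rules -/

namespace Admissible

variable {Γ Δ Ξ ΔΘ Θ : Ctx C} {A B D A' B' : Ty C} {r s t s' t' : Tm}

theorem onSum {K L : Val → Env → Dist} {S : Val → Prop}
    (hK : ∀ a, A.Mem a → Admissible Γ S (K a)) (hL : ∀ b, B.Mem b → Admissible Γ S (L b)) :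
    ∀ v, (Ty.sum A B).Mem v →
      Admissible Γ S fun ρ => Val.onSum (fun a => K a ρ) (fun b => L b ρ) v
  | .inl a, ha => hK a ha
  | .inr b, hb => hL b hb

theorem onPair {K : Val → Val → Env → Dist} {S : Val → Prop}
    (hK : ∀ a b, A.Mem a → B.Mem b → Admissible Γ S (K a b)) :
    ∀ v, (Ty.tensor A B).Mem v → Admissible Γ S fun ρ => Val.onPair (fun a b => K a b ρ) v
  | .pair a b, hab => hK a b hab.1 hab.2

theorem star : Admissible Γ (Ty.one (C := C)).Mem Tm.star.eval := .const Γ (.pure trivial)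

theorem pair (hs : Ξ.Split Γ Δ) (h : Admissible Γ A.Mem s.eval) (h' : Admissible Δ B.Mem t.eval) :
    Admissible Ξ (Ty.tensor A B).Mem (Tm.pair s t).eval :=
  .bind hs h fun _ ha => .bind_kernel h' fun _ hb => .pure ⟨ha, hb⟩

theorem lett (hs : Ξ.Split Γ Δ) (h : Admissible Γ (Ty.tensor A B).Mem s.eval)
    (h' : Admissible ((Δ.cons A).cons B) D.Mem t.eval) : Admissible Ξ D.Mem (Tm.lett s t).eval :=
  .bind hs h (.onPair fun _ _ ha hb => (h'.cons_pure hb).cons_pure ha)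

theorem not_mem_zero {v : Val} : ¬ (Ty.zero : Ty C).Mem v := by cases v <;> exact id

theorem of_zero (h : Admissible Γ (Ty.zero (C := C)).Mem s.eval) {ρ : Env} (hρ : Models Γ ρ) :
    False := by
  obtain ⟨v, hv⟩ := (h.prob hρ).exists_mem
  exact not_mem_zero hv

theorem magic (h : Admissible Γ (Ty.zero (C := C)).Mem s.eval) :
    Admissible Γ A.Mem (Tm.magic s).eval where
  depends hρ _ := (h.of_zero hρ).elim
  linear hρ _ _ _ := (h.of_zero hρ).elim
  prob hρ := (h.of_zero hρ).elim

theorem inl (h : Admissible Γ A.Mem s.eval) : Admissible Γ (Ty.sum A B).Mem (Tm.inl s).eval :=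
  .bind_kernel h fun _ ha => .pure ha

theorem inr (h : Admissible Γ B.Mem s.eval) : Admissible Γ (Ty.sum A B).Mem (Tm.inr s).eval :=
  .bind_kernel h fun _ ha => .pure ha

theorem caseOf (hs : Ξ.Split Γ Δ) (h : Admissible Γ (Ty.sum A B).Mem r.eval)
    (h' : Admissible (Δ.cons A) D.Mem s.eval) (h'' : Admissible (Δ.cons B) D.Mem t.eval) :
    Admissible Ξ D.Mem (Tm.caseOf r s t).eval :=
  .bind hs h (.onSum (fun _ ha => h'.cons_pure ha) fun _ hb => h''.cons_pure hb)

end Admissible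

theorem mem_one {v : Val} : (Ty.one : Ty C).Mem v ↔ v = Val.star := by
  cases v <;> simp [Ty.Mem]

theorem mem_part {A : Ty C} {v : Val} (h : A.part.Mem v) :
    (∃ a, A.Mem a ∧ v = Val.inl a) ∨ v = Val.inr Val.star := by
  match v, h with
  | .inl a, h => exact .inl ⟨a, h, rfl⟩
  | .inr b, h => exact .inr (by rw [mem_one.mp h])

/-- The side condition of a partial pairing `⟨⟨s, t⟩⟩`, restated as: `s` succeeds with the
probability with which `t` fails, and the other way round. -/
theorem inlr_complement {s t : Tm} {ρ : Env} (h : (isInl s).eval ρ = (isInr t).eval ρ) (μ : Dist) :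
    ((s.eval ρ).bind (onSum (fun _ => μ) fun _ => 0) =
      (t.eval ρ).bind (onSum (fun _ => 0) fun _ => μ)) ∧
    ((s.eval ρ).bind (onSum (fun _ => 0) fun _ => μ) =
      (t.eval ρ).bind (onSum (fun _ => μ) fun _ => 0)) := by
  have key : ∀ K : Val → Dist, ((isInl s).eval ρ).bind K = ((isInr t).eval ρ).bind K :=
    fun K => by rw [h]
  have h1 := key (onSum (fun _ => μ) fun _ => 0)
  have h2 := key (onSum (fun _ => 0) fun _ => μ)
  simp only [isInl, isInr, top, bot, eval, bind_bind, onSum_bind, pure_bind, onSum_inl,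
    onSum_inr] at h1 h2
  exact ⟨h1, h2⟩

theorem onSum_add (K K' L L' : Val → Dist) (v : Val) :
    onSum K L v + onSum K' L' v = onSum (fun a => K a + K' a) (fun b => L b + L' b) v := by
  cases v <;> simp [onSum]

theorem bind_onSum_add (μ : Dist) (K K' L L' : Val → Dist) :
    μ.bind (onSum K L) + μ.bind (onSum K' L') =
      μ.bind (onSum (fun a => K a + K' a) fun b => L b + L' b) := by
  rw [← bind_add]; simp only [onSum_add]

theorem IsProb.bind_onSum_eta {A B : Ty C} {μ : Dist} (h : IsProb (Ty.sum A B).Mem μ) :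
    μ.bind (onSum (fun a => Dist.pure (Val.inl a)) fun b => Dist.pure (Val.inr b)) = μ := by
  conv_rhs => rw [← bind_pure μ]
  refine h.bind_congr ?_
  rintro (_ | _ | _ | _) hv
  · exact hv.elim
  · exact hv.elim
  · rfl
  · rfl

theorem proj_one_eval (s : Tm) (ρ : Env) : (proj 2 1 s).eval ρ = (s.eval ρ).bind
    (onSum (fun a => Dist.pure (Val.inl a)) fun _ => Dist.pure (Val.inr Val.star)) := by
  simp [proj, ncase, inst, shiftUnder, Tm.rename, upr, ret, Tm.fail, Tm.subst, scons, eval,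
    Env.cons]

theorem proj_two_eval (s : Tm) (ρ : Env) : (proj 2 2 s).eval ρ = (s.eval ρ).bind
    (onSum (fun _ => Dist.pure (Val.inr Val.star)) fun a => Dist.pure (Val.inl a)) := by
  simp [proj, ncase, inst, shiftUnder, Tm.rename, ret, Tm.fail, Tm.subst, eval,
    Env.cons]

theorem IsProb.bind_onSum_part {A : Ty C} {μ : Dist} (h : IsProb A.part.Mem μ) :
    μ.bind (onSum (fun a => Dist.pure (Val.inl a)) fun _ => 0) +
      μ.bind (onSum (fun _ => 0) fun _ => Dist.pure (Val.inr Val.star)) = μ := by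
  rw [bind_onSum_add]
  conv_rhs => rw [← bind_pure μ]
  refine h.bind_congr fun v hv => ?_
  rcases mem_part hv with ⟨a, -, rfl⟩ | rfl <;> simp

theorem proj_one_inlr_eval {A : Ty C} {s t : Tm} {ρ : Env} (hs : IsProb A.part.Mem (s.eval ρ))
    (h : (isInl s).eval ρ = (isInr t).eval ρ) :
    (proj 2 1 (Tm.inlr s t)).eval ρ = s.eval ρ := by
  rw [proj_one_eval, eval, add_bind]
  simp only [bind_bind, onSum_bind, pure_bind, onSum_inl, onSum_inr, zero_bind]
  rw [← (inlr_complement h _).2, hs.bind_onSum_part]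

theorem proj_two_inlr_eval {B : Ty C} {s t : Tm} {ρ : Env} (ht : IsProb B.part.Mem (t.eval ρ))
    (h : (isInl s).eval ρ = (isInr t).eval ρ) :
    (proj 2 2 (Tm.inlr s t)).eval ρ = t.eval ρ := by
  rw [proj_two_eval, eval, add_bind]
  simp only [bind_bind, onSum_bind, pure_bind, onSum_inl, onSum_inr, zero_bind]
  rw [(inlr_complement h _).1, add_comm, ht.bind_onSum_part]

theorem inlr_eval_nonneg {A B : Ty C} {s t : Tm} {ρ : Env} (hs : IsProb A.part.Mem (s.eval ρ))
    (ht : IsProb B.part.Mem (t.eval ρ)) (v : Val) : 0 ≤ (Tm.inlr s t).eval ρ v := by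
  rw [eval, Finsupp.add_apply]
  refine add_nonneg (hs.bind_apply_nonneg ?_) (ht.bind_apply_nonneg ?_)
  · rintro (_ | _ | _ | _) _ <;> simp [onSum, pure_nonneg]
  · rintro (_ | _ | _ | _) _ <;> simp [onSum, pure_nonneg]

theorem admissible_inlr {Γ : Ctx C} {A B : Ty C} {s t : Tm} (hs : Admissible Γ A.part.Mem s.eval)
    (ht : Admissible Γ B.part.Mem t.eval)
    (h : ∀ ρ, Models Γ ρ → (isInl s).eval ρ = (isInr t).eval ρ) :
    Admissible Γ (Ty.sum A B).Mem (Tm.inlr s t).eval where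
  toMultilinear := (hs.toMultilinear.bind_kernel _).add (ht.toMultilinear.bind_kernel _)
  prob {ρ} hρ := by
    have h1 := hs.prob hρ
    have h2 := ht.prob hρ
    refine ⟨inlr_eval_nonneg h1 h2, fun v hv => ?_, ?_⟩
    · rw [eval, Finsupp.add_apply] at hv
      have key : ∀ {E : Ty C} {μ : Dist} (f : Val → Val), IsProb E.part.Mem μ →
          (∀ a, E.Mem a → (Ty.sum A B).Mem (f a)) →
          μ.bind (onSum (fun a => Dist.pure (f a)) fun _ => 0) v ≠ 0 →
          (Ty.sum A B).Mem v := fun f hμ hf hne => by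
        rw [bind_apply] at hne
        obtain ⟨w, hw, hne⟩ := Finset.exists_ne_zero_of_sum_ne_zero hne
        have hne := right_ne_zero_of_mul hne
        rcases mem_part (hμ.mem w (Finsupp.mem_support_iff.mp hw)) with ⟨a, ha, rfl⟩ | rfl
        · rw [eq_of_pure_ne_zero hne]
          exact hf a ha
        · simp at hne
      by_cases h3 : (s.eval ρ).bind (onSum (fun a => Dist.pure (Val.inl a)) fun _ => 0) v = 0
      · rw [h3, zero_add] at hv
        exact key Val.inr h2 (fun _ => id) hv
      · exact key Val.inl h1 (fun _ => id) h3
    · -- the total mass is that of the first projection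
      have h4 := congrArg Dist.total (proj_one_inlr_eval h1 (h ρ hρ))
      rw [h1.total, proj_one_eval, eval, add_bind] at h4
      simp only [bind_bind, onSum_bind, pure_bind, onSum_inl, onSum_inr, zero_bind] at h4
      rw [eval, total_add, ← h4, total_add]
      congr 1
      simp only [total_bind]
      refine Finsupp.sum_congr fun w _ => ?_
      cases w <;> simp [onSum]

theorem left_eval_mem {A B : Ty C} {t : Tm} {ρ : Env} (ht : IsProb (Ty.sum A B).Mem (t.eval ρ))
    (h : (isInl t).eval ρ = top.eval ρ) {v : Val} (hv : t.eval ρ v ≠ 0) :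
    ∃ a, A.Mem a ∧ v = Val.inl a := by
  match v, hv, ht.mem v hv with
  | .inl a, _, ha => exact ⟨a, ha, rfl⟩
  | .inr b, hv, _ =>
    exfalso
    have h0 : (isInl t).eval ρ (Val.inr Val.star) ≠ 0 := by
      simp only [isInl, top, bot, eval, pure_bind]
      refine ht.bind_apply_ne_zero ?_ hv (by simp [pure_self])
      rintro (_ | _ | _ | _) _ <;> simp [onSum, pure_nonneg]
    rw [h] at h0
    simp only [top, eval, pure_bind] at h0
    have := eq_of_pure_ne_zero h0
    cases this

theorem inl_left_eval {A B : Ty C} {t : Tm} {ρ : Env} (ht : IsProb (Ty.sum A B).Mem (t.eval ρ))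
    (h : (isInl t).eval ρ = top.eval ρ) : (Tm.inl (Tm.left t)).eval ρ = t.eval ρ := by
  simp only [eval, bind_bind, onSum_bind, pure_bind, zero_bind]
  conv_rhs => rw [← bind_pure (t.eval ρ)]
  refine Dist.bind_congr fun v hv => ?_
  obtain ⟨a, -, rfl⟩ := left_eval_mem ht h hv
  rfl

theorem admissible_left {Γ : Ctx C} {A B : Ty C} {t : Tm}
    (ht : Admissible Γ (Ty.sum A B).Mem t.eval)
    (h : ∀ ρ, Models Γ ρ → (isInl t).eval ρ = top.eval ρ) :
    Admissible Γ A.Mem (Tm.left t).eval where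
  toMultilinear := ht.toMultilinear.bind_kernel _
  prob {ρ} hρ := by
    have h1 : IsProb (fun v => ∃ a, A.Mem a ∧ v = Val.inl a) (t.eval ρ) :=
      ⟨(ht.prob hρ).nonneg, fun v hv => left_eval_mem (ht.prob hρ) (h ρ hρ) hv, (ht.prob hρ).total⟩
    exact h1.bind fun v ⟨a, ha, hv⟩ => by subst hv; exact .pure ha

/-- The success probability of a partial computation is that of the value `⊤` of its
domain predicate. -/
theorem total_bind_onSum (μ : Dist) : (μ.bind (onSum Dist.pure fun _ => 0)).total =
    μ.bind (onSum (fun _ => Dist.pure (Val.inl Val.star)) fun _ => Dist.pure (Val.inr Val.star))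
      (Val.inl Val.star) := by
  classical
  rw [total_bind, bind_apply]
  refine Finsupp.sum_congr fun v _ => ?_
  cases v <;> simp [onSum, Dist.pure, Dist.total]

theorem isInl_eval (t : Tm) (ρ : Env) : (isInl t).eval ρ = (t.eval ρ).bind
    (onSum (fun _ => Dist.pure (Val.inl Val.star)) fun _ => Dist.pure (Val.inr Val.star)) := by
  simp [isInl, top, bot, eval]

theorem oneOver_eval_inl (n : ℕ) (ρ : Env) :
    (oneOver n).eval ρ (Val.inl Val.star) = 1 / n := by
  simp [eval, Dist.pure]

theorem total_pos_of_le {n : ℕ} {t : Tm} (hn : 2 ≤ n) {ρ : Env}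
    (h : (oneOver n).eval ρ (Val.inl Val.star) ≤ (isInl t).eval ρ (Val.inl Val.star)) :
    0 < ((t.eval ρ).bind (onSum Dist.pure fun _ => 0)).total := by
  rw [oneOver_eval_inl, isInl_eval, ← total_bind_onSum] at h
  refine lt_of_lt_of_le ?_ h
  have : (0 : ℚ) < n := by exact_mod_cast (by omega : 0 < n)
  positivity

theorem admissible_norm {Γ : Ctx C} {A : Ty C} {t : Tm} {n : ℕ} (hn : 2 ≤ n)
    (ht : Admissible (Ctx.empty : Ctx C) A.part.Mem t.eval)
    (h : ∀ ρ, Models (Ctx.empty : Ctx C) ρ → ∀ a,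
      (oneOver n).eval ρ (Val.inl a) ≤ (isInl t).eval ρ (Val.inl a)) :
    Admissible Γ A.Mem (Tm.norm t).eval := by
  let ρ₀ : Env := fun _ => 0
  have h0 := total_pos_of_le hn (h ρ₀ (.empty _) Val.star)
  refine Admissible.congr (F := fun _ => (Tm.norm t).eval ρ₀) (.const Γ ?_) fun {ρ} _ => ?_
  · have h1 := ht.prob (.empty ρ₀)
    refine ⟨fun v => ?_, fun v hv => ?_, ?_⟩
    · rw [eval, Finsupp.smul_apply, smul_eq_mul]
      refine mul_nonneg (inv_nonneg.mpr h0.le) (h1.bind_apply_nonneg ?_)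
      rintro (_ | _ | _ | _) _ <;> simp [onSum, pure_nonneg]
    · rw [eval, Finsupp.smul_apply, smul_eq_mul] at hv
      have hne := right_ne_zero_of_mul hv
      rw [bind_apply] at hne
      obtain ⟨w, hw, hne⟩ := Finset.exists_ne_zero_of_sum_ne_zero hne
      have hne := right_ne_zero_of_mul hne
      rcases mem_part (h1.mem w (Finsupp.mem_support_iff.mp hw)) with ⟨a, ha, rfl⟩ | rfl
      · rwa [eq_of_pure_ne_zero hne]
      · simp at hne
    · rw [eval, total_smul, inv_mul_cancel₀ h0.ne']
  · simp only [eval, ht.eq_of_empty ρ₀ ρ]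

/-! ### Copowers and instruments -/

namespace Val

/-- The value `a` inside the value `in_i(a)` of `n · A`; irrelevant on other values. -/
def strip : ℕ → Val → Val
  | 0, v => v
  | 1, v => v
  | n + 2, inl v => strip (n + 1) v
  | _ + 2, inr v => v
  | _ + 2, v => v

/-- The index `i` of the value `in_i(a)` of `n · A`; irrelevant on other values. -/
def pos : ℕ → Val → ℕ
  | 0, _ => 0
  | 1, _ => 1
  | n + 2, inl v => pos (n + 1) v
  | n + 2, _ => n + 2

/-- The value `in_i(*)` for the value `in_i(a)` of `n · A`; irrelevant on other values. -/
def shape : ℕ → Val → Val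
  | 0, _ => star
  | 1, _ => star
  | n + 2, inl v => inl (shape (n + 1) v)
  | _ + 2, _ => inr star

end Val

/-- Inversion for the values of the copowers. -/
theorem mem_copower_succ {A : Ty C} {n : ℕ} {v : Val} (h : (Ty.copower (n + 2) A).Mem v) :
    (∃ w, (Ty.copower (n + 1) A).Mem w ∧ v = Val.inl w) ∨ ∃ a, A.Mem a ∧ v = Val.inr a := by
  match v, h with
  | .inl w, h => exact .inl ⟨w, h, rfl⟩
  | .inr a, h => exact .inr ⟨a, h, rfl⟩

theorem not_mem_copower_zero {A : Ty C} {v : Val} : ¬ (Ty.copower 0 A).Mem v :=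
  Admissible.not_mem_zero

theorem graft_strip_shape {A : Ty C} :
    ∀ {n : ℕ} {v : Val}, (Ty.copower n A).Mem v → graft (strip n v) (shape n v) = v
  | 0, _, h => (not_mem_copower_zero h).elim
  | 1, _, _ => rfl
  | n + 2, v, h => by
    rcases mem_copower_succ h with ⟨w, hw, rfl⟩ | ⟨a, ha, rfl⟩
    · exact congrArg Val.inl (graft_strip_shape (n := n + 1) hw)
    · rfl

theorem mem_graft {A : Ty C} {a : Val} (ha : A.Mem a) :
    ∀ {n : ℕ} {k : Val}, (Ty.fin n : Ty C).Mem k → (Ty.copower n A).Mem (graft a k)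
  | 0, _, h => (not_mem_copower_zero h).elim
  | 1, k, h => by
    rw [mem_one.mp (show (Ty.one : Ty C).Mem k from h)]
    exact ha
  | n + 2, v, h => by
    rcases mem_copower_succ h with ⟨w, hw, rfl⟩ | ⟨b, hb, rfl⟩
    · exact mem_graft ha (n := n + 1) hw
    · rw [mem_one.mp hb]
      exact ha

theorem strip_graft (a : Val) :
    ∀ {n : ℕ} {k : Val}, (Ty.fin n : Ty C).Mem k → strip n (graft a k) = a
  | 0, _, h => (not_mem_copower_zero h).elim
  | 1, k, h => by rw [mem_one.mp (show (Ty.one : Ty C).Mem k from h)]; rfl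
  | n + 2, v, h => by
    rcases mem_copower_succ h with ⟨w, hw, rfl⟩ | ⟨b, hb, rfl⟩
    · exact strip_graft a (n := n + 1) hw
    · rw [mem_one.mp hb]; rfl

theorem shape_graft (a : Val) :
    ∀ {n : ℕ} {k : Val}, (Ty.fin n : Ty C).Mem k → shape n (graft a k) = k
  | 0, _, h => (not_mem_copower_zero h).elim
  | 1, k, h => by rw [mem_one.mp (show (Ty.one : Ty C).Mem k from h)]; rfl
  | n + 2, v, h => by
    rcases mem_copower_succ h with ⟨w, hw, rfl⟩ | ⟨b, hb, rfl⟩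
    · exact congrArg Val.inl (shape_graft a (n := n + 1) hw)
    · rw [mem_one.mp hb]; rfl

/-- The meaning of an `n`-fold case distinction, provided that the first branch, into which the
scrutinee is substituted if `n = 1`, is linear. -/
theorem ncase_eval {A : Ty C} : ∀ {n : ℕ} {t : Tm} {f : ℕ → Tm} {ρ : Env},
    (∀ μ ρ, IsProb A.Mem μ →
      (f 1).eval (Env.cons μ ρ) = μ.bind fun v => (f 1).eval (Env.cons (Dist.pure v) ρ)) →
    IsProb (Ty.copower n A).Mem (t.eval ρ) →
    (ncase n t f).eval ρ =
      (t.eval ρ).bind fun v => (f (pos n v)).eval (Env.cons (Dist.pure (strip n v)) ρ)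
  | 0, t, f, ρ, _, h => by
    obtain ⟨v, hv⟩ := h.exists_mem
    exact (not_mem_copower_zero hv).elim
  | 1, t, f, ρ, hf, h => by
    rw [ncase, eval_inst, hf _ _ h]
    rfl
  | n + 2, t, f, ρ, hf, h => by
    rw [ncase, eval]
    refine h.bind_congr fun v hv => ?_
    rcases mem_copower_succ hv with ⟨w, hw, rfl⟩ | ⟨a, ha, rfl⟩
    · rw [onSum_inl, ncase_eval (A := A) (n := n + 1) ?_ ?_]
      · simp only [eval, Env.cons, Dist.pure_bind]
        rw [eval_shiftUnder]
        rfl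
      · intro μ ρ hμ
        have key : ∀ ν ρ, ((f 1).shiftUnder).eval (Env.cons ν ρ) =
            (f 1).eval (Env.cons ν fun i => ρ (i + 1)) := fun ν ρ => by
          rw [shiftUnder, eval_rename, Env.cons_comp_upr]
        simp only [key]
        exact hf _ _ hμ
      · exact .pure hw
    · rfl

theorem nabla_eval {A : Ty C} {n : ℕ} {t : Tm} {ρ : Env}
    (h : IsProb (Ty.copower n A).Mem (t.eval ρ)) :
    (nabla n t).eval ρ = (t.eval ρ).bind fun v => Dist.pure (strip n v) :=
  ncase_eval (A := A) (fun μ _ _ => (bind_pure μ).symm) h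

theorem pos_le {A : Ty C} : ∀ {n : ℕ} {v : Val}, (Ty.copower n A).Mem v → pos n v ≤ n
  | 0, _, _ => le_rfl
  | 1, _, _ => le_rfl
  | n + 2, v, h => by
    rcases mem_copower_succ h with ⟨w, hw, rfl⟩ | ⟨a, ha, rfl⟩
    · exact (pos_le (n := n + 1) hw).trans (Nat.le_succ _)
    · exact le_rfl

theorem inj_pos_eval {A : Ty C} : ∀ {n : ℕ} {v : Val} (ρ : Env), (Ty.copower n A).Mem v →
    (inj n (pos n v) Tm.star).eval ρ = Dist.pure (shape n v)
  | 0, _, _, h => (not_mem_copower_zero h).elim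
  | 1, _, _, _ => rfl
  | n + 2, v, ρ, h => by
    rcases mem_copower_succ h with ⟨w, hw, rfl⟩ | ⟨a, ha, rfl⟩
    · have hle : pos (n + 1) w ≤ n + 1 := pos_le hw
      rw [pos, inj, if_neg (by omega), eval, inj_pos_eval ρ hw, Dist.pure_bind]
      rfl
    · rw [pos, inj, if_pos rfl, eval, eval, Dist.pure_bind]
      · rfl
      · rintro _ ⟨⟩

theorem inj_star_eval (i : ℕ) (ρ ρ' : Env) :
    ∀ n, (inj n i Tm.star).eval ρ = (inj n i Tm.star).eval ρ'
  | 0 => rfl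
  | 1 => rfl
  | n + 2 => by
    rw [inj]
    split_ifs
    · rfl
    · rw [eval, eval, inj_star_eval i ρ ρ' (n + 1)]

theorem ind_eval {A : Ty C} {n : ℕ} {t : Tm} {ρ : Env}
    (h : IsProb (Ty.copower n A).Mem (t.eval ρ)) :
    (ind n t).eval ρ = (t.eval ρ).bind fun v => Dist.pure (shape n v) := by
  rw [ind, ncase_eval (A := A) (fun μ ρ hμ => ?_) h]
  · exact h.bind_congr fun v hv => inj_pos_eval _ hv
  · simp only [inj_star_eval 1 _ ρ n]
    exact (hμ.bind_const _).symm

theorem assert_eval {p t : Tm} {ρ : Env} {A : Ty C} (ht : IsProb A.Mem (t.eval ρ))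
    (hp : ∀ a, A.Mem a → IsProb (Ty.two : Ty C).Mem (p.eval (Env.cons (Dist.pure a) ρ))) :
    (assert p t).eval ρ = (t.eval ρ).bind fun a => (p.eval (Env.cons (Dist.pure a) ρ)).bind
      (onSum (fun _ => Dist.pure (Val.inl a)) fun _ => Dist.pure (Val.inr Val.star)) := by
  simp only [assert, eval, ret, Tm.fail, bind_bind, Dist.pure_bind, Env.cons]
  refine ht.bind_congr fun a ha => (hp a ha).bind_congr ?_
  rintro (_ | _ | b | b) hb
  · exact hb.elim
  · exact hb.elim
  · rw [mem_one.mp (show (Ty.one : Ty C).Mem b from hb)]; rfl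
  · rfl

/-! ### Soundness -/

theorem IsProb.bind_onSum_congr {A B : Ty C} {μ : Dist} (h : IsProb (Ty.sum A B).Mem μ)
    {K K' L L' : Val → Dist} (hK : ∀ a, A.Mem a → K a = K' a) (hL : ∀ b, B.Mem b → L b = L' b) :
    μ.bind (onSum K L) = μ.bind (onSum K' L') :=
  h.bind_congr fun
    | .inl a, ha => hK a ha
    | .inr b, hb => hL b hb

theorem IsProb.bind_onPair_congr {A B : Ty C} {μ : Dist} (h : IsProb (Ty.tensor A B).Mem μ)
    {K K' : Val → Val → Dist} (hK : ∀ a b, A.Mem a → B.Mem b → K a b = K' a b) :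
    μ.bind (onPair K) = μ.bind (onPair K') :=
  h.bind_congr fun
    | .pair a b, hab => hK a b hab.1 hab.2

theorem bindFst_eval (b : Tm) (ρ : Env) : b.bindFst.eval ρ = (b.eval ρ).bind (onSum
    (onSum (fun a => Dist.pure (Val.inl a)) fun _ => Dist.pure (Val.inr Val.star))
    fun _ => Dist.pure (Val.inr Val.star)) := by
  simp [bindFst, doo, eval, proj_one_eval, Tm.fail, Env.cons]

theorem bindSnd_eval (b : Tm) (ρ : Env) : b.bindSnd.eval ρ = (b.eval ρ).bind (onSum
    (onSum (fun _ => Dist.pure (Val.inr Val.star)) fun a => Dist.pure (Val.inl a))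
    fun _ => Dist.pure (Val.inr Val.star)) := by
  simp [bindSnd, doo, eval, proj_two_eval, Tm.fail, Env.cons]

theorem bindNabla_eval (b : Tm) (ρ : Env) : b.bindNabla.eval ρ = (b.eval ρ).bind (onSum
    (onSum (fun a => Dist.pure (Val.inl a)) fun a => Dist.pure (Val.inl a))
    fun _ => Dist.pure (Val.inr Val.star)) := by
  simp [bindNabla, doo, ret, nabla, ncase, inst, shiftUnder, Tm.rename, upr, Tm.subst, scons,
    eval, Tm.fail, Env.cons, onSum_bind]

theorem mem_bound {A : Ty C} {v : Val} (h : (Ty.part (.sum A A)).Mem v) :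
    (∃ a, A.Mem a ∧ v = Val.inl (Val.inl a)) ∨ (∃ a, A.Mem a ∧ v = Val.inl (Val.inr a)) ∨
      v = Val.inr Val.star := by
  rcases mem_part h with ⟨w, hw, rfl⟩ | rfl
  · match w, hw with
    | .inl a, ha => exact .inl ⟨a, ha, rfl⟩
    | .inr a, ha => exact .inr (.inl ⟨a, ha, rfl⟩)
  · exact .inr (.inr rfl)

theorem bindFst_apply {A : Ty C} {b : Tm} {ρ : Env} (h : IsProb (Ty.part (.sum A A)).Mem (b.eval ρ))
    (a : Val) : b.bindFst.eval ρ (Val.inl a) = b.eval ρ (Val.inl (Val.inl a)) := by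
  rw [bindFst_eval]
  refine bind_apply_of_unique (pure_self _) fun v hv hne => ?_
  rcases mem_bound (h.mem v hv) with ⟨a', -, rfl⟩ | ⟨a', -, rfl⟩ | rfl
  · exact pure_of_ne fun e => hne (by cases e; rfl)
  · exact pure_of_ne (by rintro ⟨⟩)
  · exact pure_of_ne (by rintro ⟨⟩)

theorem bindSnd_apply {A : Ty C} {b : Tm} {ρ : Env} (h : IsProb (Ty.part (.sum A A)).Mem (b.eval ρ))
    (a : Val) : b.bindSnd.eval ρ (Val.inl a) = b.eval ρ (Val.inl (Val.inr a)) := by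
  rw [bindSnd_eval]
  refine bind_apply_of_unique (pure_self _) fun v hv hne => ?_
  rcases mem_bound (h.mem v hv) with ⟨a', -, rfl⟩ | ⟨a', -, rfl⟩ | rfl
  · exact pure_of_ne (by rintro ⟨⟩)
  · exact pure_of_ne fun e => hne (by cases e; rfl)
  · exact pure_of_ne (by rintro ⟨⟩)

theorem bind_onSum_const (μ ν : Dist) : (μ.bind (onSum (fun _ => ν) fun _ => 0)) =
    (μ.bind (onSum Dist.pure fun _ => 0)).total • ν := by
  rw [← Dist.bind_const, bind_bind]
  simp only [onSum_bind, Dist.pure_bind, zero_bind]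

theorem isProb_coin {p : ℚ} (h0 : 0 ≤ p) (h1 : p ≤ 1) : IsProb (Ty.two : Ty C).Mem
    (p • Dist.pure (Val.inl Val.star) + (1 - p) • Dist.pure (Val.inr Val.star)) := by
  refine ⟨fun v => ?_, fun v hv => ?_, ?_⟩
  · simp only [Finsupp.add_apply, Finsupp.smul_apply, smul_eq_mul]
    have := pure_nonneg (Val.inl Val.star) v
    have := pure_nonneg (Val.inr Val.star) v
    have := sub_nonneg.mpr h1
    positivity
  · by_contra hm
    refine hv ?_
    simp only [Finsupp.add_apply, Finsupp.smul_apply]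
    rw [pure_of_ne, pure_of_ne, smul_zero, smul_zero, add_zero]
    · rintro rfl; exact hm trivial
    · rintro rfl; exact hm trivial
  · simp

theorem div_nat_le_one {m n : ℕ} (h : m ≤ n) : (m : ℚ) / n ≤ 1 :=
  div_le_one_of_le₀ (by exact_mod_cast h) (Nat.cast_nonneg n)

theorem isProb_oneOver {n : ℕ} (hn : 2 ≤ n) (ρ : Env) :
    IsProb (Ty.two : Ty C).Mem ((oneOver n).eval ρ) := by
  refine isProb_coin (by positivity) ?_
  exact_mod_cast div_nat_le_one (by omega : 1 ≤ n)

theorem isProb_bound {m n : ℕ} (hmn : m < n) (ρ : Env) :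
    IsProb (Ty.fin 3 : Ty C).Mem ((bound m n).eval ρ) := by
  have h1 : ((m : ℚ) + 1) / n ≤ 1 := by exact_mod_cast div_nat_le_one hmn
  refine ⟨fun v => ?_, fun v hv => ?_, ?_⟩
  · simp only [eval, Finsupp.add_apply, Finsupp.smul_apply, smul_eq_mul]
    have := pure_nonneg (Val.inl (Val.inl Val.star)) v
    have := pure_nonneg (Val.inl (Val.inr Val.star)) v
    have := pure_nonneg (Val.inr Val.star) v
    have := sub_nonneg.mpr h1
    positivity
  · by_contra hm
    refine hv ?_
    simp only [eval, Finsupp.add_apply, Finsupp.smul_apply]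
    rw [pure_of_ne, pure_of_ne, pure_of_ne, smul_zero, smul_zero, smul_zero, add_zero, add_zero]
    · rintro rfl; exact hm trivial
    · rintro rfl; exact hm trivial
    · rintro rfl; exact hm trivial
  · simp only [eval, total_add, total_smul, total_pure]
    ring

theorem times_eval (t : Tm) (ρ : Env) : ∀ m, (times (m + 1) t).eval ρ =
    (m + 1 : ℚ) • t.eval ρ - (m : ℚ) • Dist.pure (Val.inr Val.star)
  | 0 => by simp [times]
  | m + 1 => by
    rw [times, eval, times_eval t ρ m]
    push_cast
    module

/-- The term `m · (1 / n)` denotes a coin with bias `m / n`. For `m > n` this is an identity between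
formal combinations only. -/
theorem times_oneOver_eval {m n : ℕ} (ρ : Env) : (times m (oneOver n)).eval ρ =
    (m / n : ℚ) • Dist.pure (Val.inl Val.star) +
      (1 - m / n : ℚ) • Dist.pure (Val.inr Val.star) := by
  match m with
  | 0 => simp [times, Tm.fail, eval]
  | m + 1 =>
    rw [times_eval, eval]
    push_cast
    module

theorem admissible_instr {Γ : Ctx C} {A : Ty C} {s t : Tm} {n : ℕ}
    (ht : Admissible (Ctx.empty.cons A) (Ty.fin n : Ty C).Mem t.eval)
    (hs : Admissible Γ A.Mem s.eval) :
    Admissible Γ (Ty.copower n A).Mem (Tm.instr t s).eval :=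
  .bind (split_empty Γ) hs fun _ ha => .bind_kernel (ht.cons_pure ha) fun _ hk =>
    .pure (mem_graft ha hk)

namespace Jdg.Holds

variable {Γ Δ Ξ ΔΘ Θ : Ctx C} {A B D A' B' : Ty C} {r s t s' t' r' : Tm}

/-- It is enough to compare both sides with a third function that is known to be admissible. -/
theorem eq_of_eval {F : Env → Dist} (hF : Admissible Γ A.Mem F)
    (hs : ∀ ρ, Models Γ ρ → s.eval ρ = F ρ) (ht : ∀ ρ, Models Γ ρ → t.eval ρ = F ρ) :
    Holds Γ (eq s t A) :=
  ⟨hF.congr fun hρ => (hs _ hρ).symm, fun ρ hρ => (hs ρ hρ).trans (ht ρ hρ).symm⟩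

theorem right (h : Holds Γ (eq s t A)) : Admissible Γ A.Mem t.eval :=
  Admissible.congr h.1 fun hρ => h.2 _ hρ

theorem pairEq (hs : Ξ.Split Γ Δ) (h : Holds Γ (eq s s' A)) (h' : Holds Δ (eq t t' B)) :
    Holds Ξ (eq (Tm.pair s t) (Tm.pair s' t') (.tensor A B)) :=
  ⟨.pair hs h.1 h'.1, fun ρ hρ => by
    simp only [eval, h.2 ρ (hρ.left hs), h'.2 ρ (hρ.right hs)]⟩

theorem lettEq (hs : Ξ.Split Γ Δ) (h : Holds Γ (eq s s' (.tensor A B)))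
    (h' : Holds ((Δ.cons A).cons B) (eq t t' D)) :
    Holds Ξ (eq (Tm.lett s t) (Tm.lett s' t') D) :=
  ⟨.lett hs h.1 h'.1, fun ρ hρ => by
    rw [eval, eval, ← h.2 ρ (hρ.left hs)]
    exact (h.1.prob (hρ.left hs)).bind_onPair_congr fun a b ha hb =>
      h'.2 _ (((hρ.right hs).cons (.pure ha)).cons (.pure hb))⟩

theorem caseEq (hs : Ξ.Split Γ Δ) (h : Holds Γ (eq r r' (.sum A B)))
    (h1 : Holds (Δ.cons A) (eq s s' D)) (h2 : Holds (Δ.cons B) (eq t t' D)) :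
    Holds Ξ (eq (Tm.caseOf r s t) (Tm.caseOf r' s' t') D) :=
  ⟨.caseOf hs h.1 h1.1 h2.1, fun ρ hρ => by
    rw [eval, eval, ← h.2 ρ (hρ.left hs)]
    exact (h.1.prob (hρ.left hs)).bind_onSum_congr
      (fun a ha => h1.2 _ ((hρ.right hs).cons (.pure ha)))
      (fun b hb => h2.2 _ ((hρ.right hs).cons (.pure hb)))⟩

theorem betaPair (hs : Ξ.Split Γ ΔΘ) (hs' : ΔΘ.Split Δ Θ) (hr : Admissible Γ A.Mem r.eval)
    (h : Admissible Δ B.Mem s.eval) (ht : Admissible ((Θ.cons A).cons B) D.Mem t.eval) :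
    Holds Ξ (eq (Tm.lett (Tm.pair r s) t) (t.instTwo r s) D) := by
  refine eq_of_eval (F := fun ρ => (r.eval ρ).bind fun a => (s.eval ρ).bind fun b =>
    t.eval (Env.cons (Dist.pure b) (Env.cons (Dist.pure a) ρ))) ?_ (fun ρ hρ => ?_) (fun ρ hρ => ?_)
  · exact .bind hs hr fun a ha => .bind hs' h fun b hb => (ht.cons_pure hb).cons_pure ha
  · simp only [eval, bind_bind, Dist.pure_bind, onPair_pair]
  · have hr' := hr.prob (hρ.left hs)
    have h' := h.prob ((hρ.right hs).left hs')
    have hρ' := (hρ.right hs).right hs'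
    rw [eval_instTwo, ht.toMultilinear.cons_eq (hρ'.cons hr') h', bind_comm]
    exact h'.bind_congr fun b hb => ((ht.cons_pure hb).toMultilinear).cons_eq hρ' hr'

theorem etaPair (h : Admissible Γ (Ty.tensor A B).Mem t.eval) :
    Holds Γ (eq (Tm.lett t (Tm.pair (.var 1) (.var 0))) t (.tensor A B)) := by
  refine eq_of_eval h (fun ρ hρ => ?_) fun _ _ => rfl
  simp only [eval, Env.cons, Dist.pure_bind]
  conv_rhs => rw [← bind_pure (t.eval ρ)]
  exact (h.prob hρ).bind_congr fun
    | .pair a b, _ => rfl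

theorem letLet (hs : Ξ.Split Γ ΔΘ) (hs' : ΔΘ.Split Δ Θ)
    (hr : Admissible Γ (Ty.tensor A B).Mem r.eval)
    (h : Admissible ((Δ.cons A).cons B) (Ty.tensor A' B').Mem s.eval)
    (ht : Admissible ((Θ.cons A').cons B') D.Mem t.eval) :
    Holds Ξ (eq (Tm.lett (Tm.lett r s) t)
      (Tm.lett r (Tm.lett s t.shiftUnderTwo.shiftUnderTwo)) D) := by
  refine eq_of_eval (F := fun ρ => (r.eval ρ).bind (onPair fun a b =>
    (s.eval (Env.cons (Dist.pure b) (Env.cons (Dist.pure a) ρ))).bind (onPair fun a' b' =>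
      t.eval (Env.cons (Dist.pure b') (Env.cons (Dist.pure a') ρ))))) ?_
    (fun ρ hρ => ?_) (fun ρ hρ => ?_)
  · exact .bind hs hr (.onPair fun a b ha hb => .bind hs' ((h.cons_pure hb).cons_pure ha)
      (.onPair fun a' b' ha' hb' => (ht.cons_pure hb').cons_pure ha'))
  · simp only [eval, bind_bind, onPair_bind]
  · simp only [eval, eval_shiftUnderTwo]

theorem letPair (hs : Ξ.Split Γ ΔΘ) (hs' : ΔΘ.Split Δ Θ)
    (hr : Admissible Γ (Ty.tensor A B).Mem r.eval)
    (h : Admissible ((Δ.cons A).cons B) A'.Mem s.eval) (ht : Admissible Θ B'.Mem t.eval) :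
    Holds Ξ (eq (Tm.pair (Tm.lett r s) t) (Tm.lett r (Tm.pair s t.shift.shift))
      (.tensor A' B')) := by
  refine eq_of_eval (F := fun ρ => (r.eval ρ).bind (onPair fun a b =>
    (s.eval (Env.cons (Dist.pure b) (Env.cons (Dist.pure a) ρ))).bind fun a' =>
      (t.eval ρ).bind fun b' => Dist.pure (Val.pair a' b'))) ?_
    (fun ρ hρ => ?_) (fun ρ hρ => ?_)
  · exact .bind hs hr (.onPair fun a b ha hb => .bind hs' ((h.cons_pure hb).cons_pure ha)
      fun a' ha' => .bind_kernel ht fun b' hb' => .pure ⟨ha', hb'⟩)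
  · simp only [eval, bind_bind, onPair_bind]
  · simp only [eval, eval_shift]

theorem betaInl (hs : Ξ.Split Γ Δ) (hr : Admissible Γ A.Mem r.eval)
    (h : Admissible (Δ.cons A) D.Mem s.eval) (h' : Admissible (Δ.cons B) D.Mem t.eval) :
    Holds Ξ (eq (Tm.caseOf (Tm.inl r) s t) (s.inst r) D) :=
  ⟨.caseOf hs hr.inl h h', fun ρ hρ => by
    rw [eval_inst, h.toMultilinear.cons_eq (hρ.right hs) (hr.prob (hρ.left hs))]
    simp only [eval, bind_bind, Dist.pure_bind, onSum_inl]⟩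

theorem betaInr (hs : Ξ.Split Γ Δ) (hr : Admissible Γ B.Mem r.eval)
    (h : Admissible (Δ.cons A) D.Mem s.eval) (h' : Admissible (Δ.cons B) D.Mem t.eval) :
    Holds Ξ (eq (Tm.caseOf (Tm.inr r) s t) (t.inst r) D) :=
  ⟨.caseOf hs hr.inr h h', fun ρ hρ => by
    rw [eval_inst, h'.toMultilinear.cons_eq (hρ.right hs) (hr.prob (hρ.left hs))]
    simp only [eval, bind_bind, Dist.pure_bind, onSum_inr]⟩

theorem etaSum (h : Admissible Γ (Ty.sum A B).Mem t.eval) :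
    Holds Γ (eq (Tm.caseOf t (Tm.inl (.var 0)) (Tm.inr (.var 0))) t (.sum A B)) := by
  refine eq_of_eval h (fun ρ hρ => ?_) fun _ _ => rfl
  simp only [eval, Env.cons, Dist.pure_bind]
  exact (h.prob hρ).bind_onSum_eta

theorem caseCase (hs : Ξ.Split Γ ΔΘ) (hs' : ΔΘ.Split Δ Θ)
    (hr : Admissible Γ (Ty.sum A B).Mem r.eval)
    (h : Admissible (Δ.cons A) (Ty.sum A' B').Mem s.eval)
    (h' : Admissible (Δ.cons B) (Ty.sum A' B').Mem s'.eval)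
    (ht : Admissible (Θ.cons A') D.Mem t.eval) (ht' : Admissible (Θ.cons B') D.Mem t'.eval) :
    Holds Ξ (eq (Tm.caseOf (Tm.caseOf r s s') t t')
      (Tm.caseOf r (Tm.caseOf s t.shiftUnder t'.shiftUnder)
        (Tm.caseOf s' t.shiftUnder t'.shiftUnder)) D) := by
  refine eq_of_eval (F := fun ρ => (r.eval ρ).bind (onSum
    (fun a => (s.eval (Env.cons (Dist.pure a) ρ)).bind (onSum
      (fun a' => t.eval (Env.cons (Dist.pure a') ρ)) fun b' => t'.eval (Env.cons (Dist.pure b') ρ)))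
    (fun b => (s'.eval (Env.cons (Dist.pure b) ρ)).bind (onSum
      (fun a' => t.eval (Env.cons (Dist.pure a') ρ))
      fun b' => t'.eval (Env.cons (Dist.pure b') ρ))))) ?_
    (fun ρ hρ => ?_) (fun ρ hρ => ?_)
  · have hk := Admissible.onSum (fun a' ha' => ht.cons_pure ha') fun b' hb' => ht'.cons_pure hb'
    exact .bind hs hr (.onSum (fun a ha => .bind hs' (h.cons_pure ha) hk)
      fun b hb => .bind hs' (h'.cons_pure hb) hk)
  · simp only [eval, bind_bind, onSum_bind]
  · simp only [eval, eval_shiftUnder]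

theorem casePair (hs : Ξ.Split Γ ΔΘ) (hs' : ΔΘ.Split Δ Θ)
    (hr : Admissible Γ (Ty.sum A B).Mem r.eval) (h : Admissible (Δ.cons A) A'.Mem s.eval)
    (h' : Admissible (Δ.cons B) A'.Mem s'.eval) (ht : Admissible Θ B'.Mem t.eval) :
    Holds Ξ (eq (Tm.pair (Tm.caseOf r s s') t)
      (Tm.caseOf r (Tm.pair s t.shift) (Tm.pair s' t.shift)) (.tensor A' B')) := by
  refine eq_of_eval (F := fun ρ => (r.eval ρ).bind (onSum
    (fun a => (s.eval (Env.cons (Dist.pure a) ρ)).bind fun a' =>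
      (t.eval ρ).bind fun b' => Dist.pure (Val.pair a' b'))
    (fun b => (s'.eval (Env.cons (Dist.pure b) ρ)).bind fun a' =>
      (t.eval ρ).bind fun b' => Dist.pure (Val.pair a' b')))) ?_
    (fun ρ hρ => ?_) (fun ρ hρ => ?_)
  · have hk : ∀ a', A'.Mem a' → Admissible Θ (Ty.tensor A' B').Mem fun ρ =>
        (t.eval ρ).bind fun b' => Dist.pure (Val.pair a' b') := fun a' ha' =>
      .bind_kernel ht fun b' hb' => .pure ⟨ha', hb'⟩
    exact .bind hs hr (.onSum (fun a ha => .bind hs' (h.cons_pure ha) hk)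
      fun b hb => .bind hs' (h'.cons_pure hb) hk)
  · simp only [eval, bind_bind, onSum_bind]
  · simp only [eval, eval_shift]

theorem letCase (hs : Ξ.Split Γ ΔΘ) (hs' : ΔΘ.Split Δ Θ)
    (hr : Admissible Γ (Ty.sum A B).Mem r.eval)
    (h : Admissible (Δ.cons A) (Ty.tensor A' B').Mem s.eval)
    (h' : Admissible (Δ.cons B) (Ty.tensor A' B').Mem s'.eval)
    (ht : Admissible ((Θ.cons A').cons B') D.Mem t.eval) :
    Holds Ξ (eq (Tm.lett (Tm.caseOf r s s') t)
      (Tm.caseOf r (Tm.lett s t.shiftUnderTwo) (Tm.lett s' t.shiftUnderTwo)) D) := by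
  refine eq_of_eval (F := fun ρ => (r.eval ρ).bind (onSum
    (fun a => (s.eval (Env.cons (Dist.pure a) ρ)).bind (onPair fun a' b' =>
      t.eval (Env.cons (Dist.pure b') (Env.cons (Dist.pure a') ρ))))
    (fun b => (s'.eval (Env.cons (Dist.pure b) ρ)).bind (onPair fun a' b' =>
      t.eval (Env.cons (Dist.pure b') (Env.cons (Dist.pure a') ρ)))))) ?_
    (fun ρ hρ => ?_) (fun ρ hρ => ?_)
  · have hk := Admissible.onPair fun a' b' ha' hb' => (ht.cons_pure hb').cons_pure ha'
    exact .bind hs hr (.onSum (fun a ha => .bind hs' (h.cons_pure ha) hk)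
      fun b hb => .bind hs' (h'.cons_pure hb) hk)
  · simp only [eval, bind_bind, onSum_bind]
  · simp only [eval, eval_shiftUnderTwo]

theorem etaInlr (h : Admissible Γ (Ty.sum A B).Mem t.eval) :
    Holds Γ (eq (Tm.inlr (proj 2 1 t) (proj 2 2 t)) t (.sum A B)) := by
  refine eq_of_eval h (fun ρ hρ => ?_) fun _ _ => rfl
  rw [eval, proj_one_eval, proj_two_eval]
  simp only [bind_bind, onSum_bind, Dist.pure_bind, onSum_inl, onSum_inr]
  rw [bind_onSum_add]
  simp only [add_zero, zero_add]
  exact (h.prob hρ).bind_onSum_eta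

theorem jointMonic (hs : Admissible Γ (Ty.part (.sum A A)).Mem s.eval)
    (ht : Admissible Γ (Ty.part (.sum A A)).Mem t.eval)
    (h1 : Holds Γ (eq s.bindFst t.bindFst A.part)) (h2 : Holds Γ (eq s.bindSnd t.bindSnd A.part)) :
    Holds Γ (eq s t (Ty.part (.sum A A))) :=
  ⟨hs, fun ρ hρ => by
    have ps := hs.prob hρ
    have pt := ht.prob hρ
    refine ps.ext_of_ne pt (Val.inr Val.star) fun w hw => ?_
    have key : (Ty.part (.sum A A)).Mem w → s.eval ρ w = t.eval ρ w := fun hm => by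
      rcases mem_bound hm with ⟨a, -, rfl⟩ | ⟨a, -, rfl⟩ | rfl
      · rw [← bindFst_apply ps, ← bindFst_apply pt, h1.2 ρ hρ]
      · rw [← bindSnd_apply ps, ← bindSnd_apply pt, h2.2 ρ hρ]
      · exact absurd rfl hw
    by_cases hm : (Ty.part (.sum A A)).Mem w
    · exact key hm
    · rw [not_imp_comm.mp (ps.mem w) hm, not_imp_comm.mp (pt.mem w) hm]⟩

theorem leI {b : Tm} (hb : Admissible Γ (Ty.part (.sum A A)).Mem b.eval)
    (h1 : Holds Γ (eq b.bindFst s A.part)) (h2 : Holds Γ (eq b.bindNabla t A.part)) :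
    Holds Γ (le s t A.part) := fun ρ hρ a => by
  have pb := hb.prob hρ
  rw [← h1.2 ρ hρ, ← h2.2 ρ hρ, bindFst_eval, bindNabla_eval, bind_apply, bind_apply]
  refine Finset.sum_le_sum fun v hv => mul_le_mul_of_nonneg_left ?_ (pb.nonneg v)
  rcases mem_bound (pb.mem v (Finsupp.mem_support_iff.mp hv)) with ⟨a', -, rfl⟩ | ⟨a', -, rfl⟩ | rfl
  · exact le_rfl
  · simp only [onSum_inl, onSum_inr]
    rw [pure_of_ne (by rintro ⟨⟩)]
    exact pure_nonneg _ _
  · exact le_rfl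

theorem osumDef {b : Tm} (hb : Admissible Γ (Ty.part (.sum A A)).Mem b.eval)
    (h1 : Holds Γ (eq b.bindFst s A.part)) (h2 : Holds Γ (eq b.bindSnd t A.part)) :
    Holds Γ (eq (Tm.osum s t) b.bindNabla A.part) := by
  refine eq_of_eval (F := fun ρ => (b.eval ρ).bind (onSum
    (onSum (fun a => Dist.pure (Val.inl a)) fun a => Dist.pure (Val.inl a))
    fun _ => Dist.pure (Val.inr Val.star))) (hb.bind_kernel fun v hv => ?_) (fun ρ hρ => ?_)
    fun ρ _ => bindNabla_eval b ρ
  · rcases mem_bound hv with ⟨a, ha, rfl⟩ | ⟨a, ha, rfl⟩ | rfl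
    · exact .pure ha
    · exact .pure ha
    · exact .pure trivial
  · have pb := hb.prob hρ
    have hc := fun K => bind_add (b.eval ρ) K fun _ => Dist.pure (Val.inr Val.star)
    simp only [pb.bind_const] at hc
    rw [eval, ← h1.2 ρ hρ, ← h2.2 ρ hρ, bindFst_eval, bindSnd_eval, sub_eq_iff_eq_add,
      ← bind_add, ← hc]
    refine pb.bind_congr fun v hv => ?_
    rcases mem_bound hv with ⟨a, ha, rfl⟩ | ⟨a, ha, rfl⟩ | rfl
    · rfl
    · exact add_comm _ _
    · rfl

theorem nablaInstr {n : ℕ} (ht : Admissible (Ctx.empty.cons A) (Ty.fin n : Ty C).Mem t.eval)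
    (hs : Admissible Γ A.Mem s.eval) : Holds Γ (eq (nabla n (Tm.instr t s)) s A) := by
  refine eq_of_eval hs (fun ρ hρ => ?_) fun _ _ => rfl
  rw [nabla_eval ((admissible_instr ht hs).prob hρ), eval, bind_bind]
  conv_rhs => rw [← bind_pure (s.eval ρ)]
  refine (hs.prob hρ).bind_congr fun a ha => ?_
  have pk := (ht.cons_pure ha).prob (.empty ρ)
  rw [bind_bind, pk.bind_congr (L := fun _ => Dist.pure a) fun k hk => ?_, pk.bind_const]
  rw [Dist.pure_bind, strip_graft a hk]

theorem instrTest {n : ℕ} (ht : Admissible (Ctx.empty.cons A) (Ty.fin n : Ty C).Mem t.eval)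
    (hs : Admissible Γ A.Mem s.eval) :
    Holds Γ (eq (ind n (Tm.instr t s)) (t.inst s) (.fin n)) := by
  refine eq_of_eval (F := fun ρ => (s.eval ρ).bind fun a => t.eval (Env.cons (Dist.pure a) ρ))
    (.bind (split_empty Γ) hs fun a ha => ht.cons_pure ha) (fun ρ hρ => ?_) fun ρ hρ => ?_
  · rw [ind_eval ((admissible_instr ht hs).prob hρ), eval, bind_bind]
    refine (hs.prob hρ).bind_congr fun a ha => ?_
    have pk := (ht.cons_pure ha).prob (.empty ρ)
    conv_rhs => rw [← bind_pure (t.eval _)]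
    rw [bind_bind]
    refine pk.bind_congr fun k hk => ?_
    rw [Dist.pure_bind, shape_graft a hk]
  · rw [eval_inst, ht.toMultilinear.cons_eq (.empty ρ) (hs.prob hρ)]

/-- If the codiagonal of `t` is the identity, then all possible values of `t` at `a` are of the
form `in_i(a)`, because probabilities cannot cancel; so they are determined by their index. -/
theorem etaInstr {n : ℕ} (ht : Admissible (Ctx.empty.cons A) (Ty.copower n A).Mem t.eval)
    (h : Holds (Ctx.empty.cons A) (eq (nabla n t) (.var 0) A)) (hs : Admissible Γ A.Mem s.eval) :
    Holds Γ (eq (Tm.instr (ind n t) s) (t.inst s) (.copower n A)) := by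
  refine eq_of_eval (F := fun ρ => (s.eval ρ).bind fun a => t.eval (Env.cons (Dist.pure a) ρ))
    (.bind (split_empty Γ) hs fun a ha => ht.cons_pure ha) (fun ρ hρ => ?_) fun ρ hρ => ?_
  · rw [eval]
    refine (hs.prob hρ).bind_congr fun a ha => ?_
    have pk := (ht.cons_pure ha).prob (.empty ρ)
    have hn := h.2 _ ((Models.empty ρ).cons (.pure ha))
    rw [nabla_eval pk] at hn
    rw [ind_eval pk, bind_bind]
    conv_rhs => rw [← bind_pure (t.eval _)]
    refine Dist.bind_congr fun v hv => ?_
    have hne := pk.bind_apply_ne_zero (K := fun v => Dist.pure (strip n v)) (w := strip n v)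
      (fun _ _ => pure_nonneg _ _) hv (by rw [pure_self]; exact one_ne_zero)
    rw [hn] at hne
    have hsa : strip n v = a := eq_of_pure_ne_zero hne
    rw [Dist.pure_bind, ← hsa, graft_strip_shape (pk.mem v hv)]
  · rw [eval_inst, ht.toMultilinear.cons_eq (.empty ρ) (hs.prob hρ)]

theorem instrEq {n : ℕ} (ht : Holds (Ctx.empty.cons A) (eq t t' (.fin n)))
    (hs : Holds Γ (eq s s' A)) :
    Holds Γ (eq (Tm.instr t s) (Tm.instr t' s') (.copower n A)) :=
  ⟨admissible_instr ht.1 hs.1, fun ρ hρ => by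
    rw [eval, eval, ← hs.2 ρ hρ]
    refine (hs.1.prob hρ).bind_congr fun a ha => ?_
    rw [ht.2 _ ((Models.empty ρ).cons (.pure ha))]⟩

/-- Both orders of the two assertions run the two independent tests and succeed if and only if
both tests do. -/
theorem comm {p q : Tm} (hp : Admissible (Ctx.empty.cons A) (Ty.two : Ty C).Mem p.eval)
    (hq : Admissible (Ctx.empty.cons A) (Ty.two : Ty C).Mem q.eval)
    (ht : Admissible Γ A.Mem t.eval) :
    Holds Γ (eq (doo (assert p t) (assert q.shiftUnder (.var 0)))
      (doo (assert q t) (assert p.shiftUnder (.var 0))) A.part) := by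
  have key : ∀ {p q : Tm}, Admissible (Ctx.empty.cons A) (Ty.two : Ty C).Mem p.eval →
      Admissible (Ctx.empty.cons A) (Ty.two : Ty C).Mem q.eval → ∀ ρ, Models Γ ρ →
      (doo (assert p t) (assert q.shiftUnder (.var 0))).eval ρ = (t.eval ρ).bind fun a =>
        (p.eval (Env.cons (Dist.pure a) ρ)).bind fun k =>
        (q.eval (Env.cons (Dist.pure a) ρ)).bind fun l =>
        onSum (fun _ => onSum (fun _ => Dist.pure (Val.inl a))
          (fun _ => Dist.pure (Val.inr Val.star)) l) (fun _ => Dist.pure (Val.inr Val.star)) k := by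
    intro p q hp hq ρ hρ
    have pt := ht.prob hρ
    rw [doo, eval, assert_eval pt fun a ha => (hp.cons_pure ha).prob (.empty ρ), bind_bind]
    refine pt.bind_congr fun a ha => ?_
    have pp := (hp.cons_pure ha).prob (.empty ρ)
    have pq := (hq.cons_pure ha).prob (.empty ρ)
    have hin : (assert q.shiftUnder (.var 0)).eval (Env.cons (Dist.pure a) ρ) =
        (q.eval (Env.cons (Dist.pure a) ρ)).bind
          (onSum (fun _ => Dist.pure (Val.inl a)) fun _ => Dist.pure (Val.inr Val.star)) := by
      have pa : IsProb A.Mem ((Tm.var 0).eval (Env.cons (Dist.pure a) ρ)) := .pure ha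
      rw [assert_eval pa fun b hb => ?_]
      · simp only [eval, Env.cons, Dist.pure_bind, eval_shiftUnder]
      · rw [eval_shiftUnder]
        exact (hq.cons_pure hb).prob (.empty ρ)
    rw [bind_bind]
    refine pp.bind_congr fun
      | .inl b, _ => ?_
      | .inr b, _ => ?_
    · simp only [onSum_inl, Dist.pure_bind]
      rw [hin]
    · simp only [onSum_inr, Dist.pure_bind, Tm.fail, eval]
      exact (pq.bind_const _).symm
  have hF : Admissible Γ A.part.Mem fun ρ => (t.eval ρ).bind fun a =>
        (p.eval (Env.cons (Dist.pure a) ρ)).bind fun k =>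
        (q.eval (Env.cons (Dist.pure a) ρ)).bind fun l =>
        onSum (fun _ => onSum (fun _ => Dist.pure (Val.inl a))
          (fun _ => Dist.pure (Val.inr Val.star)) l)
          (fun _ => Dist.pure (Val.inr Val.star)) k := by
    refine .bind (split_empty Γ) ht fun a ha => .bind (split_empty _) (hp.cons_pure ha)
      fun k hk => .bind_kernel (hq.cons_pure ha) fun l hl => ?_
    match k, l, hk, hl with
    | .inl _, .inl _, _, _ => exact .pure ha
    | .inl _, .inr _, _, _ => exact .pure trivial
    | .inr _, _, _, _ => exact .pure trivial
  refine eq_of_eval hF (fun ρ hρ => key hp hq ρ hρ) fun ρ hρ => ?_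
  rw [key hq hp ρ hρ]
  refine (ht.prob hρ).bind_congr fun a ha => ?_
  rw [bind_comm]
  have pp := (hp.cons_pure ha).prob (.empty ρ)
  have pq := (hq.cons_pure ha).prob (.empty ρ)
  refine pp.bind_congr fun k hk => pq.bind_congr fun l hl => ?_
  match k, l, hk, hl with
  | .inl _, .inl _, _, _ => rfl
  | .inl _, .inr _, _, _ => rfl
  | .inr _, .inl _, _, _ => rfl
  | .inr _, .inr _, _, _ => rfl

theorem betaNorm {n : ℕ} (hn : 2 ≤ n) (ht : Admissible (Ctx.empty : Ctx C) A.part.Mem t.eval)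
    (h : Holds (Ctx.empty : Ctx C) (le (oneOver n) (isInl t) .two)) :
    Holds Γ (eq (doo t (ret (Tm.norm t).shift)) t A.part) := by
  refine eq_of_eval (Admissible.congr (.const Γ (ht.prob (.empty fun _ => 0)))
    fun {ρ} _ => ht.eq_of_empty _ ρ) (fun ρ hρ => ?_) fun ρ _ => ht.eq_of_empty ρ _
  have h0 := total_pos_of_le hn (h ρ (.empty _) Val.star)
  have pt := ht.prob (.empty ρ)
  rw [ht.eq_of_empty _ ρ, ← pt.bind_onSum_part]
  simp only [doo, ret, Tm.fail, eval, eval_shift, Dist.pure_bind, smul_bind]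
  have h1 := bind_onSum_add (t.eval ρ)
    (fun _ => (((t.eval ρ).bind (onSum Dist.pure fun _ => 0)).total⁻¹ •
      ((t.eval ρ).bind (onSum Dist.pure fun _ => 0)).bind fun a => Dist.pure (Val.inl a)))
    (fun _ => 0) (fun _ => 0) fun _ => Dist.pure (Val.inr Val.star)
  simp only [add_zero, zero_add] at h1
  rw [← h1, bind_onSum_const, smul_smul, mul_inv_cancel₀ h0.ne', one_smul, bind_bind]
  simp only [onSum_bind, Dist.pure_bind, zero_bind]

theorem etaNorm {n : ℕ} (hn : 2 ≤ n)
    (h : Holds (Ctx.empty : Ctx C) (le (oneOver n) (isInl t) .two))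
    (hr : Admissible (Ctx.empty : Ctx C) A.Mem r.eval)
    (he : Holds (Ctx.empty : Ctx C) (eq t (doo t (ret r.shift)) A.part)) :
    Holds Γ (eq r (Tm.norm t) A) := by
  refine eq_of_eval (Admissible.congr (.const Γ (hr.prob (.empty fun _ => 0)))
    fun {ρ} _ => hr.eq_of_empty _ ρ) (fun ρ _ => hr.eq_of_empty ρ _) fun ρ hρ => ?_
  have h0 := total_pos_of_le hn (h ρ (.empty _) Val.star)
  have h1 := congrArg (fun μ => μ.bind (onSum Dist.pure fun _ => 0)) (he.2 ρ (.empty ρ))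
  simp only [doo, ret, Tm.fail, eval, eval_shift, bind_bind, onSum_bind, Dist.pure_bind,
    onSum_inl, onSum_inr, Dist.bind_pure, bind_onSum_const] at h1
  rw [eval, h1, total_smul, (hr.prob (.empty ρ)).total, mul_one, smul_smul,
    inv_mul_cancel₀ h0.ne', one_smul, hr.eq_of_empty ρ fun _ => 0]

theorem timesOneOver {n : ℕ} (hn : 2 ≤ n) : Holds Γ (eq (times n (oneOver n)) top .two) := by
  refine eq_of_eval (F := fun _ => Dist.pure (Val.inl Val.star)) (.const Γ (.pure trivial))
    (fun ρ _ => ?_) fun ρ _ => by simp [top, eval]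
  have hn' : (n : ℚ) ≠ 0 := by exact_mod_cast (by omega : n ≠ 0)
  rw [times_oneOver_eval, div_self hn', sub_self, one_smul, zero_smul, add_zero]

theorem divide {n : ℕ} (hn : 2 ≤ n) (ht : Admissible Γ (Ty.two : Ty C).Mem t.eval)
    (h : Holds Γ (eq (times n t) top .two)) : Holds Γ (eq t (oneOver n) .two) :=
  ⟨ht, fun ρ hρ => by
    obtain ⟨k, rfl⟩ : ∃ k, n = k + 1 := ⟨n - 1, by omega⟩
    have h1 := h.2 ρ hρ
    rw [times_eval, sub_eq_iff_eq_add] at h1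
    have hk : (k + 1 : ℚ) ≠ 0 := by positivity
    have h2 : t.eval ρ = (k + 1 : ℚ)⁻¹ • ((k + 1 : ℚ) • t.eval ρ) := by
      rw [smul_smul, inv_mul_cancel₀ hk, one_smul]
    rw [h2, h1]
    simp only [top, eval, Dist.pure_bind]
    have h3 : (1 - 1 / ((k + 1 : ℕ) : ℚ)) = (k + 1 : ℚ)⁻¹ * k := by push_cast; field_simp; ring
    rw [h3, smul_add, smul_smul]
    push_cast
    rw [one_div]⟩

theorem projOneBound {m n : ℕ} (hmn : m < n) :
    Holds Γ (eq (proj 3 1 (bound m n)) (times m (oneOver n)) .two) := by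
  refine eq_of_eval (.const Γ (isProb_coin (p := m / n) (by positivity) (div_nat_le_one hmn.le)))
    (fun ρ _ => ?_) fun ρ _ => times_oneOver_eval ρ
  simp [proj, ncase, inst, shiftUnder, Tm.rename, upr, ret, Tm.fail, Tm.subst, scons, eval,
    Env.cons]
  module

theorem projTwoBound {m n : ℕ} (hm : 1 ≤ m) (hmn : m < n) :
    Holds Γ (eq (proj 3 2 (bound m n)) (oneOver n) .two) := by
  refine eq_of_eval (.const Γ (isProb_oneOver (by omega) fun _ => 0)) (fun ρ _ => ?_)
    fun ρ _ => rfl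
  simp [proj, ncase, inst, shiftUnder, Tm.rename, upr, ret, Tm.fail, Tm.subst, eval,
    Env.cons]
  module

end Jdg.Holds

/-- Soundness of the model. -/
theorem Der.holds {Γ : Ctx C} {J : Jdg C} (h : Der Γ J) : J.Holds Γ := by
  induction h with
  | var h => exact .var h
  | ref _ ih => exact ⟨ih, fun _ _ => rfl⟩
  | sym _ ih => exact ⟨Jdg.Holds.right ih, fun ρ hρ => (ih.2 ρ hρ).symm⟩
  | trans _ _ ih ih' => exact ⟨ih.1, fun ρ hρ => (ih.2 ρ hρ).trans (ih'.2 ρ hρ)⟩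
  | unit => exact .star
  | etaOne _ ih =>
    exact ⟨.star, fun ρ hρ => ((ih.prob hρ).eq_pure fun _ => mem_one.mp).symm⟩
  | pair hs _ _ ih ih' => exact .pair hs ih ih'
  | lett hs _ _ ih ih' => exact .lett hs ih ih'
  | pairEq hs _ _ ih ih' => exact .pairEq hs ih ih'
  | lettEq hs _ _ ih ih' => exact .lettEq hs ih ih'
  | betaPair hs hs' _ _ _ ih ih' ih'' => exact .betaPair hs hs' ih ih' ih''
  | etaPair _ ih => exact .etaPair ih
  | letLet hs hs' _ _ _ ih ih' ih'' => exact .letLet hs hs' ih ih' ih''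
  | letPair hs hs' _ _ _ ih ih' ih'' => exact .letPair hs hs' ih ih' ih''
  | magic _ ih => exact .magic ih
  | etaZero _ _ ih _ => exact ⟨.magic ih, fun ρ hρ => (ih.of_zero hρ).elim⟩
  | inl _ ih => exact .inl ih
  | inr _ ih => exact .inr ih
  | inlEq _ ih => exact ⟨.inl ih.1, fun ρ hρ => by simp only [eval, ih.2 ρ hρ]⟩
  | inrEq _ ih => exact ⟨.inr ih.1, fun ρ hρ => by simp only [eval, ih.2 ρ hρ]⟩
  | caseOf hs _ _ _ ih ih' ih'' => exact .caseOf hs ih ih' ih''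
  | caseEq hs _ _ _ ih ih' ih'' => exact .caseEq hs ih ih' ih''
  | betaInl hs _ _ _ ih ih' ih'' => exact .betaInl hs ih ih' ih''
  | betaInr hs _ _ _ ih ih' ih'' => exact .betaInr hs ih ih' ih''
  | etaSum _ ih => exact .etaSum ih
  | caseCase hs hs' _ _ _ _ _ ih₁ ih₂ ih₃ ih₄ ih₅ => exact .caseCase hs hs' ih₁ ih₂ ih₃ ih₄ ih₅
  | casePair hs hs' _ _ _ _ ih₁ ih₂ ih₃ ih₄ => exact .casePair hs hs' ih₁ ih₂ ih₃ ih₄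
  | letCase hs hs' _ _ _ _ ih₁ ih₂ ih₃ ih₄ => exact .letCase hs hs' ih₁ ih₂ ih₃ ih₄
  | inlr _ _ _ ih₁ ih₂ ih₃ => exact admissible_inlr ih₁ ih₂ ih₃.2
  | inlrEq _ _ _ ih₁ ih₂ ih₃ =>
    exact ⟨admissible_inlr ih₁.1 ih₂.1 ih₃.2, fun ρ hρ => by
      simp only [eval, ih₁.2 ρ hρ, ih₂.2 ρ hρ]⟩
  | betaInlrOne _ _ _ ih₁ ih₂ ih₃ =>
    exact .eq_of_eval ih₁ (fun ρ hρ => proj_one_inlr_eval (ih₁.prob hρ) (ih₃.2 ρ hρ))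
      fun _ _ => rfl
  | betaInlrTwo _ _ _ ih₁ ih₂ ih₃ =>
    exact .eq_of_eval ih₂ (fun ρ hρ => proj_two_inlr_eval (ih₂.prob hρ) (ih₃.2 ρ hρ))
      fun _ _ => rfl
  | etaInlr _ ih => exact .etaInlr ih
  | left _ _ ih ih' => exact admissible_left ih ih'.2
  | leftEq _ _ ih ih' =>
    exact ⟨admissible_left ih.1 ih'.2, fun ρ hρ => by simp only [eval, ih.2 ρ hρ]⟩
  | betaLeft _ _ ih ih' =>
    exact .eq_of_eval ih (fun ρ hρ => inl_left_eval (ih.prob hρ) (ih'.2 ρ hρ)) fun _ _ => rfl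
  | etaLeft _ ih =>
    exact .eq_of_eval ih (fun ρ _ => by
      simp only [eval, bind_bind, Dist.pure_bind, onSum_inl, bind_pure]) fun _ _ => rfl
  | jointMonic _ _ _ _ ih₁ ih₂ ih₃ ih₄ => exact .jointMonic ih₁ ih₂ ih₃ ih₄
  | leI _ _ _ ih₁ ih₂ ih₃ => exact .leI ih₁ ih₂ ih₃
  | osum _ _ _ ih₁ ih₂ ih₃ => exact (Jdg.Holds.osumDef ih₁ ih₂ ih₃).1
  | osumDef _ _ _ ih₁ ih₂ ih₃ => exact .osumDef ih₁ ih₂ ih₃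
  | instr _ _ ih ih' => exact admissible_instr ih ih'
  | nablaInstr _ _ ih ih' => exact .nablaInstr ih ih'
  | instrTest _ _ ih ih' => exact .instrTest ih ih'
  | etaInstr _ _ _ ih₁ ih₂ ih₃ => exact .etaInstr ih₁ ih₂ ih₃
  | instrEq _ _ ih ih' => exact .instrEq ih ih'
  | comm _ _ _ ih₁ ih₂ ih₃ => exact .comm ih₁ ih₂ ih₃
  | oneOver hn => exact .congr (.const _ (isProb_oneOver hn fun _ => 0)) fun _ => rfl
  | timesOneOver hn => exact .timesOneOver hn
  | divide hn _ _ ih ih' => exact .divide hn ih ih'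
  | bound _ hmn => exact .congr (.const _ (isProb_bound hmn fun _ => 0)) fun _ => rfl
  | projOneBound _ hmn => exact .projOneBound hmn
  | projTwoBound hm hmn => exact .projTwoBound hm hmn
  | norm hn _ _ ih ih' => exact admissible_norm hn ih ih'
  | betaNorm hn _ _ ih ih' => exact .betaNorm hn ih ih'
  | etaNorm hn _ _ _ _ _ ih₂ ih₃ ih₄ => exact .etaNorm hn ih₂ ih₃ ih₄

/-! ### Representations of rational numbers -/

/-- The success probabilities of two summands add up to at most `1`, because the failure
probability of their sum is not negative. -/
theorem add_le_one_of_osum {m n l k : ℕ}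
    (h : Der (Ctx.empty : Ctx C)
      (ty (osum (times m (oneOver n)) (times l (oneOver k))) .two)) :
    (m / n : ℚ) + l / k ≤ 1 := by
  have hp := (Admissible.prob (Der.holds h) (.empty fun _ => 0)).nonneg (Val.inr Val.star)
  rw [eval, times_oneOver_eval, times_oneOver_eval] at hp
  have h0 : Dist.pure (Val.inl Val.star) (Val.inr Val.star) = 0 := pure_of_ne (by rintro ⟨⟩)
  simp only [Finsupp.sub_apply, Finsupp.add_apply, Finsupp.smul_apply, smul_eq_mul, h0,
    pure_self] at hp
  linarith

theorem nat_le_of_div_le_one {m n : ℕ} (hn : 2 ≤ n) (h : (m / n : ℚ) ≤ 1) : m ≤ n := by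
  have hn' : (0 : ℚ) < n := by exact_mod_cast (by omega : 0 < n)
  rw [div_le_one hn'] at h
  exact_mod_cast h

/-- Fractions are added over the common denominator `nk`. -/
theorem scalarSum_times_oneOver {m n l k i j : ℕ} (hn : 2 ≤ n) (hk : 2 ≤ k) (hj : 2 ≤ j)
    (hi : i ≤ j) (h : (m / n : ℚ) + l / k = i / j) :
    ScalarSum C (times m (oneOver n)) (times l (oneOver k)) (times i (oneOver j)) := by
  have hn' : (n : ℚ) ≠ 0 := by exact_mod_cast (by omega : n ≠ 0)
  have hk' : (k : ℚ) ≠ 0 := by exact_mod_cast (by omega : k ≠ 0)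
  have hj' : (j : ℚ) ≠ 0 := by exact_mod_cast (by omega : j ≠ 0)
  have h' : (m * k + l * n) * j = i * (n * k) := by
    field_simp at h
    have : ((m * k + n * l) * j : ℚ) = n * k * i := h
    have : (m * k + n * l) * j = n * k * i := by exact_mod_cast this
    linarith
  have hnk : 2 ≤ n * k := by nlinarith
  have hle : m * k + l * n ≤ n * k := by
    by_contra hc
    nlinarith
  have hm : m * k ≤ n * k := by omega
  have hl : l * n ≤ n * k := by omega
  exact ((summable_oneOver hnk).add (isScalar_oneOver hnk) hle).congr
    (times_oneOver_eq hnk hn hm (by ring)) (times_oneOver_eq hnk hk hl (by ring))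
    (times_oneOver_eq hnk hj hle h')

end COMET

theorem mainTheorem10 {C : Type*} (q r : ℚ) (hq : q ∈ Set.Icc (0 : ℚ) 1)
    (hr : r ∈ Set.Icc (0 : ℚ) 1) (s t : COMET.Tm)
    (hs : COMET.Represents q s) (ht : COMET.Represents r t) :
    -- if `q ≤ r` then `⊢ q ≤ r : 𝟐`
    (q ≤ r → COMET.Der (COMET.Ctx.empty (C := C)) (.le s t .two)) ∧
    -- `⊢ q ⊕ r : 𝟐` iff `q + r ≤ 1`
    (COMET.Der (COMET.Ctx.empty (C := C)) (.ty (.osum s t) .two) ↔ q + r ≤ 1) ∧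
    -- in which case `Γ ⊢ q ⊕ r = q + r : 𝟐`
    (q + r ≤ 1 → ∀ v : COMET.Tm, COMET.Represents (q + r) v →
      ∀ Γ : COMET.Ctx C, COMET.Der Γ (.eq (.osum s t) v .two)) ∧
    -- `⊢ q & r = qr : 𝟐`, for scalars and for constant predicates on any type
    (∀ v : COMET.Tm, COMET.Represents (q * r) v →
      COMET.Der (COMET.Ctx.empty (C := C)) (.eq (.scalarProd s t) v .two) ∧
      ∀ A : COMET.Ty C,
        COMET.Der (COMET.Ctx.empty.cons A) (.eq (.seqProd s.shift t.shift) v.shift .two)) := by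
  obtain ⟨m, n, hn, rfl, rfl⟩ := hs
  obtain ⟨l, k, hk, rfl, rfl⟩ := ht
  have hm := COMET.nat_le_of_div_le_one hn hq.2
  have hl := COMET.nat_le_of_div_le_one hk hr.2
  have hn' : (0 : ℚ) < n := by exact_mod_cast (by omega : 0 < n)
  have hk' : (0 : ℚ) < k := by exact_mod_cast (by omega : 0 < k)
  have hnk : 2 ≤ n * k := by nlinarith
  refine ⟨fun hqr => ?_, ⟨COMET.add_le_one_of_osum, fun h => ?_⟩, ?_, ?_⟩
  · -- the difference of the two fractions completes the first to the second
    have hle : m * k ≤ l * n := by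
      rw [div_le_div_iff₀ hn' hk'] at hqr
      exact_mod_cast hqr
    refine (COMET.scalarSum_times_oneOver (l := l * n - m * k) hn hnk hk hl ?_).le _
    push_cast [Nat.cast_sub hle]
    field_simp
    ring
  · refine (COMET.scalarSum_times_oneOver (i := m * k + l * n) hn hk hnk ?_ ?_).osum_ty _
    · rw [div_add_div _ _ hn'.ne' hk'.ne', div_le_one (by positivity)] at h
      have : m * k + n * l ≤ n * k := by exact_mod_cast h
      linarith
    · push_cast
      field_simp
  · rintro h v ⟨i, j, hj, hv, rfl⟩ Γ
    rw [hv] at h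
    exact (COMET.scalarSum_times_oneOver hn hk hj (COMET.nat_le_of_div_le_one hj h) hv).osum_eq Γ
  · rintro v ⟨i, j, hj, hv, rfl⟩
    have hj' : (0 : ℚ) < j := by exact_mod_cast (by omega : 0 < j)
    have hs := COMET.isScalar_times_oneOver (C := C) hn hm
    have ht := COMET.isScalar_times_oneOver (C := C) hk hl
    have e : m * l * j = i * (n * k) := by
      rw [div_mul_div_comm, div_eq_div_iff (by positivity) hj'.ne'] at hv
      exact_mod_cast hv
    have hprod := (COMET.doo_times_oneOver (C := C) hn hk hm hl).trans
      (COMET.times_oneOver_eq hnk hj (Nat.mul_le_mul hm hl) e)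
    constructor
    · rw [COMET.Tm.scalarProd, hs.1.shift_eq, ht.1.shift_eq]
      exact .trans (COMET.doo_assert hs ht .unit) (hprod _)
    · intro A
      rw [hs.1.shift_eq, ht.1.shift_eq, ((COMET.Tm.closed_oneOver j).times i).shift_eq,
        COMET.Tm.seqProd, hs.1.shiftUnder_eq, ht.1.shiftUnder_eq]
      exact .trans (COMET.doo_assert hs ht COMET.var_zero_ty) (hprod _)
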